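/- **Setting.** A *polytope complex* $\mathcal C$ is a small double category such that: vertically it is a preorder with an initial object $\emptyset$, with pullbacks and with a Grothendieck topology; horizontally it is a groupoid; for every vertical $b'\to b$ and horizontal $\sigma:a\to b$ there is a commutative square with a vertical $a'\to a$ and a horizontal $\sigma':a'\to b'$, unique up to unique vertical isomorphism; pulling back along horizontal morphisms preserves covering families; and initial objects may be omitted from covering families. Non-initial objects are called polytopes. Two objects over a common object are disjoint if their vertical pullback is initial. Let $\mathrm{SC}(\mathcal C)$ be the category whose objects are finite families $A=\{a_i\}_{i\in I}$ of polytopes. A morphism $A\to B$ is represented by a diagram $A\xleftarrow{p}A'\xrightarrow{\sigma}B$, where the sub-map $p$ is a map of index sets with vertical morphisms $a'_k\to a_{p(k)}$ such that the members $a'_k$ over the same $a_i$ are pairwise disjoint, and the shuffle $\sigma$ is a map of index sets with horizontal morphisms $a'_k\to b_{\sigma(k)}$. Diagrams are identified along vertical isomorphisms of the $A'$, and composition pulls sub-maps back along shuffles. A morphism is a *cofibration* (resp. a *weak equivalence*) if it has a representative in which $p$ is covering (for every $i$ the members $a'_k$ over $a_i$ form a covering family of $a_i$) and $\sigma$ is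 injective (resp. bijective) on indices. For a cofibration $f:A\to B$ represented by $(p,\sigma)$, let $\operatorname{im}_B(A)=\{b_j\}_{j\in\operatorname{im}\sigma}$ and $B/A=\{b_j\}_{j\notin\operatorname{im}\sigma}$, with its cofiber map $B\to B/A$ and its canonical cofibration $B/A\to B$. For $n\ge 0$ let $F_n\mathrm{SC}(\mathcal C)$ be the category of sequences of cofibrations $A_1\to A_2\to\cdots\to A_n$ and natural maps. Weak equivalences in it are levelwise; $A\to B$ is a cofibration if all $A_i\to B_i$ and all $B_i\cup_{A_i}A_j\to B_j$ ($i<j$) are cofibrations. Let $W_n\mathrm{SC}(\mathcal C)$ be the full subcategory of the sequences of acyclic cofibrations. A morphism $f:A\to B$ of $F_n\mathrm{SC}(\mathcal C)$ is *layered* if for all $i<k$ the induced map $f_k/f_i:A_k/A_i\to B_k/B_i$ commutes with $f_k$ and the canonical cofibrations $A_k/A_i\to A_k$, $B_k/B_i\to B_k$. Let $L_n\mathrm{SC}(\mathcal C)$ be the subcategory of $F_n\mathrm{SC}(\mathcal C)$ of all objects and the layered morphisms. $W_n\mathrm{SC}(\mathcal C)$ and $L_n\mathrm{SC}(\mathcal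 C)$ carry the cofibrations and weak equivalences of $F_n\mathrm{SC}(\mathcal C)$, and products carry the componentwise ones. For $A\in L_n\mathrm{SC}(\mathcal C)$ and $1\le i\le n$ (with $A_0=\emptyset$) the $i$-th strand is $$\mathrm{St}_i(A)=\bigl(A_i/A_{i-1}\to \operatorname{im}_{A_{i+1}}(A_i/A_{i-1})\to\cdots\to\operatorname{im}_{A_n}(A_i/A_{i-1})\bigr)\in W_{n-i+1}\mathrm{SC}(\mathcal C),$$ and layered morphisms are restricted to the strands. Let $\mathrm{St}:L_n\mathrm{SC}(\mathcal C)\to\prod_{m=1}^n W_m\mathrm{SC}(\mathcal C)$ be the functor whose component in $W_m\mathrm{SC}(\mathcal C)$ is $\mathrm{St}_{n-m+1}$. Let $\mathrm{CP}:\prod_{m=1}^n W_m\mathrm{SC}(\mathcal C)\to L_n\mathrm{SC}(\mathcal C)$ send $(X_1,\dots,X_n)$ to the coproduct over $m$ of the sequences obtained from $X_m$ by putting $n-m$ copies of the zero object (the empty family) in front. **Proposition.** For every polytope complex $\mathcal C$ and every $n\ge 0$, the categories $L_n\mathrm{SC}(\mathcal C)$, $W_m\mathrm{SC}(\mathcal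 C)$ for $1\le m\le n$, and $\prod_{m=1}^n W_m\mathrm{SC}(\mathcal C)$ are Waldhausen categories, and $$\mathrm{St}:L_n\mathrm{SC}(\mathcal C)\rightleftarrows\prod_{m=1}^n W_m\mathrm{SC}(\mathcal C):\mathrm{CP}$$ is an exact equivalence: both functors are exact (they preserve zero objects, cofibrations, weak equivalences and pushouts along cofibrations), and they are mutually inverse equivalences of categories, with unit and counit objectwise weak equivalences. -/

import Mathlib

open CategoryTheory CategoryTheory.Limits

universe w v u

set_option linter.checkUnivs false

namespace ScissorsCongruence

/-! ### Polytope complexes -/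

/-- In a preorder with a Grothendieck topology, the family `f` is a covering family of `b`: all its
members lie below `b`, and the sieve on `b` that they generate is a covering sieve. -/
def IsCoveringFamily {X : Type u} [Preorder X] (J : GrothendieckTopology X) {ι : Type w} (b : X)
    (f : ι → X) : Prop :=
  ∃ h : ∀ i, f i ≤ b, Sieve.ofArrows f (fun i => homOfLE (h i)) ∈ J b

/-- A polytope complex: a small double category which is vertically a preorder with an initial
object, pullbacks and a Grothendieck topology, and which is horizontally a groupoid, such that
vertical morphisms can be pulled back along horizontal ones.

As vertical morphisms are unique, a square with horizontal sides `σ' : a' ⟶ b'` (top) and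
`σ : a ⟶ b` (bottom) is determined by `σ'` and `σ`; `Sq σ' σ` says that the vertical sides
`a' ≤ a`, `b' ≤ b` exist and that the square is one of the commutative squares.
Initial objects, pullbacks and pulled-back squares are unique up to a unique vertical
isomorphism, as vertical isomorphisms need not be identities. -/
structure PolytopeComplex where
  /-- objects -/
  Obj : Type u
  /-- vertical morphisms -/
  [vert : Preorder Obj]
  /-- there is a vertically initial object -/
  exists_initial : ∃ x : Obj, IsBot x
  /-- vertical pullbacks (greatest lower bounds of pairs with an upper bound) -/
  exists_pullback : ∀ a b c : Obj, a ≤ c → b ≤ c → ∃ d, IsGLB {a, b} d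
  /-- the vertical Grothendieck topology -/
  topology : GrothendieckTopology Obj
  /-- horizontal morphisms -/
  horiz : Groupoid.{v} Obj
  /-- commutative squares -/
  Sq : ∀ {a' b' a b : Obj}, horiz.Hom a' b' → horiz.Hom a b → Prop
  sq_left : ∀ {a' b' a b : Obj} {σ' : horiz.Hom a' b'} {σ : horiz.Hom a b}, Sq σ' σ → a' ≤ a
  sq_right : ∀ {a' b' a b : Obj} {σ' : horiz.Hom a' b'} {σ : horiz.Hom a b}, Sq σ' σ → b' ≤ b
  /-- identity squares on horizontal morphisms, and vertical composition of squares -/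
  sq_refl : ∀ {a b : Obj} (σ : horiz.Hom a b), Sq σ σ
  sq_trans : ∀ {a'' b'' a' b' a b : Obj} {σ'' : horiz.Hom a'' b''} {σ' : horiz.Hom a' b'}
    {σ : horiz.Hom a b}, Sq σ'' σ' → Sq σ' σ → Sq σ'' σ
  /-- identity squares on vertical morphisms, and horizontal composition of squares -/
  sq_id : ∀ {a' a : Obj}, a' ≤ a → Sq (horiz.id a') (horiz.id a)
  sq_comp : ∀ {a' b' c' a b c : Obj} {σ' : horiz.Hom a' b'} {τ' : horiz.Hom b' c'}
    {σ : horiz.Hom a b} {τ : horiz.Hom b c}, Sq σ' σ → Sq τ' τ →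
    Sq (horiz.comp σ' τ') (horiz.comp σ τ)
  /-- a square with identity vertical sides commutes only if its horizontal sides agree -/
  sq_eq : ∀ {a b : Obj} {σ τ : horiz.Hom a b}, Sq σ τ → σ = τ
  /-- every `b' ≤ b` can be pulled back along every horizontal `σ : a ⟶ b` ... -/
  exists_lift : ∀ {a b b' : Obj} (σ : horiz.Hom a b), b' ≤ b →
    ∃ (a' : Obj) (σ' : horiz.Hom a' b'), Sq σ' σ
  /-- ... uniquely up to vertical isomorphism -/
  lift_unique : ∀ {a b b' a₁ a₂ : Obj} {σ : horiz.Hom a b} {σ₁ : horiz.Hom a₁ b'}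
    {σ₂ : horiz.Hom a₂ b'}, Sq σ₁ σ → Sq σ₂ σ → Sq σ₁ σ₂
  /-- pulling back along a horizontal morphism preserves covering families -/
  covering_lift : ∀ {a b : Obj} (σ : horiz.Hom a b) {ι : Type u} (f g : ι → Obj)
    (τ : ∀ i, horiz.Hom (g i) (f i)), (∀ i, Sq (τ i) σ) →
    IsCoveringFamily topology b f → IsCoveringFamily topology a g
  /-- initial objects can be omitted from covering families -/
  covering_omit : ∀ {b : Obj} {ι : Type u} (f : ι → Obj), IsCoveringFamily topology b f →
    IsCoveringFamily topology b (fun i : {i // ¬ IsBot (f i)} => f i)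

attribute [instance] PolytopeComplex.vert

namespace PolytopeComplex

variable (C : PolytopeComplex.{v, u})

/-- Horizontal morphisms. -/
abbrev Hor (a b : C.Obj) : Type v := C.horiz.Hom a b

/-- Two objects over a common object are disjoint if their vertical pullback (greatest lower bound)
is the vertically initial object, that is, if all common lower bounds are initial. -/
def Disj (a b : C.Obj) : Prop := ∀ x, x ≤ a → x ≤ b → IsBot x

variable {C}

/-- Horizontal composition. -/
abbrev hcomp {a b c : C.Obj} (σ : C.Hor a b) (τ : C.Hor b c) : C.Hor a c := C.horiz.comp σ τ

/-- Horizontal identity. -/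
abbrev hid (a : C.Obj) : C.Hor a a := C.horiz.id a

/-- Horizontal inverse. -/
abbrev hinv {a b : C.Obj} (σ : C.Hor a b) : C.Hor b a := C.horiz.inv σ

theorem hid_hcomp {a b : C.Obj} (σ : C.Hor a b) : hcomp (hid a) σ = σ := C.horiz.id_comp σ

theorem hcomp_hid {a b : C.Obj} (σ : C.Hor a b) : hcomp σ (hid b) = σ := C.horiz.comp_id σ

theorem hassoc {a b c d : C.Obj} (σ : C.Hor a b) (τ : C.Hor b c) (ρ : C.Hor c d) :
    hcomp (hcomp σ τ) ρ = hcomp σ (hcomp τ ρ) := C.horiz.assoc σ τ ρ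

theorem hinv_hcomp {a b : C.Obj} (σ : C.Hor a b) : hcomp (hinv σ) σ = hid b :=
  C.horiz.inv_comp σ

theorem hcomp_hinv {a b : C.Obj} (σ : C.Hor a b) : hcomp σ (hinv σ) = hid a :=
  C.horiz.comp_inv σ

theorem hinv_hinv {a b : C.Obj} (σ : C.Hor a b) : hinv (hinv σ) = σ := by
  rw [← hcomp_hid (hinv (hinv σ)), ← hinv_hcomp σ, ← hassoc, hinv_hcomp, hid_hcomp]

/-- Squares can be inverted horizontally. -/
theorem sq_inv {a b a' b' : C.Obj} {σ' : C.Hor a' b'} {σ : C.Hor a b} (h : C.Sq σ' σ) :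
    C.Sq (hinv σ') (hinv σ) := by
  obtain ⟨d, τ, hτ⟩ := C.exists_lift (hinv σ) (C.sq_left h)
  have h1 : C.Sq (hcomp τ σ') (hid b) := by
    rw [← hinv_hcomp σ]; exact C.sq_comp hτ h
  have h2 : C.Sq (hid b') (hcomp τ σ') := C.lift_unique (C.sq_id (C.sq_right h)) h1
  have h3 : C.Sq (hcomp (hid b') (hinv σ')) (hcomp (hcomp τ σ') (hinv σ')) :=
    C.sq_comp h2 (C.sq_refl (hinv σ'))
  rw [hassoc, hcomp_hinv, hid_hcomp, hcomp_hid] at h3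
  exact C.sq_trans h3 hτ

/-- Lifting of squares along the source. -/
theorem exists_lift_source {a b a' : C.Obj} (σ : C.Hor a b) (h : a' ≤ a) :
    ∃ (b' : C.Obj) (σ' : C.Hor a' b'), C.Sq σ' σ := by
  obtain ⟨b', τ, hτ⟩ := C.exists_lift (hinv σ) h
  refine ⟨b', hinv τ, ?_⟩
  have := sq_inv hτ
  rwa [hinv_hinv] at this

theorem lift_source_unique {a b a' b₁ b₂ : C.Obj} {σ : C.Hor a b} {σ₁ : C.Hor a' b₁}
    {σ₂ : C.Hor a' b₂} (h₁ : C.Sq σ₁ σ) (h₂ : C.Sq σ₂ σ) : C.Sq σ₁ σ₂ := by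
  have := sq_inv (C.lift_unique (sq_inv h₁) (sq_inv h₂))
  rwa [hinv_hinv, hinv_hinv] at this

/-- If the left sides of a square are isomorphic then so are the right sides. -/
theorem sq_le_right {a b a' b' : C.Obj} {σ' : C.Hor a' b'} {σ : C.Hor a b} (h : C.Sq σ' σ)
    (ha : a ≤ a') : b ≤ b' := by
  obtain ⟨c, τ, hτ⟩ := exists_lift_source σ' ha
  exact (C.sq_right (lift_source_unique (C.sq_refl σ) (C.sq_trans hτ h))).trans (C.sq_right hτ)

/-- If the right sides of a square are isomorphic then so are the left sides. -/
theorem sq_le_left {a b a' b' : C.Obj} {σ' : C.Hor a' b'} {σ : C.Hor a b} (h : C.Sq σ' σ)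
    (hb : b ≤ b') : a ≤ a' := sq_le_right (sq_inv h) hb

theorem isBot_of_hor {a b : C.Obj} (σ : C.Hor a b) (h : IsBot a) : IsBot b := by
  obtain ⟨z, hz⟩ := C.exists_initial
  obtain ⟨a', σ', h'⟩ := C.exists_lift σ (hz b)
  intro x
  exact (sq_le_right h' (h a')).trans (hz x)

end PolytopeComplex

open PolytopeComplex

variable {C : PolytopeComplex.{v, u}}

/-! ### Finite families of polytopes, sub-maps and shuffles -/

/-- Finite families of polytopes (non-initial objects) of `C`. These are the objects of
`Tw(C_p)` and of the category `SC(C)`. -/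
structure SC (C : PolytopeComplex.{v, u}) where
  Idx : Type
  [fin : Finite Idx]
  obj : Idx → C.Obj
  polytope : ∀ i, ¬ IsBot (obj i)

attribute [instance] SC.fin

/-- Vertical morphisms of `Tw(C_p)`: a map of index sets and vertical morphisms of `C`. -/
structure TwVert (A B : SC C) where
  toFun : A.Idx → B.Idx
  le : ∀ i, A.obj i ≤ B.obj (toFun i)

/-- Horizontal morphisms of `Tw(C_p)` (shuffles): a map of index sets and horizontal morphisms
of `C`. -/
structure TwHor (A B : SC C) where
  toFun : A.Idx → B.Idx
  hom : ∀ i, C.Hor (A.obj i) (B.obj (toFun i))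

/-- A sub-map: the members of `A` over the same member of `B` are pairwise disjoint. -/
def TwVert.IsSubMap {A B : SC C} (p : TwVert A B) : Prop :=
  ∀ i j, i ≠ j → p.toFun i = p.toFun j → C.Disj (A.obj i) (A.obj j)

/-- For each member `b` of `B`, the members of `A` over `b` are a covering family of `b`.
A covering sub-map is a sub-map with this property. -/
def TwVert.IsCovering {A B : SC C} (p : TwVert A B) : Prop :=
  ∀ j, IsCoveringFamily C.topology (B.obj j) (fun i : {i // p.toFun i = j} => A.obj i)

/-- A diagram `A ⇠ mid → B` in `Tw(C_p)` consisting of a sub-map and a shuffle. -/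
structure Span (A B : SC C) where
  mid : SC C
  p : TwVert mid A
  isSubMap : p.IsSubMap
  σ : TwHor mid B

/-- Two diagrams are equivalent if there is a vertical isomorphism of the middle objects which
commutes with the sub-maps and with the shuffles. -/
def Span.Equiv {A B : SC C} (s t : Span A B) : Prop :=
  ∃ e : s.mid.Idx ≃ t.mid.Idx,
    (∀ k, s.mid.obj k ≤ t.mid.obj (e k) ∧ t.mid.obj (e k) ≤ s.mid.obj k) ∧
    (∀ k, t.p.toFun (e k) = s.p.toFun k) ∧
    (∀ k, t.σ.toFun (e k) = s.σ.toFun k) ∧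
    (∀ k, C.Sq (s.σ.hom k) (t.σ.hom (e k)))

/-- All restrictions of the components of the shuffle of a diagram. -/
def Span.graph {A B : SC C} (s : Span A B) (i : A.Idx) (j : B.Idx) {x y : C.Obj}
    (g : C.Hor x y) : Prop :=
  ∃ k, s.p.toFun k = i ∧ s.σ.toFun k = j ∧ C.Sq g (s.σ.hom k)

theorem Span.graph_self {A B : SC C} (s : Span A B) (k : s.mid.Idx) :
    s.graph (s.p.toFun k) (s.σ.toFun k) (s.σ.hom k) := ⟨k, rfl, rfl, C.sq_refl _⟩

theorem Span.Equiv.graph {A B : SC C} {s t : Span A B} (h : s.Equiv t) (i : A.Idx) (j : B.Idx)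
    {x y : C.Obj} (g : C.Hor x y) : s.graph i j g ↔ t.graph i j g := by
  obtain ⟨e, he, hp, hσ, hsq⟩ := h
  constructor
  · rintro ⟨k, rfl, rfl, hg⟩
    exact ⟨e k, hp k, hσ k, C.sq_trans hg (hsq k)⟩
  · rintro ⟨l, rfl, rfl, hg⟩
    obtain ⟨k, rfl⟩ := e.surjective l
    have hkey : C.Sq (t.σ.hom (e k)) (s.σ.hom k) := by
      have hb : B.obj (s.σ.toFun k) ≤ B.obj (t.σ.toFun (e k)) := by rw [hσ k]
      have aux : ∀ {j j' : B.Idx} (hj : j' = j) (σ : C.Hor (s.mid.obj k) (B.obj j))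
          (τ : C.Hor (t.mid.obj (e k)) (B.obj j')), C.Sq σ τ → C.Sq τ σ := by
        rintro j _ rfl σ τ h
        exact C.lift_unique (C.sq_refl τ) h
      exact aux (hσ k) _ _ (hsq k)
    exact ⟨k, (hp k).symm, (hσ k).symm, C.sq_trans hg hkey⟩

theorem Span.equiv_of_graph {A B : SC C} {s t : Span A B}
    (h : ∀ (i : A.Idx) (j : B.Idx) (x y : C.Obj) (g : C.Hor x y), s.graph i j g ↔ t.graph i j g) :
    s.Equiv t := by
  have hst : ∀ k, ∃ l, t.p.toFun l = s.p.toFun k ∧ t.σ.toFun l = s.σ.toFun k ∧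
      C.Sq (s.σ.hom k) (t.σ.hom l) := fun k => (h _ _ _ _ _).1 (s.graph_self k)
  have hts : ∀ l, ∃ k, s.p.toFun k = t.p.toFun l ∧ s.σ.toFun k = t.σ.toFun l ∧
      C.Sq (t.σ.hom l) (s.σ.hom k) := fun l => (h _ _ _ _ _).2 (t.graph_self l)
  choose f f1 f2 f3 using hst
  choose g g1 g2 g3 using hts
  have gf : ∀ k, g (f k) = k := by
    intro k
    by_contra hne
    refine s.mid.polytope k (s.isSubMap k (g (f k)) (Ne.symm hne) (by rw [g1, f1]) _ le_rfl ?_)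
    exact (C.sq_left (f3 k)).trans (C.sq_left (g3 (f k)))
  have fg : ∀ l, f (g l) = l := by
    intro l
    by_contra hne
    refine t.mid.polytope l (t.isSubMap l (f (g l)) (Ne.symm hne) (by rw [f1, g1]) _ le_rfl ?_)
    exact (C.sq_left (g3 l)).trans (C.sq_left (f3 (g l)))
  refine ⟨⟨f, g, gf, fg⟩, fun k => ⟨C.sq_left (f3 k), ?_⟩, f1, f2, f3⟩
  have := C.sq_left (g3 (f k))
  rwa [gf k] at this

theorem Span.equiv_iff {A B : SC C} {s t : Span A B} : s.Equiv t ↔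
    ∀ (i : A.Idx) (j : B.Idx) (x y : C.Obj) (g : C.Hor x y), s.graph i j g ↔ t.graph i j g :=
  ⟨fun h i j _ _ g => Span.Equiv.graph h i j g, Span.equiv_of_graph⟩

instance Span.setoid (A B : SC C) : Setoid (Span A B) where
  r := Span.Equiv
  iseqv :=
    { refl := fun _ => Span.equiv_iff.2 fun _ _ _ _ _ => Iff.rfl
      symm := fun h => Span.equiv_iff.2 fun i j x y g => (Span.equiv_iff.1 h i j x y g).symm
      trans := fun h h' => Span.equiv_iff.2 fun i j x y g =>
        (Span.equiv_iff.1 h i j x y g).trans (Span.equiv_iff.1 h' i j x y g) }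

/-! ### The category `SC(C)` -/

/-- The identity diagram. -/
def Span.id (A : SC C) : Span A A where
  mid := A
  p := ⟨fun i => i, fun _ => le_rfl⟩
  isSubMap := fun _ _ h h' => absurd h' h
  σ := ⟨fun i => i, fun i => hid (A.obj i)⟩

namespace Span

variable {A B D : SC C}

theorem lift_aux (s : Span A B) (t : Span B D)
    (kl : {kl : s.mid.Idx × t.mid.Idx // s.σ.toFun kl.1 = t.p.toFun kl.2}) :
    ∃ (a' : C.Obj) (σ' : C.Hor a' (t.mid.obj kl.1.2)), C.Sq σ' (s.σ.hom kl.1.1) :=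
  C.exists_lift (s.σ.hom kl.1.1) (by rw [kl.2]; exact t.p.le kl.1.2)

/-- The pullback of the sub-map of `t` along the shuffle of `s`. -/
noncomputable def pullbackMid (s : Span A B) (t : Span B D) : SC C where
  Idx := {kl : s.mid.Idx × t.mid.Idx // s.σ.toFun kl.1 = t.p.toFun kl.2}
  obj := fun kl => (lift_aux s t kl).choose
  polytope := fun kl h =>
    t.mid.polytope kl.1.2 (isBot_of_hor (lift_aux s t kl).choose_spec.choose h)

/-- The shuffle from the pullback to the middle of `t`. -/
noncomputable def pullbackHom (s : Span A B) (t : Span B D) (kl : (pullbackMid s t).Idx) :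
    C.Hor ((pullbackMid s t).obj kl) (t.mid.obj kl.1.2) :=
  (lift_aux s t kl).choose_spec.choose

theorem pullback_sq (s : Span A B) (t : Span B D) (kl : (pullbackMid s t).Idx) :
    C.Sq (pullbackHom s t kl) (s.σ.hom kl.1.1) :=
  (lift_aux s t kl).choose_spec.choose_spec

/-- Composition of diagrams: pull back the sub-map of the second along the shuffle of the first. -/
noncomputable def comp (s : Span A B) (t : Span B D) : Span A D where
  mid := pullbackMid s t
  p := ⟨fun kl => s.p.toFun kl.1.1,
    fun kl => (C.sq_left (pullback_sq s t kl)).trans (s.p.le kl.1.1)⟩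
  isSubMap := by
    rintro ⟨⟨k, l⟩, h⟩ ⟨⟨k', l'⟩, h'⟩ hne hp x hx hx'
    by_cases hk : k = k'
    · subst hk
      have hl : l ≠ l' := by rintro rfl; exact hne rfl
      obtain ⟨y, g, hg⟩ := exists_lift_source (pullbackHom s t ⟨⟨k, l⟩, h⟩) hx
      obtain ⟨y', g', hg'⟩ := exists_lift_source (pullbackHom s t ⟨⟨k, l'⟩, h'⟩) hx'
      have h1 := C.sq_trans hg (pullback_sq s t _)
      have h2 := C.sq_trans hg' (pullback_sq s t _)
      have h3 : y ≤ y' := C.sq_right (lift_source_unique h1 h2)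
      have hy : IsBot y := t.isSubMap l l' hl (h.symm.trans h') y (C.sq_right hg)
        (h3.trans (C.sq_right hg'))
      exact isBot_of_hor (hinv g) hy
    · exact s.isSubMap k k' hk hp x (hx.trans (C.sq_left (pullback_sq s t _)))
        (hx'.trans (C.sq_left (pullback_sq s t _)))
  σ := ⟨fun kl => t.σ.toFun kl.1.2, fun kl => hcomp (pullbackHom s t kl) (t.σ.hom kl.1.2)⟩

theorem graph_id (i j : A.Idx) {x y : C.Obj} (g : C.Hor x y) :
    (Span.id A).graph i j g ↔ i = j ∧ C.Sq g (hid (A.obj i)) := by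
  constructor
  · rintro ⟨k, rfl, rfl, h⟩; exact ⟨rfl, h⟩
  · rintro ⟨rfl, h⟩; exact ⟨i, rfl, rfl, h⟩

theorem graph_comp (s : Span A B) (t : Span B D) (i : A.Idx) (m : D.Idx) {x z : C.Obj}
    (g : C.Hor x z) : (s.comp t).graph i m g ↔
      ∃ (j : B.Idx) (y : C.Obj) (u : C.Hor x y) (v : C.Hor y z),
        hcomp u v = g ∧ s.graph i j u ∧ t.graph j m v := by
  constructor
  · rintro ⟨kl, rfl, rfl, hg⟩
    obtain ⟨y, w, hw⟩ := exists_lift_source (pullbackHom s t kl) (C.sq_left hg)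
    refine ⟨s.σ.toFun kl.1.1, y, w, hcomp (hinv w) g, ?_, ?_, ?_⟩
    · rw [← hassoc, hcomp_hinv, hid_hcomp]
    · exact ⟨kl.1.1, rfl, rfl, C.sq_trans hw (pullback_sq s t kl)⟩
    · refine ⟨kl.1.2, kl.2.symm, rfl, ?_⟩
      have h2 : C.Sq (hcomp (hinv w) g) (hcomp (hinv (pullbackHom s t kl))
          (hcomp (pullbackHom s t kl) (t.σ.hom kl.1.2))) := C.sq_comp (sq_inv hw) hg
      rwa [← hassoc, hinv_hcomp, hid_hcomp] at h2
  · rintro ⟨j, y, w, v, rfl, ⟨k, rfl, rfl, hw⟩, ⟨l, hl, rfl, hv⟩⟩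
    let kl : (pullbackMid s t).Idx := ⟨(k, l), hl.symm⟩
    refine ⟨kl, rfl, rfl, ?_⟩
    obtain ⟨x', w', hw'⟩ := C.exists_lift (pullbackHom s t kl) (C.sq_left hv)
    have h1 : C.Sq w w' := C.lift_unique hw (C.sq_trans hw' (pullback_sq s t kl))
    exact C.sq_comp (C.sq_trans h1 hw') hv

end Span

/-- Morphisms of `SC(C)`: equivalence classes of diagrams. -/
def SC.Hom (A B : SC C) := Quotient (Span.setoid A B)

/-- The class of a diagram. -/
def SC.Hom.mk {A B : SC C} (s : Span A B) : SC.Hom A B := Quotient.mk _ s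

/-- All restrictions of the components of the shuffle of a representing diagram. -/
def SC.Hom.graph {A B : SC C} (f : SC.Hom A B) (i : A.Idx) (j : B.Idx) {x y : C.Obj}
    (g : C.Hor x y) : Prop :=
  Quotient.lift (fun s : Span A B => s.graph i j g)
    (fun _ _ h => propext (Span.Equiv.graph h i j g)) f

theorem SC.Hom.graph_mk {A B : SC C} (s : Span A B) (i : A.Idx) (j : B.Idx) {x y : C.Obj}
    (g : C.Hor x y) : (SC.Hom.mk s).graph i j g ↔ s.graph i j g := Iff.rfl

theorem SC.Hom.ext_graph {A B : SC C} {f f' : SC.Hom A B}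
    (h : ∀ i j (x y : C.Obj) (g : C.Hor x y), f.graph i j g ↔ f'.graph i j g) : f = f' := by
  induction f using Quotient.inductionOn with | _ s
  induction f' using Quotient.inductionOn with | _ t
  exact Quotient.sound (Span.equiv_iff.2 h)

/-- Composition in `SC(C)`. -/
noncomputable def SC.Hom.comp {A B D : SC C} (f : SC.Hom A B) (g : SC.Hom B D) : SC.Hom A D :=
  Quotient.map₂ Span.comp (fun _ _ hs _ _ ht => Span.equiv_iff.2 fun i m x z h => by
    simp only [Span.graph_comp, Span.equiv_iff.1 hs, Span.equiv_iff.1 ht]) f g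

theorem SC.Hom.graph_comp {A B D : SC C} (f : SC.Hom A B) (g : SC.Hom B D) (i : A.Idx)
    (m : D.Idx) {x z : C.Obj} (h : C.Hor x z) : (f.comp g).graph i m h ↔
      ∃ (j : B.Idx) (y : C.Obj) (u : C.Hor x y) (v : C.Hor y z),
        hcomp u v = h ∧ f.graph i j u ∧ g.graph j m v := by
  induction f using Quotient.inductionOn with | _ s
  induction g using Quotient.inductionOn with | _ t
  exact Span.graph_comp s t i m h

theorem SC.Hom.graph_restrict {A B : SC C} {f : SC.Hom A B} {i : A.Idx} {j : B.Idx}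
    {x y x' y' : C.Obj} {g : C.Hor x y} {g' : C.Hor x' y'} (h : f.graph i j g)
    (h' : C.Sq g' g) : f.graph i j g' := by
  induction f using Quotient.inductionOn with | _ s
  obtain ⟨k, hk, hk', hs⟩ := h
  exact ⟨k, hk, hk', C.sq_trans h' hs⟩

/-- Horizontal morphisms which are restrictions of an identity. -/
theorem sq_hid_iff {a x y : C.Obj} {g : C.Hor x y} (h : C.Sq g (hid a)) :
    C.Sq g (hid x) ∧ C.Sq g (hid y) ∧ C.Sq (hid x) g ∧ C.Sq (hid y) g := by
  have hx : C.Sq (hid x) (hid a) := C.sq_id (C.sq_left h)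
  have hy : C.Sq (hid y) (hid a) := C.sq_id (C.sq_right h)
  exact ⟨lift_source_unique h hx, C.lift_unique h hy, lift_source_unique hx h,
    C.lift_unique hy h⟩

theorem SC.Hom.graph_src_le {A B : SC C} {f : SC.Hom A B} {i : A.Idx} {j : B.Idx}
    {x y : C.Obj} {g : C.Hor x y} (h : f.graph i j g) : x ≤ A.obj i ∧ y ≤ B.obj j := by
  induction f using Quotient.inductionOn with | _ s
  obtain ⟨k, rfl, rfl, hs⟩ := h
  exact ⟨(C.sq_left hs).trans (s.p.le k), C.sq_right hs⟩

noncomputable instance : Category (SC C) where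
  Hom := SC.Hom
  id A := SC.Hom.mk (Span.id A)
  comp f g := f.comp g
  id_comp {A B} f := by
    refine SC.Hom.ext_graph fun i j x z h => ?_
    rw [SC.Hom.graph_comp]
    simp only [SC.Hom.graph_mk, Span.graph_id]
    constructor
    · rintro ⟨_, y, w, v, rfl, ⟨rfl, hw⟩, hv⟩
      refine SC.Hom.graph_restrict hv ?_
      have := C.sq_comp (sq_hid_iff hw).2.1 (C.sq_refl v)
      change C.Sq _ (hcomp (hid _) v) at this
      rwa [hid_hcomp] at this
    · intro hh
      exact ⟨i, x, hid x, h, hid_hcomp h, ⟨rfl, C.sq_id (SC.Hom.graph_src_le hh).1⟩, hh⟩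
  comp_id {A B} f := by
    refine SC.Hom.ext_graph fun i j x z h => ?_
    rw [SC.Hom.graph_comp]
    simp only [SC.Hom.graph_mk, Span.graph_id]
    constructor
    · rintro ⟨_, y, w, v, rfl, hw, ⟨rfl, hv⟩⟩
      refine SC.Hom.graph_restrict hw ?_
      have := C.sq_comp (C.sq_refl w) (sq_hid_iff hv).1
      change C.Sq _ (hcomp w (hid _)) at this
      rwa [hcomp_hid] at this
    · intro hh
      exact ⟨j, z, h, hid z, hcomp_hid h, hh, ⟨rfl, C.sq_id (SC.Hom.graph_src_le hh).2⟩⟩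
  assoc {A B D E} f g h := by
    refine SC.Hom.ext_graph fun i j x z q => ?_
    simp only [SC.Hom.graph_comp]
    constructor
    · rintro ⟨j, y, w, v, rfl, ⟨j', y', w', v', rfl, hw', hv'⟩, hv⟩
      exact ⟨j', y', w', hcomp v' v, (hassoc _ _ _).symm, hw', j, y, v', v, rfl, hv', hv⟩
    · rintro ⟨j, y, w, v, rfl, hw, ⟨j', y', w', v', rfl, hw', hv'⟩⟩
      exact ⟨j', y', hcomp w w', v', hassoc _ _ _, ⟨j, y, w, w', rfl, hw, hw'⟩, hv'⟩

/-- The morphism of `SC(C)` represented by a diagram. -/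
def Span.toHom {A B : SC C} (s : Span A B) : A ⟶ B := SC.Hom.mk s

/-! ### Waldhausen categories -/

/-- A category with two distinguished classes of morphisms, the cofibrations and the weak
equivalences. -/
class WaldhausenData (E : Type u) [Category.{v} E] where
  cof : MorphismProperty E
  weq : MorphismProperty E

open WaldhausenData

/-- The axioms of a Waldhausen category (a category with cofibrations and weak equivalences). -/
structure IsWaldhausen (E : Type u) [Category.{v} E] [WaldhausenData E] : Prop where
  hasZeroObject : HasZeroObject E
  cof_of_isIso : ∀ {A B : E} (f : A ⟶ B), IsIso f → cof f
  cof_comp : ∀ {A B D : E} (f : A ⟶ B) (g : B ⟶ D), cof f → cof g → cof (f ≫ g)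
  cof_of_isZero : ∀ {Z A : E} (f : Z ⟶ A), IsZero Z → cof f
  hasPushout : ∀ {A B D : E} (f : A ⟶ B) (g : A ⟶ D), cof f → HasPushout f g
  cof_cobaseChange : ∀ {A B D P : E} {f : A ⟶ B} {g : A ⟶ D} {inl : B ⟶ P} {inr : D ⟶ P},
    IsPushout f g inl inr → cof f → cof inr
  weq_of_isIso : ∀ {A B : E} (f : A ⟶ B), IsIso f → weq f
  weq_comp : ∀ {A B D : E} (f : A ⟶ B) (g : B ⟶ D), weq f → weq g → weq (f ≫ g)
  gluing : ∀ {A B D P A' B' D' P' : E} {f : A ⟶ B} {g : A ⟶ D} {inl : B ⟶ P} {inr : D ⟶ P}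
    {f' : A' ⟶ B'} {g' : A' ⟶ D'} {inl' : B' ⟶ P'} {inr' : D' ⟶ P'}
    (α : A ⟶ A') (β : B ⟶ B') (δ : D ⟶ D') (φ : P ⟶ P'),
    IsPushout f g inl inr → IsPushout f' g' inl' inr' → cof f → cof f' →
    f ≫ β = α ≫ f' → g ≫ δ = α ≫ g' → inl ≫ φ = β ≫ inl' → inr ≫ φ = δ ≫ inr' →
    weq α → weq β → weq δ → weq φ

/-- Exact functors: they preserve zero objects, cofibrations, weak equivalences and pushouts along
cofibrations. -/
structure IsExactFunctor {E : Type*} [Category E] [WaldhausenData E] {E' : Type*} [Category E']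
    [WaldhausenData E'] (F : E ⥤ E') : Prop where
  map_isZero : ∀ {Z : E}, IsZero Z → IsZero (F.obj Z)
  map_cof : ∀ {A B : E} {f : A ⟶ B}, cof f → cof (F.map f)
  map_weq : ∀ {A B : E} {f : A ⟶ B}, weq f → weq (F.map f)
  map_isPushout : ∀ {A B D P : E} {f : A ⟶ B} {g : A ⟶ D} {inl : B ⟶ P} {inr : D ⟶ P},
    cof f → IsPushout f g inl inr →
    IsPushout (F.map f) (F.map g) (F.map inl) (F.map inr)

/-- `F` and `G` form an exact equivalence: they are exact, and they are the two functors of an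
(adjoint) equivalence of categories whose unit and counit are objectwise weak equivalences. -/
structure IsExactEquivalence {E : Type*} [Category E] [WaldhausenData E] {E' : Type*}
    [Category E'] [WaldhausenData E'] (F : E ⥤ E') (G : E' ⥤ E) : Prop where
  exact_functor : IsExactFunctor F
  exact_inverse : IsExactFunctor G
  equivalence : ∃ e : E ≌ E', e.functor = F ∧ e.inverse = G ∧
    (∀ A, weq (e.unit.app A)) ∧ ∀ B, weq (e.counit.app B)

/-- The product of categories with cofibrations and weak equivalences, with componentwise
structure. -/
instance piWaldhausenData {ι : Type*} (E : ι → Type*) [∀ i, Category (E i)]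
    [∀ i, WaldhausenData (E i)] : WaldhausenData (∀ i, E i) where
  cof := fun _ _ f => ∀ i, cof (f i)
  weq := fun _ _ f => ∀ i, weq (f i)

/-- `F_n E`: sequences of `n` objects and `n - 1` composable cofibrations (functors from
`{0 < 1 < ... < n - 1}` to `E` all of whose maps are cofibrations), and all natural maps. -/
abbrev FilteredObj (E : Type*) [Category E] [WaldhausenData E] (n : ℕ) :=
  ObjectProperty.FullSubcategory (fun A : Fin n ⥤ E =>
    ∀ (i j : Fin n) (h : i ⟶ j), cof (A.map h))

/-- Weak equivalences in `F_n E` are levelwise. A map `f : A ⟶ B` is a cofibration if it is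
levelwise a cofibration and if for all `i < j` the map from the pushout of `B i` and `A j` over
`A i` to `B j` is a cofibration. -/
instance filteredWaldhausenData (E : Type*) [Category E] [WaldhausenData E] (n : ℕ) :
    WaldhausenData (FilteredObj E n) where
  cof := fun A B f => (∀ i, cof (f.hom.app i)) ∧ ∀ (i j : Fin n) (h : i < j),
    ∃ (P : E) (inl : B.obj.obj i ⟶ P) (inr : A.obj.obj j ⟶ P) (d : P ⟶ B.obj.obj j),
      IsPushout (f.hom.app i) (A.obj.map (homOfLE h.le)) inl inr ∧
      inl ≫ d = B.obj.map (homOfLE h.le) ∧ inr ≫ d = f.hom.app j ∧ cof d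
  weq := fun _ _ f => ∀ i, weq (f.hom.app i)

/-- `W_n E`: the full subcategory of `F_n E` of sequences of acyclic cofibrations. -/
abbrev AcyclicFilteredObj (E : Type*) [Category E] [WaldhausenData E] (n : ℕ) :=
  ObjectProperty.FullSubcategory (fun A : FilteredObj E n =>
    ∀ (i j : Fin n) (h : i ⟶ j), weq (A.obj.map h))

instance acyclicWaldhausenData (E : Type*) [Category E] [WaldhausenData E] (n : ℕ) :
    WaldhausenData (AcyclicFilteredObj E n) where
  cof := fun _ _ f => cof f.hom
  weq := fun _ _ f => weq f.hom

/-- Cofibrations of `SC(C)` are represented by a covering sub-map and a shuffle which is injective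
on indices; weak equivalences by a covering sub-map and a shuffle which is bijective on indices
(equivalently, invertible). -/
instance scWaldhausenData : WaldhausenData (SC C) where
  cof := fun A B f => ∃ s : Span A B, s.toHom = f ∧ s.p.IsCovering ∧
    Function.Injective s.σ.toFun
  weq := fun A B f => ∃ s : Span A B, s.toHom = f ∧ s.p.IsCovering ∧
    Function.Bijective s.σ.toFun

/-! ### Images, subobjects and quotients in `SC(C)` -/

namespace SC

/-- The set of indices in `B` of the members of the image of `f : A ⟶ B`: if `f` is represented by
the sub-map `p` and the shuffle `σ`, this is the image of `σ`. -/
def im {A B : SC C} (f : A ⟶ B) : Set B.Idx :=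
  {j | ∃ s : Span A B, s.toHom = f ∧ j ∈ Set.range s.σ.toFun}

/-- The subobject of `A` of the members with index in `S`. -/
@[reducible] def restr (A : SC C) (S : Set A.Idx) : SC C where
  Idx := S
  obj := fun i => A.obj i
  polytope := fun i => A.polytope i

/-- The inclusion of a subobject, a pure shuffle. -/
def incl (A : SC C) (S : Set A.Idx) : A.restr S ⟶ A :=
  Span.toHom
    { mid := A.restr S
      p := ⟨fun i => i, fun _ => le_rfl⟩
      isSubMap := fun _ _ h h' => absurd h' h
      σ := ⟨fun i => i.1, fun i => hid (A.obj i.1)⟩ }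

/-- The projection to a subobject, a pure sub-map. -/
def proj (A : SC C) (S : Set A.Idx) : A ⟶ A.restr S :=
  Span.toHom
    { mid := A.restr S
      p := ⟨fun i => i.1, fun _ => le_rfl⟩
      isSubMap := fun _ _ h h' => absurd (Subtype.ext h') h
      σ := ⟨fun i => i, fun i => hid (A.obj i.1)⟩ }

/-- The quotient `B/A` of a cofibration `f : A ⟶ B`: the members of `B` which are not in the
image of `f`. The cofiber map `B ⟶ B/A` is `B.proj (im f)ᶜ`, and the canonical cofibration
`B/A ⟶ B` is `B.incl (im f)ᶜ`. -/
abbrev quot {A B : SC C} (f : A ⟶ B) : SC C := B.restr (im f)ᶜ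

/-- The relation between indices underlying a morphism. -/
def Rel {A B : SC C} (f : A ⟶ B) (i : A.Idx) (j : B.Idx) : Prop :=
  ∃ (x y : C.Obj) (g : C.Hor x y), SC.Hom.graph f i j g

theorem rel_toHom {A B : SC C} (s : Span A B) (i : A.Idx) (j : B.Idx) :
    Rel s.toHom i j ↔ ∃ k, s.p.toFun k = i ∧ s.σ.toFun k = j := by
  constructor
  · rintro ⟨x, y, g, k, h, h', -⟩; exact ⟨k, h, h'⟩
  · rintro ⟨k, rfl, rfl⟩; exact ⟨_, _, _, s.graph_self k⟩

theorem exists_rep {A B : SC C} (f : A ⟶ B) : ∃ s : Span A B, s.toHom = f :=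
  Quotient.exists_rep f

theorem rel_comp {A B D : SC C} (f : A ⟶ B) (g : B ⟶ D) (i : A.Idx) (m : D.Idx) :
    Rel (f ≫ g) i m ↔ ∃ j, Rel f i j ∧ Rel g j m := by
  obtain ⟨s, rfl⟩ := exists_rep f
  obtain ⟨t, rfl⟩ := exists_rep g
  change Rel (s.comp t).toHom i m ↔ _
  rw [rel_toHom]
  constructor
  · rintro ⟨⟨⟨k, l⟩, h⟩, rfl, rfl⟩
    exact ⟨_, (rel_toHom s _ _).2 ⟨k, rfl, rfl⟩, (rel_toHom t _ _).2 ⟨l, h.symm, rfl⟩⟩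
  · rintro ⟨j, hf, hg⟩
    obtain ⟨k, rfl, rfl⟩ := (rel_toHom s _ _).1 hf
    obtain ⟨l, h, rfl⟩ := (rel_toHom t _ _).1 hg
    exact ⟨⟨⟨k, l⟩, h.symm⟩, rfl, rfl⟩

theorem mem_im {A B : SC C} (f : A ⟶ B) (j : B.Idx) : j ∈ im f ↔ ∃ i, Rel f i j := by
  constructor
  · rintro ⟨s, rfl, k, rfl⟩
    exact ⟨_, (rel_toHom s _ _).2 ⟨k, rfl, rfl⟩⟩
  · rintro ⟨i, h⟩
    obtain ⟨s, rfl⟩ := exists_rep f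
    obtain ⟨k, -, rfl⟩ := (rel_toHom s _ _).1 h
    exact ⟨s, rfl, k, rfl⟩

theorem rel_id {A : SC C} (i j : A.Idx) : Rel (𝟙 A) i j ↔ i = j := by
  change Rel (Span.id A).toHom i j ↔ _
  rw [rel_toHom]
  constructor
  · rintro ⟨k, rfl, rfl⟩; rfl
  · rintro rfl; exact ⟨i, rfl, rfl⟩

theorem rel_incl {A : SC C} {S : Set A.Idx} (i : S) (j : A.Idx) :
    Rel (A.incl S) i j ↔ i.1 = j := by
  unfold incl
  rw [rel_toHom]
  constructor
  · rintro ⟨k, rfl, rfl⟩; rfl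
  · rintro rfl; exact ⟨i, rfl, rfl⟩

theorem rel_proj {A : SC C} {S : Set A.Idx} (i : A.Idx) (j : S) :
    Rel (A.proj S) i j ↔ i = j.1 := by
  unfold proj
  rw [rel_toHom]
  constructor
  · rintro ⟨k, rfl, rfl⟩; rfl
  · rintro rfl; exact ⟨j, rfl, rfl⟩

theorem graph_comp {A B D : SC C} (f : A ⟶ B) (g : B ⟶ D) (i : A.Idx) (m : D.Idx)
    {x z : C.Obj} (h : C.Hor x z) : SC.Hom.graph (f ≫ g) i m h ↔
      ∃ (j : B.Idx) (y : C.Obj) (u : C.Hor x y) (v : C.Hor y z),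
        hcomp u v = h ∧ SC.Hom.graph f i j u ∧ SC.Hom.graph g j m v :=
  SC.Hom.graph_comp f g i m h

theorem hom_ext {A B : SC C} {f f' : A ⟶ B}
    (h : ∀ i j (x y : C.Obj) (g : C.Hor x y), SC.Hom.graph f i j g ↔ SC.Hom.graph f' i j g) :
    f = f' := SC.Hom.ext_graph h

theorem graph_incl {A : SC C} {S : Set A.Idx} (i : S) (j : A.Idx) {x y : C.Obj} (g : C.Hor x y) :
    SC.Hom.graph (A.incl S) i j g ↔ i.1 = j ∧ C.Sq g (hid (A.obj i.1)) := by
  constructor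
  · rintro ⟨k, rfl, rfl, h⟩; exact ⟨rfl, h⟩
  · rintro ⟨rfl, h⟩; exact ⟨i, rfl, rfl, h⟩

theorem graph_proj {A : SC C} {S : Set A.Idx} (i : A.Idx) (j : S) {x y : C.Obj} (g : C.Hor x y) :
    SC.Hom.graph (A.proj S) i j g ↔ i = j.1 ∧ C.Sq g (hid (A.obj j.1)) := by
  constructor
  · rintro ⟨k, rfl, rfl, h⟩; exact ⟨rfl, h⟩
  · rintro ⟨rfl, h⟩; exact ⟨j, rfl, rfl, h⟩

theorem graph_comp_incl {A B : SC C} {T : Set B.Idx} (f : A ⟶ B.restr T) (i : A.Idx) (j : B.Idx)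
    {x y : C.Obj} (g : C.Hor x y) :
    SC.Hom.graph (f ≫ B.incl T) i j g ↔ ∃ h : j ∈ T, SC.Hom.graph f i ⟨j, h⟩ g := by
  rw [graph_comp]
  constructor
  · rintro ⟨⟨j', hj⟩, z, p, q, rfl, hf, hq⟩
    rw [graph_incl] at hq
    obtain ⟨rfl, hq⟩ := hq
    refine ⟨hj, SC.Hom.graph_restrict hf ?_⟩
    have := C.sq_comp (C.sq_refl p) (sq_hid_iff hq).1
    change C.Sq _ (hcomp p (hid _)) at this
    rwa [hcomp_hid] at this
  · rintro ⟨hj, hf⟩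
    exact ⟨⟨j, hj⟩, y, g, hid y, hcomp_hid g, hf, (graph_incl _ _ _).2
      ⟨rfl, C.sq_id (SC.Hom.graph_src_le hf).2⟩⟩

theorem graph_comp_proj {A B : SC C} {T : Set B.Idx} (f : A ⟶ B) (i : A.Idx) (j : T)
    {x y : C.Obj} (g : C.Hor x y) :
    SC.Hom.graph (f ≫ B.proj T) i j g ↔ SC.Hom.graph f i j.1 g := by
  rw [graph_comp]
  constructor
  · rintro ⟨j', z, p, q, rfl, hf, hq⟩
    rw [graph_proj] at hq
    obtain ⟨rfl, hq⟩ := hq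
    refine SC.Hom.graph_restrict hf ?_
    have := C.sq_comp (C.sq_refl p) (sq_hid_iff hq).1
    change C.Sq _ (hcomp p (hid _)) at this
    rwa [hcomp_hid] at this
  · intro hf
    exact ⟨j.1, y, g, hid y, hcomp_hid g, hf, (graph_proj _ _ _).2
      ⟨rfl, C.sq_id (SC.Hom.graph_src_le hf).2⟩⟩

theorem graph_incl_comp {A B : SC C} {S : Set A.Idx} (f : A ⟶ B) (i : S) (j : B.Idx)
    {x y : C.Obj} (g : C.Hor x y) :
    SC.Hom.graph (A.incl S ≫ f) i j g ↔ SC.Hom.graph f i.1 j g := by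
  rw [graph_comp]
  constructor
  · rintro ⟨j', z, p, q, rfl, hp, hf⟩
    rw [graph_incl] at hp
    obtain ⟨rfl, hp⟩ := hp
    refine SC.Hom.graph_restrict hf ?_
    have := C.sq_comp (sq_hid_iff hp).2.1 (C.sq_refl q)
    change C.Sq _ (hcomp (hid _) q) at this
    rwa [hid_hcomp] at this
  · intro hf
    exact ⟨i.1, x, hid x, g, hid_hcomp g, (graph_incl _ _ _).2
      ⟨rfl, C.sq_id (SC.Hom.graph_src_le hf).1⟩, hf⟩

theorem graph_proj_comp {A B : SC C} {S : Set A.Idx} (f : A.restr S ⟶ B) (i : A.Idx) (j : B.Idx)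
    {x y : C.Obj} (g : C.Hor x y) :
    SC.Hom.graph (A.proj S ≫ f) i j g ↔ ∃ h : i ∈ S, SC.Hom.graph f ⟨i, h⟩ j g := by
  rw [graph_comp]
  constructor
  · rintro ⟨⟨j', hj⟩, z, p, q, rfl, hp, hf⟩
    rw [graph_proj] at hp
    obtain ⟨rfl, hp⟩ := hp
    refine ⟨hj, SC.Hom.graph_restrict hf ?_⟩
    have := C.sq_comp (sq_hid_iff hp).2.1 (C.sq_refl q)
    change C.Sq _ (hcomp (hid _) q) at this
    rwa [hid_hcomp] at this
  · rintro ⟨hi, hf⟩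
    exact ⟨⟨i, hi⟩, x, hid x, g, hid_hcomp g, (graph_proj _ _ _).2
      ⟨rfl, C.sq_id (SC.Hom.graph_src_le hf).1⟩, hf⟩

theorem incl_proj (A : SC C) (S : Set A.Idx) : A.incl S ≫ A.proj S = 𝟙 _ := by
  refine hom_ext fun i j x y g => ?_
  rw [graph_comp_proj, graph_incl]
  change _ ↔ (Span.id (A.restr S)).graph i j g
  rw [Span.graph_id, Subtype.ext_iff]

theorem rel_of_graph {A B : SC C} {f : A ⟶ B} {i : A.Idx} {j : B.Idx} {x y : C.Obj}
    {g : C.Hor x y} (h : SC.Hom.graph f i j g) : Rel f i j := ⟨x, y, g, h⟩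

/-- A morphism whose image lies in `T` factors through the subobject. -/
theorem comp_proj_incl {A B : SC C} (f : A ⟶ B) (T : Set B.Idx)
    (h : ∀ i j, Rel f i j → j ∈ T) : f ≫ B.proj T ≫ B.incl T = f := by
  rw [← Category.assoc]
  refine hom_ext fun i j x y g => ?_
  rw [graph_comp_incl]
  constructor
  · rintro ⟨hj, hf⟩; exact (graph_comp_proj _ _ _ _).1 hf
  · intro hf; exact ⟨h _ _ (rel_of_graph hf), (graph_comp_proj _ _ _ _).2 hf⟩

theorem proj_incl_comp {A B : SC C} (f : A ⟶ B) (S : Set A.Idx)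
    (h : ∀ i j, Rel f i j → i ∈ S) : A.proj S ≫ A.incl S ≫ f = f := by
  refine hom_ext fun i j x y g => ?_
  rw [graph_proj_comp]
  constructor
  · rintro ⟨hj, hf⟩; exact (graph_incl_comp _ _ _ _).1 hf
  · intro hf; exact ⟨h _ _ (rel_of_graph hf), (graph_incl_comp _ _ _ _).2 hf⟩

/-- The restriction of a morphism to subobjects. -/
noncomputable def restrMap {A B : SC C} (f : A ⟶ B) (S : Set A.Idx) (T : Set B.Idx) :
    A.restr S ⟶ B.restr T := A.incl S ≫ f ≫ B.proj T

theorem rel_restrMap {A B : SC C} (f : A ⟶ B) (S : Set A.Idx) (T : Set B.Idx) (i : S) (j : T) :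
    Rel (restrMap f S T) i j ↔ Rel f i.1 j.1 := by
  simp only [restrMap, rel_comp, rel_incl, rel_proj, exists_eq_left', exists_eq_right]

theorem graph_restrMap {A B : SC C} (f : A ⟶ B) (S : Set A.Idx) (T : Set B.Idx) (i : S) (j : T)
    {x y : C.Obj} (g : C.Hor x y) :
    SC.Hom.graph (restrMap f S T) i j g ↔ SC.Hom.graph f i.1 j.1 g := by
  rw [restrMap, graph_incl_comp, graph_comp_proj]

theorem restrMap_id (A : SC C) (S : Set A.Idx) : restrMap (𝟙 A) S S = 𝟙 _ := by
  rw [restrMap, Category.id_comp, incl_proj]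

theorem restrMap_comp {A B D : SC C} (f : A ⟶ B) (g : B ⟶ D) {S : Set A.Idx} {T : Set B.Idx}
    {R : Set D.Idx} (h : ∀ i j, i ∈ S → Rel f i j → j ∈ T) :
    restrMap f S T ≫ restrMap g T R = restrMap (f ≫ g) S R := by
  have h1 := comp_proj_incl (A.incl S ≫ f) T (fun i j hr => by
    obtain ⟨k, hk, hf⟩ := (rel_comp _ _ _ _).1 hr
    rw [rel_incl] at hk
    subst hk
    exact h _ _ i.2 hf)
  calc restrMap f S T ≫ restrMap g T R
      = ((A.incl S ≫ f) ≫ B.proj T ≫ B.incl T) ≫ g ≫ D.proj R := by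
        simp only [restrMap, Category.assoc]
    _ = restrMap (f ≫ g) S R := by rw [h1]; simp only [restrMap, Category.assoc]

theorem cof_of_weq {A B : SC C} {f : A ⟶ B} (h : weq f) : cof f := by
  obtain ⟨s, hs, hc, hb⟩ := h
  exact ⟨s, hs, hc, hb.1⟩

theorem isCoveringFamily_congr {X : Type*} [Preorder X] {J : GrothendieckTopology X}
    {ι κ : Type*} {b : X} {f : ι → X} {g : κ → X} (e : ι ≃ κ) (h : ∀ i, g (e i) = f i)
    (hf : IsCoveringFamily J b f) : IsCoveringFamily J b g := by
  obtain ⟨hb, hJ⟩ := hf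
  have hg : ∀ k, g k ≤ b := fun k => by
    obtain ⟨i, rfl⟩ := e.surjective k
    rw [h]; exact hb i
  refine ⟨hg, J.superset_covering ?_ hJ⟩
  rw [Sieve.generate_le_iff]
  rintro _ _ ⟨i⟩
  exact ⟨_, homOfLE (h i).ge, homOfLE (hg (e i)), ⟨e i⟩, Subsingleton.elim _ _⟩

/-- A cofibration restricts to a weak equivalence from a subobject to its image. -/
theorem weq_restrMap {A B : SC C} {f : A ⟶ B} (hf : cof f) (S : Set A.Idx) (T : Set B.Idx)
    (h : ∀ j, j ∈ T ↔ ∃ i ∈ S, Rel f i j) : weq (restrMap f S T) := by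
  obtain ⟨s, rfl, hc, hi⟩ := hf
  have hT : ∀ k : {k // s.p.toFun k ∈ S}, s.σ.toFun k.1 ∈ T := fun k =>
    (h _).2 ⟨_, k.2, (rel_toHom s _ _).2 ⟨k.1, rfl, rfl⟩⟩
  let t : Span (A.restr S) (B.restr T) :=
    { mid := s.mid.restr {k | s.p.toFun k ∈ S}
      p := ⟨fun k => ⟨s.p.toFun k.1, k.2⟩, fun k => s.p.le k.1⟩
      isSubMap := fun i j hne hp => s.isSubMap i.1 j.1 (fun hh => hne (Subtype.ext hh))
        (congrArg Subtype.val hp)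
      σ := ⟨fun k => ⟨s.σ.toFun k.1, hT k⟩, fun k => s.σ.hom k.1⟩ }
  refine ⟨t, ?_, ?_, ?_, ?_⟩
  · refine hom_ext fun i j x y g => ?_
    rw [graph_restrMap]
    constructor
    · rintro ⟨k, rfl, rfl, hg⟩; exact ⟨k.1, rfl, rfl, hg⟩
    · rintro ⟨k, hk, hk', hg⟩
      exact ⟨⟨k, by change s.p.toFun k ∈ S; rw [hk]; exact i.2⟩, Subtype.ext hk,
        Subtype.ext hk', hg⟩
  · intro j
    refine isCoveringFamily_congr ?_ ?_ (hc j.1)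
    · exact
        { toFun := fun k => ⟨⟨k.1, by change s.p.toFun k.1 ∈ S; rw [k.2]; exact j.2⟩,
            Subtype.ext k.2⟩
          invFun := fun k => ⟨k.1.1, congrArg Subtype.val k.2⟩
          left_inv := fun _ => rfl
          right_inv := fun _ => rfl }
    · intro i; rfl
  · intro k k' hk
    exact Subtype.ext (hi (congrArg Subtype.val hk))
  · rintro ⟨j, hj⟩
    obtain ⟨i, hiS, hr⟩ := (h j).1 hj
    obtain ⟨k, rfl, rfl⟩ := (rel_toHom s _ _).1 hr
    exact ⟨⟨k, hiS⟩, rfl⟩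

end SC

/-! ### Finite coproducts in `SC(C)` -/

namespace SC

/-- The coproduct of a finite family of objects of `SC(C)`: the disjoint union. -/
@[reducible] def sigma {ι : Type} [Finite ι] (A : ι → SC C) : SC C where
  Idx := Σ i, (A i).Idx
  obj := fun x => (A x.1).obj x.2
  polytope := fun x => (A x.1).polytope x.2

section

variable {ι : Type} [Finite ι] (A : ι → SC C)

/-- The inclusion of a member of a coproduct. -/
def inj (i : ι) : A i ⟶ sigma A :=
  Span.toHom
    { mid := A i
      p := ⟨fun a => a, fun _ => le_rfl⟩
      isSubMap := fun _ _ h h' => absurd h' h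
      σ := ⟨fun a => ⟨i, a⟩, fun a => hid ((A i).obj a)⟩ }

variable {A}

/-- The union of a family of diagrams with a common target. -/
def sigmaSpan {ι' : Type} [Finite ι'] {B : ι' → SC C} (e : ι → ι')
    (s : ∀ i, Span (A i) (B (e i))) : Span (sigma A) (sigma B) where
  mid := sigma fun i => (s i).mid
  p := ⟨fun x => ⟨x.1, (s x.1).p.toFun x.2⟩, fun x => (s x.1).p.le x.2⟩
  isSubMap := by
    rintro ⟨i, a⟩ ⟨j, b⟩ hne hp
    obtain ⟨rfl, h⟩ := Sigma.mk.inj_iff.1 hp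
    exact (s i).isSubMap a b (fun hh => hne (by rw [hh])) (eq_of_heq h)
  σ := ⟨fun x => ⟨e x.1, (s x.1).σ.toFun x.2⟩, fun x => (s x.1).σ.hom x.2⟩

/-- The morphism of coproducts with the components `f i : A i ⟶ B (e i)`. -/
noncomputable def sigmaMap {ι' : Type} [Finite ι'] {B : ι' → SC C} (e : ι → ι')
    (f : ∀ i, A i ⟶ B (e i)) : sigma A ⟶ sigma B :=
  (sigmaSpan e fun i => (exists_rep (f i)).choose).toHom

theorem graph_inj (i : ι) (a : (A i).Idx) (x : (sigma A).Idx) {u v : C.Obj} (g : C.Hor u v) :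
    SC.Hom.graph (inj A i) a x g ↔ (⟨i, a⟩ : Σ i, (A i).Idx) = x ∧ C.Sq g (hid ((A i).obj a)) := by
  constructor
  · rintro ⟨k, rfl, rfl, h⟩; exact ⟨rfl, h⟩
  · rintro ⟨rfl, h⟩; exact ⟨a, rfl, rfl, h⟩

theorem graph_sigmaSpan {ι' : Type} [Finite ι'] {B : ι' → SC C} (e : ι → ι')
    (s : ∀ i, Span (A i) (B (e i))) (i : ι) (a : (A i).Idx) (y : (sigma B).Idx) {u v : C.Obj}
    (g : C.Hor u v) :
    SC.Hom.graph (sigmaSpan e s).toHom (⟨i, a⟩ : Σ i, (A i).Idx) y g ↔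
      ∃ b, (⟨e i, b⟩ : Σ i, (B i).Idx) = y ∧ SC.Hom.graph (s i).toHom a b g := by
  constructor
  · rintro ⟨⟨i', k⟩, h, rfl, hg⟩
    obtain ⟨rfl, h'⟩ := Sigma.mk.inj_iff.1 h
    exact ⟨_, rfl, k, eq_of_heq h', rfl, hg⟩
  · rintro ⟨b, rfl, k, rfl, rfl, hg⟩
    exact ⟨⟨i, k⟩, rfl, rfl, hg⟩

theorem graph_sigmaMap {ι' : Type} [Finite ι'] {B : ι' → SC C} (e : ι → ι')
    (f : ∀ i, A i ⟶ B (e i)) (i : ι) (a : (A i).Idx) (y : (sigma B).Idx) {u v : C.Obj}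
    (g : C.Hor u v) :
    SC.Hom.graph (sigmaMap e f) (⟨i, a⟩ : Σ i, (A i).Idx) y g ↔
      ∃ b, (⟨e i, b⟩ : Σ i, (B i).Idx) = y ∧ SC.Hom.graph (f i) a b g := by
  unfold sigmaMap
  rw [graph_sigmaSpan, (exists_rep (f i)).choose_spec]

theorem rel_sigmaMap {ι' : Type} [Finite ι'] {B : ι' → SC C} (e : ι → ι')
    (f : ∀ i, A i ⟶ B (e i)) (i : ι) (a : (A i).Idx) (y : (sigma B).Idx) :
    Rel (sigmaMap e f) (⟨i, a⟩ : Σ i, (A i).Idx) y ↔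
      ∃ b, (⟨e i, b⟩ : Σ i, (B i).Idx) = y ∧ Rel (f i) a b := by
  constructor
  · rintro ⟨u, v, g, h⟩
    obtain ⟨b, hb, hg⟩ := (graph_sigmaMap _ _ _ _ _ _).1 h
    exact ⟨b, hb, _, _, _, hg⟩
  · rintro ⟨b, hb, u, v, g, h⟩
    exact ⟨u, v, g, (graph_sigmaMap _ _ _ _ _ _).2 ⟨b, hb, h⟩⟩

/-- `sigmaMap e f` is the morphism induced by the components of `f`. -/
theorem inj_sigmaMap {ι' : Type} [Finite ι'] {B : ι' → SC C} (e : ι → ι')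
    (f : ∀ i, A i ⟶ B (e i)) (i : ι) : inj A i ≫ sigmaMap e f = f i ≫ inj B (e i) := by
  refine hom_ext fun a y u v g => ?_
  rw [graph_comp, graph_comp]
  constructor
  · rintro ⟨x, w, p, q, rfl, hp, hq⟩
    obtain ⟨rfl, hp'⟩ := (graph_inj _ _ _ _).1 hp
    obtain ⟨b, rfl, hf⟩ := (graph_sigmaMap _ _ _ _ _ _).1 hq
    refine ⟨b, v, hcomp p q, hid v, hcomp_hid _, SC.Hom.graph_restrict hf ?_,
      (graph_inj _ _ _ _).2 ⟨rfl, C.sq_id (SC.Hom.graph_src_le hf).2⟩⟩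
    have := C.sq_comp (sq_hid_iff hp').2.1 (C.sq_refl q)
    change C.Sq _ (hcomp (hid _) q) at this
    rwa [hid_hcomp] at this
  · rintro ⟨b, w, p, q, rfl, hf, hq⟩
    obtain ⟨rfl, hq'⟩ := (graph_inj _ _ _ _).1 hq
    refine ⟨⟨i, a⟩, u, hid u, hcomp p q, hid_hcomp _, (graph_inj _ _ _ _).2
      ⟨rfl, C.sq_id (SC.Hom.graph_src_le hf).1⟩, (graph_sigmaMap _ _ _ _ _ _).2
      ⟨b, rfl, SC.Hom.graph_restrict hf ?_⟩⟩
    have := C.sq_comp (C.sq_refl p) (sq_hid_iff hq').1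
    change C.Sq _ (hcomp p (hid _)) at this
    rwa [hcomp_hid] at this

/-- Morphisms from a coproduct are determined by their components. -/
theorem sigma_hom_ext {B : SC C} {f f' : sigma A ⟶ B} (h : ∀ i, inj A i ≫ f = inj A i ≫ f') :
    f = f' := by
  have key : ∀ (f : sigma A ⟶ B) i a j (x y : C.Obj) (g : C.Hor x y),
      SC.Hom.graph (inj A i ≫ f) a j g ↔ SC.Hom.graph f (⟨i, a⟩ : Σ i, (A i).Idx) j g := by
    intro f i a j x y g
    rw [graph_comp]
    constructor
    · rintro ⟨x', w, p, q, rfl, hp, hq⟩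
      obtain ⟨rfl, hp'⟩ := (graph_inj _ _ _ _).1 hp
      refine SC.Hom.graph_restrict hq ?_
      have := C.sq_comp (sq_hid_iff hp').2.1 (C.sq_refl q)
      change C.Sq _ (hcomp (hid _) q) at this
      rwa [hid_hcomp] at this
    · intro hf
      exact ⟨_, x, hid x, g, hid_hcomp g, (graph_inj _ _ _ _).2
        ⟨rfl, C.sq_id (SC.Hom.graph_src_le hf).1⟩, hf⟩
  refine hom_ext fun x j u v g => ?_
  obtain ⟨i, a⟩ := x
  rw [← key, ← key, h]

theorem sigmaMap_id : sigmaMap (fun i : ι => i) (fun i => 𝟙 (A i)) = 𝟙 (sigma A) :=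
  sigma_hom_ext fun i => by rw [inj_sigmaMap, Category.id_comp, Category.comp_id]

theorem sigmaMap_comp {ι' ι'' : Type} [Finite ι'] [Finite ι''] {B : ι' → SC C} {D : ι'' → SC C}
    (e : ι → ι') (e' : ι' → ι'') (f : ∀ i, A i ⟶ B (e i)) (f' : ∀ i, B i ⟶ D (e' i)) :
    sigmaMap e f ≫ sigmaMap e' f' = sigmaMap (fun i => e' (e i)) (fun i => f i ≫ f' (e i)) :=
  sigma_hom_ext fun i => by
    rw [← Category.assoc, inj_sigmaMap, Category.assoc, inj_sigmaMap, inj_sigmaMap,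
      Category.assoc]

theorem cof_sigmaMap {ι' : Type} [Finite ι'] {B : ι' → SC C} (e : ι → ι')
    (he : Function.Injective e) (f : ∀ i, A i ⟶ B (e i)) (hf : ∀ i, cof (f i)) :
    cof (sigmaMap e f) := by
  choose s hs hc hi using hf
  refine ⟨sigmaSpan e s, ?_, ?_, ?_⟩
  · refine hom_ext fun x y u v g => ?_
    obtain ⟨i, a⟩ := x
    rw [graph_sigmaSpan, graph_sigmaMap, hs]
  · rintro ⟨i, a⟩
    refine isCoveringFamily_congr ?_ ?_ (hc i a)
    · exact Equiv.ofBijective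
        (fun k => (⟨⟨i, k.1⟩, congrArg (Sigma.mk i) k.2⟩ :
          {x : Σ i, (s i).mid.Idx // (⟨x.1, (s x.1).p.toFun x.2⟩ : Σ i, (A i).Idx) = ⟨i, a⟩}))
        ⟨fun k l h => by
          have h1 := congrArg Subtype.val h
          exact Subtype.ext (eq_of_heq (Sigma.mk.inj_iff.1 h1).2), by
          rintro ⟨⟨j, k⟩, h⟩
          obtain ⟨rfl, h'⟩ := Sigma.mk.inj_iff.1 h
          exact ⟨⟨k, eq_of_heq h'⟩, rfl⟩⟩
    · intro k; rfl
  · rintro ⟨i, a⟩ ⟨j, b⟩ h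
    obtain ⟨hij, h'⟩ := Sigma.mk.inj_iff.1 h
    obtain rfl := he hij
    obtain rfl := hi i (eq_of_heq h')
    rfl

end

end SC

open SC

/-! ### Layered morphisms -/

/-- A morphism `f : A ⟶ B` of `F_n SC(C)` is layered if for all `i < k` the map
`f_k/f_i : A_k/A_i ⟶ B_k/B_i` which is induced by `f_k` on cofibers commutes with the canonical
cofibrations `A_k/A_i ⟶ A_k` and `B_k/B_i ⟶ B_k`. -/
def IsLayered (C : PolytopeComplex.{v, u}) (n : ℕ) : MorphismProperty (FilteredObj (SC C) n) :=
  fun A B f => ∀ (i k : Fin n) (h : i < k),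
    ∃ q : quot (A.obj.map (homOfLE h.le)) ⟶ quot (B.obj.map (homOfLE h.le)),
      SC.proj _ (im (A.obj.map (homOfLE h.le)))ᶜ ≫ q =
        f.hom.app k ≫ SC.proj _ (im (B.obj.map (homOfLE h.le)))ᶜ ∧
      q ≫ SC.incl _ (im (B.obj.map (homOfLE h.le)))ᶜ =
        SC.incl _ (im (A.obj.map (homOfLE h.le)))ᶜ ≫ f.hom.app k

instance (n : ℕ) : (IsLayered C n).IsMultiplicative where
  id_mem A i k h := ⟨𝟙 _, by simp, by simp⟩
  comp_mem f g hf hg i k h := by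
    obtain ⟨q, h1, h2⟩ := hf i k h
    obtain ⟨r, h3, h4⟩ := hg i k h
    refine ⟨q ≫ r, ?_, ?_⟩
    · rw [← Category.assoc, h1, Category.assoc, h3]; simp
    · rw [Category.assoc, h4, ← Category.assoc, h2]; simp

/-- `L_n SC(C)`: the subcategory of `F_n SC(C)` of all objects and the layered morphisms. -/
abbrev LayeredObj (C : PolytopeComplex.{v, u}) (n : ℕ) := WideSubcategory (IsLayered C n)

/-- The cofibrations and weak equivalences of `L_n SC(C)` are those of `F_n SC(C)`. -/
instance layeredWaldhausenData (n : ℕ) : WaldhausenData (LayeredObj C n) where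
  cof := fun _ _ f => cof f.hom
  weq := fun _ _ f => weq f.hom

theorem isLayered_of_rel {n : ℕ} {A B : FilteredObj (SC C) n} (f : A ⟶ B)
    (hf : ∀ (i k : Fin n) (h : i < k) a b, Rel (f.hom.app k) a b →
      (a ∈ im (A.obj.map (homOfLE h.le)) ↔ b ∈ im (B.obj.map (homOfLE h.le)))) :
    IsLayered C n f := by
  intro i k h
  refine ⟨restrMap (f.hom.app k) _ _, ?_, ?_⟩
  · refine proj_incl_comp _ _ fun a b hab => ?_
    obtain ⟨b', hb', hb⟩ := (rel_comp _ _ _ _).1 hab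
    rw [rel_proj] at hb
    subst hb
    exact fun ha => b.2 ((hf i k h _ _ hb').1 ha)
  · rw [restrMap, Category.assoc, Category.assoc, ← Category.assoc]
    refine comp_proj_incl _ _ fun a b hab => ?_
    obtain ⟨a', ha', hb⟩ := (rel_comp _ _ _ _).1 hab
    rw [rel_incl] at ha'
    subst ha'
    exact fun hb' => a.2 ((hf i k h _ _ hb).2 hb')

theorem IsLayered.not_mem_im {n : ℕ} {A B : FilteredObj (SC C) n} {f : A ⟶ B}
    (hf : IsLayered C n f) {i k : Fin n} (h : i < k) {a b} (hab : Rel (f.hom.app k) a b)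
    (ha : a ∉ im (A.obj.map (homOfLE h.le))) : b ∉ im (B.obj.map (homOfLE h.le)) := by
  obtain ⟨q, -, h2⟩ := hf i k h
  have h3 : Rel (q ≫ SC.incl _ (im (B.obj.map (homOfLE h.le)))ᶜ) ⟨a, ha⟩ b := by
    rw [h2, rel_comp]
    exact ⟨a, (rel_incl _ _).2 rfl, hab⟩
  obtain ⟨b', -, hb⟩ := (rel_comp _ _ _ _).1 h3
  rw [rel_incl] at hb
  subst hb
  exact b'.2

/-! ### The strand functor -/

section Strands

variable {n : ℕ}

/-- The indices of the members of `A_i/A_{i-1}` in `A_i` (all indices if `i` is the first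
index). -/
def newIdx (A : Fin n ⥤ SC C) (i : Fin n) : Set (A.obj i).Idx :=
  {a | ∀ (i' : Fin n) (h : i'.1 + 1 = i.1),
    a ∉ im (A.map (homOfLE (Fin.le_def.2 (by omega)) : i' ⟶ i))}

/-- The indices in `A_k` of the image of `A_i/A_{i-1} ⟶ A_i ⟶ A_k`. -/
def strandIdx (A : Fin n ⥤ SC C) {i k : Fin n} (h : i ≤ k) : Set (A.obj k).Idx :=
  im ((A.obj i).incl (newIdx A i) ≫ A.map (homOfLE h))

theorem mem_strandIdx (A : Fin n ⥤ SC C) {i k : Fin n} (h : i ≤ k) (b : (A.obj k).Idx) :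
    b ∈ strandIdx A h ↔ ∃ a ∈ newIdx A i, Rel (A.map (homOfLE h)) a b := by
  rw [strandIdx, mem_im]
  constructor
  · rintro ⟨a, h⟩
    obtain ⟨a', h1, h2⟩ := (rel_comp _ _ _ _).1 h
    rw [rel_incl] at h1
    subst h1
    exact ⟨a.1, a.2, h2⟩
  · rintro ⟨a, ha, h⟩
    exact ⟨⟨a, ha⟩, (rel_comp _ _ _ _).2 ⟨a, (rel_incl _ _).2 rfl, h⟩⟩

theorem strandIdx_succ (A : Fin n ⥤ SC C) {i k k' : Fin n} (h : i ≤ k) (h' : k ≤ k')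
    (b : (A.obj k').Idx) :
    b ∈ strandIdx A (h.trans h') ↔ ∃ a ∈ strandIdx A h, Rel (A.map (homOfLE h')) a b := by
  have e : A.map (homOfLE (h.trans h')) = A.map (homOfLE h) ≫ A.map (homOfLE h') := by
    rw [← A.map_comp]; rfl
  simp only [mem_strandIdx, e, rel_comp]
  constructor
  · rintro ⟨a, ha, j, h1, h2⟩; exact ⟨j, ⟨a, ha, h1⟩, h2⟩
  · rintro ⟨j, ⟨a, ha, h1⟩, h2⟩; exact ⟨a, ha, j, h1, h2⟩

/-- The level of `A` to which the level `l` of the strand of length `m + 1` belongs. This strand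
starts at the level `n - 1 - m` (counted from `0`). -/
def strandLevel (m : Fin n) (l : Fin (m.1 + 1)) : Fin n := ⟨n - 1 - m + l, by omega⟩

theorem strandLevel_mono (m : Fin n) {l l' : Fin (m.1 + 1)} (h : l ≤ l') :
    strandLevel m l ≤ strandLevel m l' :=
  Fin.le_def.2 (by simp only [strandLevel]; have := Fin.le_def.1 h; omega)

/-- The strand of length `m + 1` of `A`: with `i = n - 1 - m` it is
`A_i/A_{i-1} ⟶ im_{A_{i+1}}(A_i/A_{i-1}) ⟶ ... ⟶ im_{A_{n-1}}(A_i/A_{i-1})`. -/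
noncomputable def strandFunctor (A : Fin n ⥤ SC C) (m : Fin n) : Fin (m.1 + 1) ⥤ SC C where
  obj l := (A.obj (strandLevel m l)).restr (strandIdx A (strandLevel_mono m (Fin.zero_le l)))
  map {l l'} h := restrMap (A.map (homOfLE (strandLevel_mono m (leOfHom h)))) _ _
  map_id l := by
    have e : A.map (homOfLE (strandLevel_mono m (leOfHom (𝟙 l)))) = 𝟙 _ := A.map_id _
    rw [e, restrMap_id]
  map_comp {l l' l''} h h' := by
    rw [restrMap_comp]
    · rw [← A.map_comp]; rfl
    · intro a b ha hab
      exact (strandIdx_succ A _ (strandLevel_mono m (leOfHom h)) b).2 ⟨a, ha, hab⟩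

/-- The strand of length `m + 1`, as an object of `W_{m+1} SC(C)`. -/
noncomputable def strandObj (A : FilteredObj (SC C) n) (m : Fin n) :
    AcyclicFilteredObj (SC C) (m.1 + 1) :=
  have hw : ∀ (l l' : Fin (m.1 + 1)) (h : l ⟶ l'), weq ((strandFunctor A.obj m).map h) :=
    fun _ _ h => weq_restrMap (A.property _ _ _) _ _
      (strandIdx_succ A.obj _ (strandLevel_mono m (leOfHom h)))
  ⟨⟨strandFunctor A.obj m, fun l l' h => cof_of_weq (hw l l' h)⟩, hw⟩

theorem IsLayered.mem_strandIdx {A B : FilteredObj (SC C) n} {f : A ⟶ B}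
    (hf : IsLayered C n f) {i k : Fin n} (h : i ≤ k) (a b) (ha : a ∈ strandIdx A.obj h)
    (hab : Rel (f.hom.app k) a b) : b ∈ strandIdx B.obj h := by
  rw [ScissorsCongruence.mem_strandIdx] at ha ⊢
  obtain ⟨j, hj, hja⟩ := ha
  have h1 : Rel (A.obj.map (homOfLE h) ≫ f.hom.app k) j b :=
    (rel_comp _ _ _ _).2 ⟨a, hja, hab⟩
  rw [f.hom.naturality, rel_comp] at h1
  obtain ⟨j', h2, h3⟩ := h1
  exact ⟨j', fun i' hi' => hf.not_mem_im (Fin.lt_def.2 (by omega)) h2 (hj i' hi'), h3⟩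

/-- The strand functor `St`, with components `St_i : L_n SC(C) ⥤ W_{n-i+1} SC(C)`. A layered
morphism is restricted to the strands. -/
noncomputable def strands (C : PolytopeComplex.{v, u}) (n : ℕ) :
    LayeredObj C n ⥤ (∀ m : Fin n, AcyclicFilteredObj (SC C) (m.1 + 1)) where
  obj A := fun m => strandObj A.obj m
  map {A B} f := fun m => ObjectProperty.homMk (ObjectProperty.homMk
    { app := fun l => restrMap (f.hom.hom.app (strandLevel m l)) _ _
      naturality := by
        intro l l' h
        change restrMap _ _ _ ≫ restrMap _ _ _ = restrMap _ _ _ ≫ restrMap _ _ _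
        rw [restrMap_comp, restrMap_comp, f.hom.hom.naturality]
        · exact fun a b ha hab => IsLayered.mem_strandIdx f.property _ a b ha hab
        · exact fun a b ha hab =>
            (strandIdx_succ A.obj.obj _ (strandLevel_mono m (leOfHom h)) b).2 ⟨a, ha, hab⟩ })
  map_id A := by
    funext m
    apply ObjectProperty.hom_ext
    apply ObjectProperty.hom_ext
    ext l : 2
    exact restrMap_id _ _
  map_comp {A B D} f g := by
    funext m
    apply ObjectProperty.hom_ext
    apply ObjectProperty.hom_ext
    ext l : 2
    exact (restrMap_comp _ _ fun a b ha hab =>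
      IsLayered.mem_strandIdx f.property _ a b ha hab).symm

end Strands

/-! ### The coproduct of paddings -/

section Paddings

variable {n : ℕ}

/-- The padding of a sequence `X` of `m` objects by `c` zero objects at the front: at the levels
`k < c` it is the empty coproduct, and at the levels `k ≥ c` it is `X_{k-c}` (written as a
coproduct with one summand). -/
noncomputable def pad {m c : ℕ} (hn : n ≤ c + m) (X : Fin m ⥤ SC C) : Fin n ⥤ SC C where
  obj k := sigma fun h : PLift (c ≤ k.1) => X.obj ⟨k.1 - c, by have := h.down; omega⟩
  map {k k'} g := sigmaMap (fun h => ⟨h.down.trans (Fin.le_def.1 (leOfHom g))⟩)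
    (fun _ => X.map (homOfLE (Fin.le_def.2 (Nat.sub_le_sub_right (Fin.le_def.1 (leOfHom g)) c))))
  map_id k := by
    refine Eq.trans ?_ sigmaMap_id
    congr 1
    funext h
    exact X.map_id _
  map_comp g g' := by
    rw [sigmaMap_comp]
    congr 1
    funext h
    rw [← X.map_comp]
    rfl

/-- Padding of a natural transformation. -/
noncomputable def padMap {m c : ℕ} (hn : n ≤ c + m) {X Y : Fin m ⥤ SC C} (f : X ⟶ Y) :
    pad hn X ⟶ pad hn Y where
  app k := sigmaMap (fun h => h) (fun h => f.app ⟨k.1 - c, by have := h.down; omega⟩)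
  naturality k k' g := by
    dsimp only [pad]
    rw [sigmaMap_comp, sigmaMap_comp]
    congr 1
    funext h
    exact f.naturality _

/-- The levelwise coproduct of a finite family of sequences. -/
noncomputable def coprodSeq {ι : Type} [Finite ι] (X : ι → Fin n ⥤ SC C) : Fin n ⥤ SC C where
  obj k := sigma fun i => (X i).obj k
  map g := sigmaMap (fun i => i) (fun i => (X i).map g)
  map_id k := (congrArg (sigmaMap _) (funext fun i => (X i).map_id k)).trans sigmaMap_id
  map_comp g g' := by rw [sigmaMap_comp]; exact congrArg (sigmaMap _) (funext fun i => (X i).map_comp g g')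

/-- The levelwise coproduct of natural transformations. -/
noncomputable def coprodSeqMap {ι : Type} [Finite ι] {X Y : ι → Fin n ⥤ SC C}
    (f : ∀ i, X i ⟶ Y i) : coprodSeq X ⟶ coprodSeq Y where
  app k := sigmaMap (fun i => i) (fun i => (f i).app k)
  naturality k k' g := by
    change sigmaMap _ _ ≫ sigmaMap _ _ = sigmaMap _ _ ≫ sigmaMap _ _
    rw [sigmaMap_comp, sigmaMap_comp]
    exact congrArg (sigmaMap _) (funext fun i => (f i).naturality g)

theorem pad_le (m : Fin n) : n ≤ (n - 1 - m.1) + (m.1 + 1) := by omega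

/-- The object `∐ I(X_m)` of `F_n SC(C)`, where `I` pads `X_m` at the front with zero objects to
a sequence of length `n`. -/
noncomputable def paddingsObj (X : ∀ m : Fin n, AcyclicFilteredObj (SC C) (m.1 + 1)) :
    FilteredObj (SC C) n :=
  ⟨coprodSeq fun m => pad (pad_le m) (X m).obj.obj, fun _ _ _ =>
    cof_sigmaMap _ (fun _ _ h => h) _ fun m =>
      cof_sigmaMap _ (fun _ _ _ => Subsingleton.elim _ _) _ fun _ => (X m).obj.property _ _ _⟩

theorem exists_rel_of_weq {A B : SC C} {f : A ⟶ B} (hf : weq f) (b : B.Idx) :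
    ∃ a, Rel f a b := by
  obtain ⟨s, rfl, -, hb⟩ := hf
  obtain ⟨k, rfl⟩ := hb.2 b
  exact ⟨_, (rel_toHom s _ _).2 ⟨k, rfl, rfl⟩⟩

theorem mem_im_paddingsObj (X : ∀ m : Fin n, AcyclicFilteredObj (SC C) (m.1 + 1)) {i k : Fin n}
    (g : i ⟶ k) (b : ((paddingsObj X).obj.obj k).Idx) :
    b ∈ im ((paddingsObj X).obj.map g) ↔ n - 1 - b.1.1 ≤ i.1 := by
  rw [mem_im]
  constructor
  · rintro ⟨⟨m, h, a⟩, hr⟩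
    obtain ⟨b', rfl, -⟩ := (rel_sigmaMap _ _ _ _ _).1 hr
    exact h.down
  · intro h
    obtain ⟨m, h', b⟩ := b
    obtain ⟨a, ha⟩ := exists_rel_of_weq ((X m).property _ _ (homOfLE (Fin.le_def.2
      (Nat.sub_le_sub_right (Fin.le_def.1 (leOfHom g)) (n - 1 - m.1))) :
        (⟨i.1 - (n - 1 - m.1), by omega⟩ : Fin (m.1 + 1)) ⟶ ⟨k.1 - (n - 1 - m.1), by omega⟩)) b
    exact ⟨⟨m, ⟨h⟩, a⟩, (rel_sigmaMap _ _ _ _ _).2 ⟨_, rfl, (rel_sigmaMap _ _ _ _ _).2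
      ⟨b, rfl, ha⟩⟩⟩

/-- The coproduct-of-paddings functor `CP`. -/
noncomputable def coprodPaddings (C : PolytopeComplex.{v, u}) (n : ℕ) :
    (∀ m : Fin n, AcyclicFilteredObj (SC C) (m.1 + 1)) ⥤ LayeredObj C n where
  obj X := ⟨paddingsObj X⟩
  map {X Y} f := ⟨ObjectProperty.homMk (coprodSeqMap fun m => padMap (pad_le m) (f m).hom.hom), by
    refine isLayered_of_rel _ fun i k h a b hab => ?_
    rw [mem_im_paddingsObj, mem_im_paddingsObj]
    obtain ⟨m, a⟩ := a
    obtain ⟨b', rfl, -⟩ := (rel_sigmaMap _ _ _ _ _).1 hab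
    rfl⟩
  map_id X := by
    apply WideSubcategory.hom_ext
    apply ObjectProperty.hom_ext
    ext k : 2
    refine Eq.trans ?_ sigmaMap_id
    exact congrArg (sigmaMap fun m => m) (funext fun m => sigmaMap_id)
  map_comp f g := by
    apply WideSubcategory.hom_ext
    apply ObjectProperty.hom_ext
    ext k : 2
    refine Eq.trans ?_ (sigmaMap_comp _ _ _ _).symm
    exact congrArg (sigmaMap fun m => m) (funext fun m =>
      (sigmaMap_comp (fun h => h) (fun h => h) _ _).symm)

end Paddings

end ScissorsCongruence

open CategoryTheory ScissorsCongruence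

namespace ScissorsCongruence

open PolytopeComplex WaldhausenData SC

variable {C : PolytopeComplex.{v, u}}

/-! ### Squares -/

/-! A member of `A_k` has a stage of birth: the least `i` such that it lies in the image of `A_i`.
The maps of `A` are cofibrations, hence injective on indices, so the members born at stage `i` are
exactly those of the `i`-th strand, and each `A_k` is the disjoint union of its strands
(`exists_mem_strandIdx`, `eq_of_mem_strandIdx`). Naturality sends the image of `A_i` into the image
of `B_i`; layeredness says that the complement goes into the complement (`IsLayered.not_mem_im`). A
layered morphism therefore preserves stages of birth and is the coproduct of its restrictions to
strands. This gives the isomorphism `strandsIso`. Conversely, in a coproduct of paddings the summand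
`X_m` is born at the level where its padding ends, and nothing is born later because the maps of
`X_m` are surjective on indices; this gives `paddingsIso`.

The Waldhausen axioms are proved first for `SC C`. A weak equivalence is, up to isomorphism, a
covering sub-map. Its cobase change is a finite common refinement of transported pieces
(`exists_isPushout_ofSub`), and it is an epimorphism (`epi_of_weq`); these two facts yield the
gluing axiom formally (`weq_gluing`). A cofibration is a weak equivalence onto its image followed by
the inclusion of a summand, so pushouts along it arise by pasting (`exists_isPushout_of_cof`).

For sequences of acyclic cofibrations everything is levelwise: the corner condition in the
definition of a cofibration is automatic, by cancellation of weak equivalences (`acyclic_cof_iff`).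
Products are componentwise. In `L_n` the corner condition is automatic too, because layeredness
makes the images of `B_i` and `A_k` in `B_k` meet only in the image of `A_i` (`layered_cof_iff`).
Both functors then preserve cofibrations and weak equivalences, `strands` also detects them, and the
axioms move to `L_n` along the equivalence. The remaining parts of exactness hold for any
equivalence of categories. -/

/-- Restricting `h` to the smaller target gives a second lift of `σ` with target `y`, and lifts are
unique. Restrictions of one horizontal morphism are thus ordered by their targets alone, and by the
next lemma by their sources alone. -/
theorem sq_of_le_right {a b x y x' y' : C.Obj} {σ : C.Hor a b} {g : C.Hor x y} {h : C.Hor x' y'}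
    (hg : C.Sq g σ) (hh : C.Sq h σ) (hy : y ≤ y') : C.Sq g h := by
  obtain ⟨z, w, hw⟩ := C.exists_lift h hy
  exact C.sq_trans (C.lift_unique hg (C.sq_trans hw hh)) hw

theorem sq_of_le_left {a b x y x' y' : C.Obj} {σ : C.Hor a b} {g : C.Hor x y} {h : C.Hor x' y'}
    (hg : C.Sq g σ) (hh : C.Sq h σ) (hx : x ≤ x') : C.Sq g h := by
  obtain ⟨z, w, hw⟩ := exists_lift_source h hx
  exact C.sq_trans (lift_source_unique hg (C.sq_trans hw hh)) hw

theorem sq_hinv_right {a b x y : C.Obj} {σ : C.Hor a b} {g : C.Hor y x}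
    (h : C.Sq g (hinv σ)) : C.Sq (hinv g) σ := by
  have := sq_inv h
  rwa [hinv_hinv] at this

theorem sq_le_hid {a x y : C.Obj} {g : C.Hor x y} (h : C.Sq g (hid a)) : x ≤ y :=
  C.sq_left (sq_hid_iff h).2.1

theorem hinv_hcomp_cancel {a b c : C.Obj} (σ : C.Hor a b) (τ : C.Hor b c) :
    hcomp (hinv σ) (hcomp σ τ) = τ := by
  rw [← hassoc, hinv_hcomp, hid_hcomp]

theorem hcomp_hinv_cancel {a b c : C.Obj} (σ : C.Hor a b) (τ : C.Hor a c) :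
    hcomp σ (hcomp (hinv σ) τ) = τ := by
  rw [← hassoc, hcomp_hinv, hid_hcomp]

/-! ### Covering by pieces with a property -/

/-- The object `b` is covered by initial objects and by objects which satisfy `P`. -/
def Cov (b : C.Obj) (P : C.Obj → Prop) : Prop :=
  ∃ S ∈ C.topology b, ∀ (y : C.Obj) (h : y ≤ b), S (homOfLE h) → ¬ IsBot y → P y

theorem ofArrows_homOfLE {b : C.Obj} {ι : Type w} {f : ι → C.Obj} (hf : ∀ i, f i ≤ b) {y : C.Obj}
    (h : y ≤ b) : Sieve.ofArrows f (fun i => homOfLE (hf i)) (homOfLE h) ↔ ∃ i, y ≤ f i := by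
  constructor
  · rintro ⟨_, g, _, ⟨i⟩, -⟩
    exact ⟨i, leOfHom g⟩
  · rintro ⟨i, hi⟩
    exact ⟨_, homOfLE hi, _, ⟨i⟩, Subsingleton.elim _ _⟩

/-- This trades families, whose index types live in varying universes, for a condition on sieves.
Ignoring initial objects loses nothing, by `covering_omit`. -/
theorem isCoveringFamily_iff {b : C.Obj} {ι : Type w} {f : ι → C.Obj} :
    IsCoveringFamily C.topology b f ↔ (∀ i, f i ≤ b) ∧ Cov b (fun y => ∃ i, y ≤ f i) := by
  constructor
  · rintro ⟨h, hJ⟩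
    exact ⟨h, _, hJ, fun y hy hS _ => (ofArrows_homOfLE h hy).1 hS⟩
  · rintro ⟨h, S, hS, H⟩
    refine ⟨h, ?_⟩
    -- The sieve itself as a family; its index type is a subtype of `C.Obj`, hence in the universe
    -- where `covering_omit` applies.
    let F : {y // ∃ hy : y ≤ b, S (homOfLE hy)} → C.Obj := fun y => y.1
    have hF : IsCoveringFamily C.topology b F := by
      refine ⟨fun y => y.2.1, C.topology.superset_covering ?_ hS⟩
      intro y g hg
      exact ⟨_, 𝟙 y, _, ⟨(⟨y, leOfHom g, hg⟩ : {y // ∃ hy : y ≤ b, S (homOfLE hy)})⟩,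
        Subsingleton.elim _ _⟩
    obtain ⟨h', hJ⟩ := C.covering_omit F hF
    refine C.topology.superset_covering ?_ hJ
    intro y g hg
    obtain ⟨i, hi⟩ := (ofArrows_homOfLE h' (leOfHom g)).1 hg
    obtain ⟨j, hj⟩ := H i.1.1 i.1.2.1 i.1.2.2 i.2
    exact (ofArrows_homOfLE h (leOfHom g)).2 ⟨j, hi.trans hj⟩

namespace Cov

variable {a b : C.Obj} {P Q : C.Obj → Prop}

theorem mono (h : Cov b P) (hPQ : ∀ y, y ≤ b → ¬ IsBot y → P y → Q y) : Cov b Q := by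
  obtain ⟨S, hS, H⟩ := h
  exact ⟨S, hS, fun y hy h hb => hPQ y hy hb (H y hy h hb)⟩

theorem of_forall (h : ∀ y, y ≤ b → ¬ IsBot y → P y) : Cov b P :=
  ⟨⊤, C.topology.top_mem b, fun y hy _ hb => h y hy hb⟩

theorem restrict (h : Cov b P) (hab : a ≤ b) : Cov a P := by
  obtain ⟨S, hS, H⟩ := h
  exact ⟨S.pullback (homOfLE hab), C.topology.pullback_stable _ hS,
    fun y hy h hb => H y (hy.trans hab) h hb⟩

theorem forall_finite {κ : Type} [Finite κ] {P : κ → C.Obj → Prop} (h : ∀ k, Cov b (P k)) :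
    Cov b (fun y => ∀ k, P k y) := by
  choose S hS H using h
  cases nonempty_fintype κ
  have : ∀ s : Finset κ, ∃ T ∈ C.topology b, ∀ k ∈ s, T ≤ S k := by
    classical
    intro s
    induction s using Finset.induction_on with
    | empty => exact ⟨⊤, C.topology.top_mem b, by simp⟩
    | insert k s _ ih =>
      obtain ⟨T, hT, h⟩ := ih
      refine ⟨T ⊓ S k, C.topology.intersection_covering hT (hS k), fun l hl => ?_⟩
      rcases Finset.mem_insert.1 hl with rfl | hl
      · exact inf_le_right
      · exact inf_le_left.trans (h l hl)
  obtain ⟨T, hT, h⟩ := this Finset.univ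
  exact ⟨T, hT, fun y hy hTy hb k => H k y hy (h k (Finset.mem_univ k) _ hTy) hb⟩

theorem bind (h : Cov b P) (h' : ∀ y, y ≤ b → ¬ IsBot y → P y → Cov y Q) : Cov b Q := by
  obtain ⟨S, hS, H⟩ := h
  have key : ∀ (y : C.Obj) (hy : y ≤ b), S (homOfLE hy) → Cov y Q := by
    intro y hy hSy
    -- Nothing is required of the objects below an initial one, so `P y` is needed only for the
    -- other members of the sieve.
    by_cases hb : IsBot y
    · exact of_forall fun z hz hz' => absurd (fun x => hz.trans (hb x)) hz'
    · exact h' y hy hb (H y hy hSy hb)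
  choose T hT hTQ using key
  refine ⟨Sieve.bind S.arrows (fun Y f hf => T Y (leOfHom f) hf),
    C.topology.bind_covering hS (fun Y f hf => hT Y (leOfHom f) hf), ?_⟩
  rintro y hy ⟨z, g, f, hf, hg, -⟩ hb
  exact hTQ z (leOfHom f) hf y (leOfHom g) hg hb

theorem hor (h : Cov b P) (σ : C.Hor a b) :
    Cov a (fun x => ∃ (y : C.Obj) (g : C.Hor x y), C.Sq g σ ∧ P y) := by
  obtain ⟨S, hS, H⟩ := h
  -- `covering_lift` speaks of families, so the sieve is listed as one and lifted member by member
  -- along `σ`.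
  let F : {y // ∃ hy : y ≤ b, S (homOfLE hy)} → C.Obj := fun y => y.1
  have hF : IsCoveringFamily C.topology b F := by
    refine ⟨fun y => y.2.1, C.topology.superset_covering ?_ hS⟩
    intro y g hg
    exact ⟨_, 𝟙 y, _, ⟨(⟨y, leOfHom g, hg⟩ : {y // ∃ hy : y ≤ b, S (homOfLE hy)})⟩,
      Subsingleton.elim _ _⟩
  have hl : ∀ i, ∃ (x : C.Obj) (τ : C.Hor x (F i)), C.Sq τ σ := fun i => C.exists_lift σ i.2.1
  choose G τ hτ using hl
  obtain ⟨hle, hcov⟩ := isCoveringFamily_iff.1 (C.covering_lift σ F G τ hτ hF)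
  refine hcov.mono fun x hx hb hi => ?_
  obtain ⟨i, hi⟩ := hi
  obtain ⟨y, g, hg⟩ := exists_lift_source (τ i) hi
  have hy : ¬ IsBot y := fun h => hb (isBot_of_hor (hinv g) h)
  have hyi : y ≤ i.1 := C.sq_right hg
  exact ⟨y, g, C.sq_trans hg (hτ i), H y (hyi.trans i.2.1)
    (S.downward_closed i.2.2 (homOfLE hyi)) hy⟩

end Cov

theorem TwVert.isCovering_iff {A B : SC C} (p : TwVert A B) : p.IsCovering ↔
    ∀ j, Cov (B.obj j) (fun y => ∃ i, p.toFun i = j ∧ y ≤ A.obj i) := by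
  unfold TwVert.IsCovering
  refine forall_congr' fun j => ?_
  rw [isCoveringFamily_iff]
  constructor
  · rintro ⟨-, h⟩
    exact h.mono fun y _ _ ⟨i, hi⟩ => ⟨i.1, i.2, hi⟩
  · intro h
    exact ⟨fun i => by have := p.le i.1; rwa [i.2] at this,
      h.mono fun y _ _ ⟨i, hi, hy⟩ => ⟨⟨i, hi⟩, hy⟩⟩

/-- Greatest lower bounds of finite families of objects with a common upper bound. -/
theorem exists_finite_glb {κ : Type} [Finite κ] (d : C.Obj) (t : κ → C.Obj) (ht : ∀ k, t k ≤ d) :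
    ∃ z, ∀ y, y ≤ z ↔ y ≤ d ∧ ∀ k, y ≤ t k := by
  classical
  cases nonempty_fintype κ
  have : ∀ s : Finset κ, ∃ z, ∀ y, y ≤ z ↔ y ≤ d ∧ ∀ k ∈ s, y ≤ t k := by
    intro s
    induction s using Finset.induction_on with
    | empty => exact ⟨d, by simp⟩
    | insert k s _ ih =>
      obtain ⟨z, hz⟩ := ih
      obtain ⟨z', hz'⟩ := C.exists_pullback z (t k) d ((hz z).1 le_rfl).1 (ht k)
      refine ⟨z', fun y => ?_⟩
      rw [le_isGLB_iff hz']
      simp only [mem_lowerBounds, Set.mem_insert_iff, Set.mem_singleton_iff, forall_eq_or_imp,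
        forall_eq, hz, Finset.mem_insert]
      tauto
  obtain ⟨z, hz⟩ := this Finset.univ
  exact ⟨z, by simpa using hz⟩

/-! ### Cofibrations and weak equivalences of `SC(C)` -/

theorem Span.toHom_eq_iff {A B : SC C} {s t : Span A B} : s.toHom = t.toHom ↔ s.Equiv t :=
  ⟨fun h => Quotient.exact h, fun h => Quotient.sound h⟩

theorem Span.Equiv.isCovering {A B : SC C} {s t : Span A B} (h : s.Equiv t)
    (hs : s.p.IsCovering) : t.p.IsCovering := by
  obtain ⟨e, he, hp, -, -⟩ := h
  rw [TwVert.isCovering_iff] at hs ⊢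
  exact fun j => (hs j).mono fun y _ _ ⟨i, hi, hy⟩ => ⟨e i, (hp i).trans hi, hy.trans (he i).1⟩

theorem Span.Equiv.injective {A B : SC C} {s t : Span A B} (h : s.Equiv t)
    (hs : Function.Injective s.σ.toFun) : Function.Injective t.σ.toFun := by
  obtain ⟨e, -, -, hσ, -⟩ := h
  have : t.σ.toFun ∘ e = s.σ.toFun := funext hσ
  rw [← this] at hs
  exact (Equiv.injective_comp e _).1 hs

namespace SC

/-- Covering and injectivity are invariant under equivalence of diagrams, so the existential in
`cof` can be tested on any representative. -/
theorem cof_toHom {A B : SC C} {s : Span A B} :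
    cof s.toHom ↔ s.p.IsCovering ∧ Function.Injective s.σ.toFun := by
  constructor
  · rintro ⟨t, ht, hc, hi⟩
    rw [Span.toHom_eq_iff] at ht
    exact ⟨ht.isCovering hc, ht.injective hi⟩
  · rintro ⟨hc, hi⟩
    exact ⟨s, rfl, hc, hi⟩

theorem toHom_comp {A B D : SC C} (s : Span A B) (t : Span B D) :
    (s.comp t).toHom = s.toHom ≫ t.toHom := rfl

/-- Each piece of `s` is covered by the pieces of `t` pulled back along its shuffle component;
covers of the pieces of a cover compose. -/
theorem isCovering_comp {A B D : SC C} {s : Span A B} {t : Span B D} (hs : s.p.IsCovering)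
    (ht : t.p.IsCovering) : (s.comp t).p.IsCovering := by
  rw [TwVert.isCovering_iff] at hs ht ⊢
  refine fun i => (hs i).bind ?_
  rintro y - - ⟨k, rfl, hy⟩
  refine Cov.restrict ?_ hy
  refine ((ht (s.σ.toFun k)).hor (s.σ.hom k)).mono ?_
  rintro x - - ⟨z, g, hg, l, hl, hz⟩
  let kl : (s.comp t).mid.Idx := ⟨(k, l), hl.symm⟩
  exact ⟨kl, rfl, C.sq_left (sq_of_le_right hg (Span.pullback_sq s t kl) hz)⟩

theorem cof_comp {A B D : SC C} {f : A ⟶ B} {g : B ⟶ D} (hf : cof f) (hg : cof g) :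
    cof (f ≫ g) := by
  obtain ⟨s, rfl, hs, hi⟩ := hf
  obtain ⟨t, rfl, ht, hj⟩ := hg
  refine ⟨s.comp t, rfl, isCovering_comp hs ht, ?_⟩
  rintro ⟨⟨k, l⟩, h⟩ ⟨⟨k', l'⟩, h'⟩ e
  obtain rfl : l = l' := hj e
  obtain rfl : k = k' := hi (h.trans h'.symm)
  rfl

theorem weq_comp {A B D : SC C} {f : A ⟶ B} {g : B ⟶ D} (hf : weq f) (hg : weq g) :
    weq (f ≫ g) := by
  obtain ⟨s, rfl, hs, hi⟩ := hf
  obtain ⟨t, rfl, ht, hj⟩ := hg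
  refine ⟨s.comp t, rfl, isCovering_comp hs ht,
    (cof_toHom.1 (cof_comp ⟨s, rfl, hs, hi.1⟩ ⟨t, rfl, ht, hj.1⟩)).2, ?_⟩
  intro m
  obtain ⟨l, rfl⟩ := hj.2 m
  obtain ⟨k, hk⟩ := hi.2 (t.p.toFun l)
  exact ⟨⟨(k, l), hk⟩, rfl⟩

theorem rel_injective_of_cof {A B : SC C} {f : A ⟶ B} (hf : cof f) {a a' : A.Idx} {b : B.Idx}
    (h : Rel f a b) (h' : Rel f a' b) : a = a' := by
  obtain ⟨s, rfl, -, hi⟩ := hf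
  obtain ⟨k, rfl, rfl⟩ := (rel_toHom _ _ _).1 h
  obtain ⟨k', rfl, hk⟩ := (rel_toHom _ _ _).1 h'
  rw [hi hk]

theorem weq_of_cof {A B : SC C} {f : A ⟶ B} (hf : cof f) (h : ∀ b, ∃ a, Rel f a b) : weq f := by
  obtain ⟨s, rfl, hc, hi⟩ := hf
  refine ⟨s, rfl, hc, hi, fun b => ?_⟩
  obtain ⟨a, h⟩ := h b
  obtain ⟨k, -, hk⟩ := (rel_toHom _ _ _).1 h
  exact ⟨k, hk⟩

/-- Since the shuffle of `f` is bijective, each member of `B` is a horizontal copy of one piece of a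
member of `A`. The covering of that member given by `f ≫ g` is restricted to the piece and carried
over to `B`. -/
theorem cof_of_weq_comp {A B D : SC C} {f : A ⟶ B} {g : B ⟶ D} (hf : weq f)
    (hfg : cof (f ≫ g)) : cof g := by
  obtain ⟨s, rfl, hs, hi⟩ := hf
  obtain ⟨t, rfl⟩ := exists_rep g
  obtain ⟨hc, hj⟩ := cof_toHom.1 ((toHom_comp s t).symm ▸ hfg)
  refine ⟨t, rfl, ?_, ?_⟩
  · rw [TwVert.isCovering_iff] at hc ⊢
    intro j
    obtain ⟨k, rfl⟩ := hi.2 j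
    -- Pieces of the composite that pass through another `k'` over the same member are disjoint from
    -- the `k`-th piece, so they drop out of its covering.
    have h1 : Cov (s.mid.obj k) (fun y => ∃ kl : (s.comp t).mid.Idx, kl.1.1 = k ∧
        y ≤ (s.comp t).mid.obj kl) := by
      refine ((hc (s.p.toFun k)).restrict (s.p.le k)).mono ?_
      rintro y hy hb ⟨kl, hkl, hy'⟩
      refine ⟨kl, ?_, hy'⟩
      by_contra hne
      exact hb (s.isSubMap _ _ hne hkl y (hy'.trans (C.sq_left (Span.pullback_sq s t kl))) hy)
    refine (h1.hor (hinv (s.σ.hom k))).mono ?_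
    rintro y - - ⟨x, g, hg, ⟨⟨⟨k', l⟩, h⟩, rfl, hx⟩⟩
    refine ⟨l, h.symm, ?_⟩
    exact C.sq_right (sq_of_le_left (sq_hinv_right hg) (Span.pullback_sq s t ⟨⟨k', l⟩, h⟩) hx)
  · intro l l' h
    obtain ⟨k, hk⟩ := hi.2 (t.p.toFun l)
    obtain ⟨k', hk'⟩ := hi.2 (t.p.toFun l')
    have := @hj ⟨(k, l), hk⟩ ⟨(k', l'), hk'⟩ h
    exact congrArg (fun x => x.1.2) this

theorem weq_of_weq_comp {A B D : SC C} {f : A ⟶ B} {g : B ⟶ D} (hf : weq f)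
    (hfg : weq (f ≫ g)) : weq g := by
  refine weq_of_cof (cof_of_weq_comp hf (cof_of_weq hfg)) fun b => ?_
  obtain ⟨a, h⟩ := exists_rel_of_weq hfg b
  obtain ⟨j, -, h⟩ := (rel_comp _ _ _ _).1 h
  exact ⟨j, h⟩

/-- Morphisms are determined by the pieces which are polytopes. -/
theorem hom_ext_of_polytope {A B : SC C} {f f' : A ⟶ B}
    (h : ∀ i j (x y : C.Obj) (g : C.Hor x y), ¬ IsBot x →
      (SC.Hom.graph f i j g ↔ SC.Hom.graph f' i j g)) : f = f' := by
  have key : ∀ (f f' : A ⟶ B), (∀ i j (x y : C.Obj) (g : C.Hor x y), ¬ IsBot x →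
      SC.Hom.graph f i j g → SC.Hom.graph f' i j g) →
      ∀ i j (x y : C.Obj) (g : C.Hor x y), SC.Hom.graph f i j g → SC.Hom.graph f' i j g := by
    intro f f' h i j x y g hg
    obtain ⟨s, rfl⟩ := exists_rep f
    obtain ⟨k, rfl, rfl, hs⟩ := hg
    exact SC.Hom.graph_restrict (h _ _ _ _ _ (s.mid.polytope k) (s.graph_self k)) hs
  exact hom_ext fun i j x y g => ⟨key f f' (fun i j x y g hx => (h i j x y g hx).1) i j x y g,
    key f' f (fun i j x y g hx => (h i j x y g hx).2) i j x y g⟩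

/-- Each member of `B` is reached by a component of the shuffle of `f`. A piece of `v` can be
precomposed with a restriction of that component, read off as a piece of `f ≫ v'`, and recovered by
cancelling the horizontal isomorphism. -/
theorem epi_of_weq {A B : SC C} {f : A ⟶ B} (hf : weq f) : Epi f := by
  obtain ⟨s, rfl, -, hi⟩ := hf
  have key : ∀ {D : SC C} (v v' : B ⟶ D), s.toHom ≫ v = s.toHom ≫ v' →
      ∀ j m (x z : C.Obj) (h : C.Hor x z), ¬ IsBot x → SC.Hom.graph v j m h →
        SC.Hom.graph v' j m h := by
    intro D v v' e j m x z h hx hv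
    obtain ⟨k, rfl⟩ := hi.2 j
    obtain ⟨x', w, hw⟩ := C.exists_lift (s.σ.hom k) (SC.Hom.graph_src_le hv).1
    have hx' : ¬ IsBot x' := fun hh => hx (isBot_of_hor w hh)
    have h1 : SC.Hom.graph (s.toHom ≫ v) (s.p.toFun k) m (hcomp w h) :=
      (graph_comp _ _ _ _ _).2 ⟨_, _, _, _, rfl, ⟨k, rfl, rfl, hw⟩, hv⟩
    rw [e, graph_comp] at h1
    obtain ⟨j', y', u', h', e', ⟨k', hk', rfl, hu'⟩, hv'⟩ := h1
    -- The piece of `f ≫ v'` could a priori pass through another `k'`; disjointness of the pieces of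
    -- `f` excludes this, as its source is not initial.
    obtain rfl : k' = k := by
      by_contra hne
      exact hx' (s.isSubMap _ _ hne hk' x' (C.sq_left hu') (C.sq_left hw))
    refine SC.Hom.graph_restrict hv' ?_
    have := C.sq_comp (sq_inv (lift_source_unique hw hu')) (C.sq_refl (hcomp w h))
    have e2 : hcomp (hinv u') (hcomp w h) = h' := by rw [← e', hinv_hcomp_cancel]
    change C.Sq (hcomp (hinv w) (hcomp w h)) (hcomp (hinv u') (hcomp w h)) at this
    rwa [hinv_hcomp_cancel, e2] at this
  exact ⟨fun v v' e => hom_ext_of_polytope fun j m x z h hx =>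
    ⟨key v v' e j m x z h hx, key v' v e.symm j m x z h hx⟩⟩

/-! ### Pure shuffles -/

/-- A pure shuffle. -/
def ofHor {A B : SC C} (σ : TwHor A B) : A ⟶ B :=
  Span.toHom
    { mid := A
      p := ⟨fun i => i, fun _ => le_rfl⟩
      isSubMap := fun _ _ h h' => absurd h' h
      σ := σ }

theorem graph_ofHor {A B : SC C} (σ : TwHor A B) (i : A.Idx) (j : B.Idx) {x y : C.Obj}
    (g : C.Hor x y) :
    SC.Hom.graph (ofHor σ) i j g ↔ σ.toFun i = j ∧ C.Sq g (σ.hom i) := by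
  constructor
  · rintro ⟨k, rfl, rfl, h⟩; exact ⟨rfl, h⟩
  · rintro ⟨rfl, h⟩; exact ⟨i, rfl, rfl, h⟩

theorem rel_ofHor {A B : SC C} (σ : TwHor A B) (i : A.Idx) (j : B.Idx) :
    Rel (ofHor σ) i j ↔ σ.toFun i = j := by
  unfold ofHor
  rw [rel_toHom]
  constructor
  · rintro ⟨k, rfl, rfl⟩; rfl
  · rintro rfl; exact ⟨i, rfl, rfl⟩

theorem isCovering_id (A : SC C) : (⟨fun i => i, fun _ => le_rfl⟩ : TwVert A A).IsCovering := by
  rw [TwVert.isCovering_iff]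
  exact fun j => Cov.of_forall fun y hy _ => ⟨j, rfl, hy⟩

theorem cof_ofHor {A B : SC C} (σ : TwHor A B) (h : Function.Injective σ.toFun) :
    cof (ofHor σ) := ⟨_, rfl, isCovering_id A, h⟩

theorem ofHor_comp {A B D : SC C} (σ : TwHor A B) (τ : TwHor B D) :
    ofHor σ ≫ ofHor τ =
      ofHor ⟨fun i => τ.toFun (σ.toFun i), fun i => hcomp (σ.hom i) (τ.hom (σ.toFun i))⟩ := by
  refine hom_ext fun i m x z g => ?_
  rw [graph_comp, graph_ofHor]
  constructor
  · rintro ⟨j, y, u, v, rfl, hu, hv⟩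
    obtain ⟨rfl, hu'⟩ := (graph_ofHor _ _ _ _).1 hu
    obtain ⟨rfl, hv'⟩ := (graph_ofHor _ _ _ _).1 hv
    exact ⟨rfl, C.sq_comp hu' hv'⟩
  · rintro ⟨rfl, hg⟩
    obtain ⟨y, u, hu⟩ := exists_lift_source (σ.hom i) (C.sq_left hg)
    refine ⟨_, y, u, hcomp (hinv u) g, hcomp_hinv_cancel _ _, (graph_ofHor _ _ _ _).2 ⟨rfl, hu⟩,
      (graph_ofHor _ _ _ _).2 ⟨rfl, ?_⟩⟩
    have h2 : C.Sq (hcomp (hinv u) g) (hcomp (hinv (σ.hom i)) (hcomp (σ.hom i) (τ.hom _))) :=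
      C.sq_comp (sq_inv hu) hg
    rwa [hinv_hcomp_cancel] at h2

theorem isIso_ofHor {A B : SC C} (σ : TwHor A B) (h : Function.Bijective σ.toFun) :
    IsIso (ofHor σ) := by
  -- Indexing a copy of `B` by `A.Idx` avoids transporting horizontal morphisms along the inverse of
  -- the bijection on indices.
  let A' : SC C := ⟨A.Idx, fun i => B.obj (σ.toFun i), fun i => B.polytope _⟩
  let t : Span B A :=
    { mid := A'
      p := ⟨σ.toFun, fun _ => le_rfl⟩
      isSubMap := fun i j hne hp => absurd (h.1 hp) hne
      σ := ⟨fun i => i, fun i => hinv (σ.hom i)⟩ }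
  have ht : ∀ j i (x y : C.Obj) (g : C.Hor x y),
      SC.Hom.graph t.toHom j i g ↔ σ.toFun i = j ∧ C.Sq g (hinv (σ.hom i)) := by
    intro j i x y g
    constructor
    · rintro ⟨k, rfl, rfl, h⟩; exact ⟨rfl, h⟩
    · rintro ⟨rfl, h⟩; exact ⟨i, rfl, rfl, h⟩
  refine ⟨t.toHom, ?_, ?_⟩
  · refine hom_ext fun i i' x z g => ?_
    rw [graph_comp]
    change _ ↔ (Span.id A).graph i i' g
    rw [Span.graph_id]
    constructor
    · rintro ⟨j, y, u, v, rfl, hu, hv⟩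
      obtain ⟨rfl, hu'⟩ := (graph_ofHor _ _ _ _).1 hu
      obtain ⟨e, hv'⟩ := (ht _ _ _ _ _).1 hv
      obtain rfl := h.1 e
      refine ⟨rfl, ?_⟩
      rw [← hcomp_hinv (σ.hom i')]
      exact C.sq_comp hu' hv'
    · rintro ⟨rfl, hg⟩
      obtain ⟨y, u, hu⟩ := exists_lift_source (σ.hom i) (C.sq_left hg)
      refine ⟨_, y, u, hcomp (hinv u) g, hcomp_hinv_cancel _ _,
        (graph_ofHor _ _ _ _).2 ⟨rfl, hu⟩, (ht _ _ _ _ _).2 ⟨rfl, ?_⟩⟩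
      have h2 : C.Sq (hcomp (hinv u) g) (hcomp (hinv (σ.hom i)) (hid _)) :=
        C.sq_comp (sq_inv hu) hg
      rwa [hcomp_hid] at h2
  · refine hom_ext fun j j' x z g => ?_
    rw [graph_comp]
    change _ ↔ (Span.id B).graph j j' g
    rw [Span.graph_id]
    constructor
    · rintro ⟨i, y, u, v, rfl, hu, hv⟩
      obtain ⟨rfl, hv'⟩ := (graph_ofHor _ _ _ _).1 hv
      obtain ⟨rfl, hu'⟩ := (ht _ _ _ _ _).1 hu
      refine ⟨rfl, ?_⟩
      rw [← hinv_hcomp (σ.hom i)]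
      exact C.sq_comp hu' hv'
    · rintro ⟨rfl, hg⟩
      obtain ⟨i, rfl⟩ := h.2 j
      obtain ⟨y, u, hu⟩ := exists_lift_source (hinv (σ.hom i)) (C.sq_left hg)
      refine ⟨_, y, u, hcomp (hinv u) g, hcomp_hinv_cancel _ _,
        (ht _ _ _ _ _).2 ⟨rfl, hu⟩, (graph_ofHor _ _ _ _).2 ⟨rfl, ?_⟩⟩
      have h2 : C.Sq (hcomp (hinv u) g) (hcomp (hinv (hinv (σ.hom i))) (hid _)) :=
        C.sq_comp (sq_inv hu) hg
      rwa [hcomp_hid, hinv_hinv] at h2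

/-- The identity of a member of `A` is a piece of `f ≫ g`, so one single piece of `f` exhausts that
member, and disjointness leaves no room for others. Hence the sub-maps of `f` and `g` are bijective
on indices, and `g` then inverts the shuffle of `f`. -/
theorem weq_of_isIso {A B : SC C} (f : A ⟶ B) (hf : IsIso f) : weq f := by
  obtain ⟨g, hfg, hgf⟩ := hf
  obtain ⟨s, rfl⟩ := exists_rep f
  obtain ⟨t, rfl⟩ := exists_rep g
  have key : ∀ {A B : SC C} {s : Span A B} {t : Span B A}, s.toHom ≫ t.toHom = 𝟙 A →
      ∀ i, ∃ k, s.p.toFun k = i ∧ A.obj i ≤ s.mid.obj k ∧ Rel t.toHom (s.σ.toFun k) i := by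
    intro A B s t h i
    have h1 : SC.Hom.graph (𝟙 A) i i (hid (A.obj i)) := (Span.id A).graph_self i
    rw [← h, graph_comp] at h1
    obtain ⟨j, y, u, v, -, ⟨k, hk, rfl, hu⟩, hv⟩ := h1
    exact ⟨k, hk, C.sq_left hu, rel_of_graph hv⟩
  have hinj : ∀ {A B : SC C} {s : Span A B} {t : Span B A}, s.toHom ≫ t.toHom = 𝟙 A →
      Function.Injective s.p.toFun := by
    intro A B s t h k k' e
    obtain ⟨l, hl, hle, -⟩ := key h (s.p.toFun k)
    -- The piece `l` fills the whole member, so another piece over it would be contained in `l` and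
    -- disjoint from it.
    have aux : ∀ k', s.p.toFun k' = s.p.toFun k → k' = l := by
      intro k' e'
      by_contra hne
      refine s.mid.polytope k' (s.isSubMap k' l hne (e'.trans hl.symm) _ le_rfl ?_)
      have := s.p.le k'
      rw [e'] at this
      exact this.trans hle
    rw [aux k rfl, aux k' e.symm]
  refine ⟨s, rfl, ?_, ?_, ?_⟩
  · rw [TwVert.isCovering_iff]
    intro i
    obtain ⟨k, hk, hle, -⟩ := key hfg i
    exact Cov.of_forall fun y hy _ => ⟨k, hk, hy.trans hle⟩
  · intro k k' e
    apply hinj hfg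
    have aux : ∀ k, Rel t.toHom (s.σ.toFun k) (s.p.toFun k) := by
      intro k
      obtain ⟨l, hl, -, hr⟩ := key hfg (s.p.toFun k)
      rwa [hinj hfg hl] at hr
    obtain ⟨l, hl, hl'⟩ := (rel_toHom _ _ _).1 (aux k)
    obtain ⟨m, hm, hm'⟩ := (rel_toHom _ _ _).1 (aux k')
    rw [← hl', ← hm', hinj hgf (hl.trans (e.trans hm.symm))]
  · intro j
    obtain ⟨l, -, -, hr⟩ := key hgf j
    obtain ⟨k, -, hk⟩ := (rel_toHom _ _ _).1 hr
    exact ⟨k, hk⟩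

/-! ### Pure sub-maps and their cobase changes -/

/-- A pure sub-map. -/
def ofSub {A X : SC C} (p : TwVert X A) (hp : p.IsSubMap) : A ⟶ X :=
  Span.toHom
    { mid := X
      p := p
      isSubMap := hp
      σ := ⟨fun i => i, fun i => hid (X.obj i)⟩ }

theorem graph_ofSub {A X : SC C} (p : TwVert X A) (hp : p.IsSubMap) (i : A.Idx) (j : X.Idx)
    {x y : C.Obj} (g : C.Hor x y) :
    SC.Hom.graph (ofSub p hp) i j g ↔ p.toFun j = i ∧ C.Sq g (hid (X.obj j)) := by
  constructor
  · rintro ⟨k, rfl, rfl, h⟩; exact ⟨rfl, h⟩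
  · rintro ⟨rfl, h⟩; exact ⟨j, rfl, rfl, h⟩

theorem graph_ofSub_comp {A X E : SC C} (p : TwVert X A) (hp : p.IsSubMap) (f : X ⟶ E) (i : A.Idx)
    (j : E.Idx) {x y : C.Obj} (g : C.Hor x y) :
    SC.Hom.graph (ofSub p hp ≫ f) i j g ↔ ∃ m, p.toFun m = i ∧ SC.Hom.graph f m j g := by
  rw [graph_comp]
  constructor
  · rintro ⟨m, z, u, v, rfl, hu, hv⟩
    obtain ⟨rfl, hu'⟩ := (graph_ofSub _ _ _ _ _).1 hu
    refine ⟨m, rfl, SC.Hom.graph_restrict hv ?_⟩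
    have := C.sq_comp (sq_hid_iff hu').2.1 (C.sq_refl v)
    change C.Sq _ (hcomp (hid _) v) at this
    rwa [hid_hcomp] at this
  · rintro ⟨m, rfl, hf⟩
    exact ⟨m, x, hid x, g, hid_hcomp g, (graph_ofSub _ _ _ _ _).2
      ⟨rfl, C.sq_id (SC.Hom.graph_src_le hf).1⟩, hf⟩

theorem weq_ofSub {A X : SC C} {p : TwVert X A} (hp : p.IsSubMap) (hc : p.IsCovering) :
    weq (ofSub p hp) := ⟨_, rfl, hc, Function.bijective_id⟩

/-- Every morphism is a pure sub-map followed by a pure shuffle. -/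
theorem toHom_eq {A B : SC C} (s : Span A B) : s.toHom = ofSub s.p s.isSubMap ≫ ofHor s.σ := by
  refine hom_ext fun i j x y g => ?_
  rw [graph_ofSub_comp]
  simp only [graph_ofHor]
  exact Iff.rfl

/-- A morphism whose pieces lie in members of `X` factors through the pure sub-map to `X`. -/
theorem exists_ofSub_comp_eq {A X E : SC C} (p : TwVert X A) (hp : p.IsSubMap) (h : A ⟶ E)
    (H : ∀ i j (x y : C.Obj) (g : C.Hor x y), ¬ IsBot x → SC.Hom.graph h i j g →
      ∃ m, p.toFun m = i ∧ x ≤ X.obj m) : ∃ h' : X ⟶ E, ofSub p hp ≫ h' = h := by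
  obtain ⟨t, rfl⟩ := exists_rep h
  have H' : ∀ k, ∃ m, p.toFun m = t.p.toFun k ∧ t.mid.obj k ≤ X.obj m := fun k =>
    H _ _ _ _ _ (t.mid.polytope k) (t.graph_self k)
  choose m hm hle using H'
  let t' : Span X E :=
    { mid := t.mid
      p := ⟨m, hle⟩
      isSubMap := fun k k' hne e => t.isSubMap k k' hne (by
        rw [← hm, ← hm]; exact congrArg p.toFun e)
      σ := t.σ }
  refine ⟨t'.toHom, hom_ext fun i j x y g => ?_⟩
  rw [graph_ofSub_comp]
  constructor
  · rintro ⟨_, rfl, k, rfl, rfl, hg⟩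
    exact ⟨k, (hm k).symm, rfl, hg⟩
  · rintro ⟨k, rfl, rfl, hg⟩
    exact ⟨m k, hm k, k, rfl, rfl, hg⟩

/-- The cobase change of a covering pure sub-map is a covering pure sub-map. -/
theorem exists_isPushout_ofSub {A X D : SC C} (p : TwVert X A) (hp : p.IsSubMap)
    (hc : p.IsCovering) (g : A ⟶ D) : ∃ (P : SC C) (inl : X ⟶ P) (inr : D ⟶ P),
      IsPushout (ofSub p hp) g inl inr ∧ weq inr := by
  obtain ⟨s, rfl⟩ := exists_rep g
  -- the part of the `k`-th member of `s.mid` in the `m`-th member of `X`, moved to `D`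
  have h1 : ∀ (k : s.mid.Idx) (m : {m // p.toFun m = s.p.toFun k}),
      ∃ t, t ≤ D.obj (s.σ.toFun k) ∧ ∀ (z : C.Obj) (y : C.Obj) (u : C.Hor y z),
        C.Sq u (s.σ.hom k) → (z ≤ t ↔ y ≤ X.obj m.1) := by
    rintro k ⟨m, hm⟩
    have hmA : X.obj m ≤ A.obj (s.p.toFun k) := by rw [← hm]; exact p.le m
    obtain ⟨y, hy⟩ := C.exists_pullback (s.mid.obj k) (X.obj m) _ (s.p.le k) hmA
    have hyk : y ≤ s.mid.obj k := hy.1 (by simp)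
    have hym : y ≤ X.obj m := hy.1 (by simp)
    obtain ⟨t, w, hw⟩ := exists_lift_source (s.σ.hom k) hyk
    refine ⟨t, C.sq_right hw, fun z y' u hu => ⟨fun h => ?_, fun h => ?_⟩⟩
    · exact (C.sq_left (sq_of_le_right hu hw h)).trans hym
    · refine C.sq_right (sq_of_le_left hu hw (hy.2 ?_))
      simp only [mem_lowerBounds, Set.mem_insert_iff, Set.mem_singleton_iff, forall_eq_or_imp,
        forall_eq]
      exact ⟨C.sq_left hu, h⟩
  choose t htd ht using h1
  -- the common refinement
  let K : D.Idx → Type := fun d => {k // s.σ.toFun k = d}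
  have h2 : ∀ (d : D.Idx) (l : ∀ k : K d, {m // p.toFun m = s.p.toFun k.1}), ∃ z, z ≤ D.obj d ∧
      ∀ y, y ≤ D.obj d → (y ≤ z ↔ ∀ k : K d, y ≤ t k.1 (l k)) := by
    intro d l
    obtain ⟨z, hz⟩ := exists_finite_glb (D.obj d) (fun k : K d => t k.1 (l k)) (by
      rintro ⟨k, rfl⟩
      exact htd _ _)
    refine ⟨z, ((hz z).1 le_rfl).1, fun y hy => ?_⟩
    rw [hz]
    simp only [hy, true_and]
  choose z hzd hz using h2
  -- A member of `P` over `d` picks, for every `k` mapped to `d`, a member of `X` above the same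
  -- member of `A`, and intersects the transported pieces. Initial intersections are discarded; if
  -- no `k` maps to `d`, the intersection is all of `D.obj d`, up to vertical isomorphism.
  let P : SC C :=
    { Idx := {x : Σ d, ∀ k : K d, {m // p.toFun m = s.p.toFun k.1} // ¬ IsBot (z x.1 x.2)}
      obj := fun x => z x.1.1 x.1.2
      polytope := fun x => x.2 }
  let ρ : TwVert P D := ⟨fun x => x.1.1, fun x => hzd _ _⟩
  -- Two distinct choices differ at some `k`. Pulled back along the shuffle component at `k`, a
  -- common lower bound lies in two different members of `X` over one member of `A`.
  have hρ : ρ.IsSubMap := by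
    rintro ⟨⟨d, l⟩, hl⟩ ⟨⟨d', l'⟩, hl'⟩ hne e y hy hy'
    obtain rfl : d = d' := e
    have : l ≠ l' := by rintro rfl; exact hne rfl
    obtain ⟨k, hk⟩ := Function.ne_iff.1 this
    have hyd : y ≤ D.obj d := hy.trans (hzd _ _)
    have e1 := (hz d l y hyd).1 hy k
    have e2 := (hz d l' y hyd).1 hy' k
    obtain ⟨k, rfl⟩ := k
    obtain ⟨y', u, hu⟩ := C.exists_lift (s.σ.hom k) hyd
    refine isBot_of_hor u (hp (l ⟨k, rfl⟩).1 (l' ⟨k, rfl⟩).1 (fun h => hk (Subtype.ext h))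
      ((l _).2.trans (l' _).2.symm) y' ((ht _ _ _ _ _ hu).1 e1) ((ht _ _ _ _ _ hu).1 e2))
  -- For each `k` the transported pieces cover `D.obj d`; finitely many coverings have a common
  -- refinement.
  have hρc : ρ.IsCovering := by
    rw [TwVert.isCovering_iff] at hc ⊢
    intro d
    have h3 : ∀ k : K d, Cov (D.obj d) (fun y => ∃ m, y ≤ t k.1 m) := by
      rintro ⟨k, rfl⟩
      refine (((hc (s.p.toFun k)).restrict (s.p.le k)).hor (hinv (s.σ.hom k))).mono ?_
      rintro y - - ⟨x, v, hv, m, hm, hx⟩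
      exact ⟨⟨m, hm⟩, (ht _ _ _ _ _ (sq_hinv_right hv)).2 hx⟩
    refine (Cov.forall_finite h3).mono fun y hy hb h => ?_
    choose l hl using h
    have hyz : y ≤ z d l := (hz d l y hy).2 hl
    exact ⟨⟨⟨d, l⟩, fun h => hb fun x => hyz.trans (h x)⟩, rfl, hyz⟩
  have hπ : Epi (ofSub p hp) := epi_of_weq (weq_ofSub hp hc)
  have hρe : Epi (ofSub ρ hρ) := epi_of_weq (weq_ofSub hρ hρc)
  obtain ⟨q, hq⟩ := exists_ofSub_comp_eq p hp (s.toHom ≫ ofSub ρ hρ) (by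
    rintro i j x y g hx hg
    obtain ⟨d, y', u, v, rfl, ⟨k, rfl, rfl, hu⟩, hv⟩ := (graph_comp _ _ _ _ _).1 hg
    obtain ⟨e, hv'⟩ := (graph_ofSub _ _ _ _ _).1 hv
    obtain ⟨⟨d, l⟩, hl⟩ := j
    obtain rfl : d = s.σ.toFun k := e
    refine ⟨(l ⟨k, rfl⟩).1, (l _).2, (ht k _ _ _ _ hu).1 ?_⟩
    exact (hz _ l _ (C.sq_right hu)).1 (C.sq_left hv') ⟨k, rfl⟩)
  -- Precomposed with any shuffle component into `d`, a piece of `h` becomes a piece of `ofSub p hp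
  -- ≫ h'` and so lies in a member of `X`. Doing this for every `k` puts it in a member of `P`.
  -- Uniqueness, and the compatibility with `q`, follow from `hρe` and `hπ`.
  have desc : ∀ {E : SC C} (h' : X ⟶ E) (h : D ⟶ E), ofSub p hp ≫ h' = s.toHom ≫ h →
      ∃ h'' : P ⟶ E, ofSub ρ hρ ≫ h'' = h := by
    intro E h' h e
    refine exists_ofSub_comp_eq ρ hρ h fun d j x y g hx hg => ?_
    have hxd := (SC.Hom.graph_src_le hg).1
    have h4 : ∀ k : K d, ∃ m, x ≤ t k.1 m := by
      rintro ⟨k, rfl⟩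
      obtain ⟨x', u, hu⟩ := C.exists_lift (s.σ.hom k) hxd
      have h5 : SC.Hom.graph (s.toHom ≫ h) (s.p.toFun k) j (hcomp u g) :=
        (graph_comp _ _ _ _ _).2 ⟨_, _, _, _, rfl, ⟨k, rfl, rfl, hu⟩, hg⟩
      rw [← e, graph_ofSub_comp] at h5
      obtain ⟨m, hm, hg'⟩ := h5
      exact ⟨⟨m, hm⟩, (ht _ _ _ _ _ hu).2 (SC.Hom.graph_src_le hg').1⟩
    choose l hl using h4
    have hxz : x ≤ z d l := (hz d l x hxd).2 hl
    exact ⟨⟨⟨d, l⟩, fun h => hx fun x' => hxz.trans (h x')⟩, rfl, hxz⟩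
  refine ⟨P, q, ofSub ρ hρ, ⟨⟨hq⟩, ⟨PushoutCocone.IsColimit.mk _
    (fun c => (desc c.inl c.inr c.condition).choose) (fun c => ?_)
    (fun c => (desc c.inl c.inr c.condition).choose_spec) (fun c m _ hm => ?_)⟩⟩,
    weq_ofSub hρ hρc⟩
  · rw [← cancel_epi (ofSub p hp), ← Category.assoc, hq, Category.assoc,
      (desc c.inl c.inr c.condition).choose_spec, c.condition]
  · rw [← cancel_epi (ofSub ρ hρ), hm, (desc c.inl c.inr c.condition).choose_spec]

/-- A weak equivalence is a covering sub-map followed by a bijective shuffle, and the latter is an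
isomorphism. -/
theorem exists_isPushout_of_weq {A B D : SC C} {f : A ⟶ B} (hf : weq f) (g : A ⟶ D) :
    ∃ (P : SC C) (inl : B ⟶ P) (inr : D ⟶ P), IsPushout f g inl inr ∧ weq inr := by
  obtain ⟨s, rfl, hc, hb⟩ := hf
  obtain ⟨P, q, r, h, hr⟩ := exists_isPushout_ofSub s.p s.isSubMap hc g
  have := isIso_ofHor s.σ hb
  refine ⟨P, inv (ofHor s.σ) ≫ q, r, ?_, hr⟩
  rw [toHom_eq]
  refine IsPushout.of_iso h (Iso.refl _) (asIso (ofHor s.σ)) (Iso.refl _) (Iso.refl _) ?_ ?_ ?_ ?_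
    <;> simp

/-! ### Coproducts -/

/-- The codiagonal of a coproduct of copies of one object. -/
def fold (ι : Type) [Finite ι] (B : SC C) : sigma (fun _ : ι => B) ⟶ B :=
  ofHor ⟨fun x => x.2, fun x => hid (B.obj x.2)⟩

theorem inj_eq_ofHor {ι : Type} [Finite ι] (A : ι → SC C) (i : ι) :
    inj A i = ofHor (B := sigma A) ⟨fun a => ⟨i, a⟩, fun a => hid ((A i).obj a)⟩ := rfl

theorem ofHor_hid (A : SC C) : ofHor ⟨fun i => i, fun i => hid (A.obj i)⟩ = 𝟙 A := rfl

theorem inj_fold {ι : Type} [Finite ι] (B : SC C) (i : ι) :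
    inj (fun _ : ι => B) i ≫ fold ι B = 𝟙 B := by
  rw [inj_eq_ofHor, fold, ofHor_comp, ← ofHor_hid]
  simp only [hcomp_hid]

/-- The morphism from a coproduct with given components. -/
noncomputable def sigmaDesc {ι : Type} [Finite ι] {A : ι → SC C} {B : SC C} (f : ∀ i, A i ⟶ B) :
    sigma A ⟶ B := sigmaMap (fun i => i) f ≫ fold ι B

theorem inj_sigmaDesc {ι : Type} [Finite ι] {A : ι → SC C} {B : SC C} (f : ∀ i, A i ⟶ B)
    (i : ι) : inj A i ≫ sigmaDesc f = f i := by
  have := inj_sigmaMap (B := fun _ : ι => B) (fun i => i) f i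
  rw [sigmaDesc, ← Category.assoc, this, Category.assoc, inj_fold, Category.comp_id]

theorem rel_sigmaDesc {ι : Type} [Finite ι] {A : ι → SC C} {B : SC C} (f : ∀ i, A i ⟶ B)
    (i : ι) (a : (A i).Idx) (b : B.Idx) :
    Rel (sigmaDesc f) (⟨i, a⟩ : Σ i, (A i).Idx) b ↔ Rel (f i) a b := by
  rw [← inj_sigmaDesc f i, rel_comp]
  constructor
  · intro h
    exact ⟨_, (rel_ofHor _ _ _).2 rfl, h⟩
  · rintro ⟨x, hx, h⟩
    obtain rfl := (rel_ofHor _ _ _).1 hx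
    exact h

theorem cof_inj {ι : Type} [Finite ι] (A : ι → SC C) (i : ι) : cof (inj A i) := by
  rw [inj_eq_ofHor]
  exact cof_ofHor _ fun a b h => eq_of_heq (Sigma.mk.inj_iff.1 h).2

theorem rel_inj {ι : Type} [Finite ι] (A : ι → SC C) (i : ι) (a : (A i).Idx) (x : (sigma A).Idx) :
    Rel (inj A i) a x ↔ (⟨i, a⟩ : Σ i, (A i).Idx) = x := rel_ofHor _ _ _

/-- A morphism from a coproduct is a cofibration if its components are, and if their images are
disjoint. -/
theorem cof_of_inj_comp {ι : Type} [Finite ι] {A : ι → SC C} {B : SC C} (f : sigma A ⟶ B)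
    (hf : ∀ i, cof (inj A i ≫ f))
    (h : ∀ i i' a a' b, Rel (inj A i ≫ f) a b → Rel (inj A i' ≫ f) a' b → i = i') : cof f := by
  obtain ⟨s, rfl⟩ := exists_rep f
  refine ⟨s, rfl, ?_, ?_⟩
  · rw [TwVert.isCovering_iff]
    rintro ⟨i, a⟩
    have h1 := (cof_toHom (s := Span.comp _ s).1 (hf i)).1
    rw [TwVert.isCovering_iff] at h1
    refine (h1 a).mono ?_
    rintro y - - ⟨⟨⟨a', k⟩, hk⟩, rfl, hy⟩
    exact ⟨k, hk.symm, hy.trans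
      (sq_le_hid (Span.pullback_sq _ s ⟨⟨a', k⟩, hk⟩))⟩
  · intro k k' e
    have key : ∀ k, Rel (inj A (s.p.toFun k).1 ≫ s.toHom) (s.p.toFun k).2 (s.σ.toFun k) :=
      fun k => (rel_comp _ _ _ _).2 ⟨s.p.toFun k, (rel_inj _ _ _ _).2 rfl,
        (rel_toHom _ _ _).2 ⟨k, rfl, rfl⟩⟩
    have h0 := h _ _ _ _ _ (key k) (e ▸ key k')
    have h1 := (cof_toHom (s := Span.comp _ s).1 (hf (s.p.toFun k).1)).2
    -- Both pieces now lie over the same summand, so both come from the one restriction of `f` to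
    -- it, whose shuffle is injective.
    have h2 : ∀ (i : ι) (x : Σ i, (A i).Idx), i = x.1 → ∃ a', (⟨i, a'⟩ : Σ i, (A i).Idx) = x := by
      rintro _ ⟨i, a⟩ rfl
      exact ⟨a, rfl⟩
    obtain ⟨a', ha'⟩ := h2 _ _ h0
    have := @h1 ⟨((s.p.toFun k).2, k), rfl⟩ ⟨(a', k'), ha'⟩ e
    exact congrArg (fun x => x.1.2) this

theorem weq_sigmaMap {ι : Type} [Finite ι] {A B : ι → SC C} (f : ∀ i, A i ⟶ B i)
    (hf : ∀ i, weq (f i)) : weq (sigmaMap (fun i => i) f) := by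
  refine weq_of_cof (cof_sigmaMap _ Function.injective_id f fun i => cof_of_weq (hf i)) ?_
  rintro ⟨i, b⟩
  obtain ⟨a, h⟩ := exists_rel_of_weq (hf i) b
  exact ⟨⟨i, a⟩, (rel_sigmaMap _ _ _ _ _).2 ⟨b, rfl, h⟩⟩

/-! ### Subobjects -/

theorem incl_eq_ofHor (A : SC C) (S : Set A.Idx) :
    A.incl S = ofHor (A := A.restr S) ⟨fun i => i.1, fun i => hid (A.obj i.1)⟩ := rfl

theorem cof_incl (A : SC C) (S : Set A.Idx) : cof (A.incl S) := by
  rw [incl_eq_ofHor]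
  exact cof_ofHor _ Subtype.val_injective

/-- The restriction is a weak equivalence onto the exact image `T'` of `S`, followed by the
inclusion of `T'` in `T`. -/
theorem cof_restrMap {A B : SC C} {f : A ⟶ B} (hf : cof f) (S : Set A.Idx) (T : Set B.Idx)
    (h : ∀ i j, i ∈ S → Rel f i j → j ∈ T) : cof (restrMap f S T) := by
  let T' : Set B.Idx := {j | ∃ i ∈ S, Rel f i j}
  have h1 : weq (restrMap f S T') := weq_restrMap hf S T' fun j => Iff.rfl
  have h2 : restrMap f S T' ≫ restrMap (𝟙 B) T' T = restrMap f S T := by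
    have := restrMap_comp f (𝟙 B) (S := S) (T := T') (R := T) fun i j hi hr => ⟨i, hi, hr⟩
    rwa [Category.comp_id] at this
  have hT : T' ⊆ T := by
    rintro j ⟨i, hi, hr⟩
    exact h i j hi hr
  have h3 : restrMap (𝟙 B) T' T =
      ofHor (A := B.restr T') (B := B.restr T)
        ⟨fun i => ⟨i.1, hT i.2⟩, fun i => hid (B.obj i.1)⟩ := by
    refine hom_ext fun i j x y g => ?_
    rw [graph_restrMap, graph_ofHor]
    change (Span.id B).graph _ _ g ↔ _
    rw [Span.graph_id, Subtype.ext_iff]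
  rw [← h2, h3]
  exact cof_comp (cof_of_weq h1) (cof_ofHor _ fun i j e => Subtype.ext (congrArg (fun x => x.1) e))

/-- With `comp_proj_im_incl` this factors a cofibration as a weak equivalence onto its image
followed by the inclusion of a subobject, which reduces pushouts along cofibrations to two simple
kinds. -/
theorem weq_proj_of_cof {A B : SC C} {f : A ⟶ B} (hf : cof f) : weq (f ≫ B.proj (im f)) := by
  have h1 := weq_restrMap hf Set.univ (im f) fun j => by simp [mem_im]
  have h2 : f ≫ B.proj (im f) = A.proj Set.univ ≫ restrMap f Set.univ (im f) := by
    rw [restrMap, proj_incl_comp _ Set.univ fun _ _ _ => Set.mem_univ _]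
  rw [h2]
  refine weq_comp (weq_of_isIso _ ?_) h1
  refine ⟨A.incl _, ?_, incl_proj _ _⟩
  have := proj_incl_comp (𝟙 A) Set.univ fun _ _ _ => Set.mem_univ _
  rwa [Category.comp_id] at this

theorem comp_proj_im_incl {A B : SC C} (f : A ⟶ B) : (f ≫ B.proj (im f)) ≫ B.incl (im f) = f := by
  rw [Category.assoc, comp_proj_incl f (im f) fun i j h => (mem_im _ _).2 ⟨i, h⟩]

/-! ### Binary coproducts and pushouts along cofibrations -/

/-- A family of two objects. -/
def pairFam (X Y : SC C) : Bool → SC C := fun b => cond b X Y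

/-- The morphism of families of two objects. -/
def pairMap {X Y X' Y' : SC C} (f : X ⟶ X') (g : Y ⟶ Y') : ∀ b, pairFam X Y b ⟶ pairFam X' Y' b
  | true => f
  | false => g

/-- The coproduct of two objects. -/
@[reducible] def sum (X Y : SC C) : SC C := sigma (pairFam X Y)

/-- The inclusion of the first summand. -/
def inl (X Y : SC C) : X ⟶ sum X Y := inj (pairFam X Y) true

/-- The inclusion of the second summand. -/
def inr (X Y : SC C) : Y ⟶ sum X Y := inj (pairFam X Y) false

theorem inl_eq_ofHor (X Y : SC C) :
    inl X Y = ofHor (A := X) (B := sum X Y) ⟨fun a => ⟨true, a⟩, fun a => hid (X.obj a)⟩ := rfl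

theorem inr_eq_ofHor (X Y : SC C) :
    inr X Y = ofHor (A := Y) (B := sum X Y) ⟨fun a => ⟨false, a⟩, fun a => hid (Y.obj a)⟩ := rfl

/-- The morphism of coproducts induced by a morphism of the first summands. -/
noncomputable def sumMap {S D : SC C} (g : S ⟶ D) (T : SC C) : sum S T ⟶ sum D T :=
  sigmaMap (fun b => b) (pairMap g (𝟙 T))

theorem inl_sumMap {S D : SC C} (g : S ⟶ D) (T : SC C) : inl S T ≫ sumMap g T = g ≫ inl D T :=
  inj_sigmaMap (fun b => b) (pairMap g (𝟙 T)) true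

theorem inr_sumMap {S D : SC C} (g : S ⟶ D) (T : SC C) : inr S T ≫ sumMap g T = inr D T :=
  (inj_sigmaMap (fun b => b) (pairMap g (𝟙 T)) false).trans (Category.id_comp _)

theorem sum_hom_ext {X Y E : SC C} {f f' : sum X Y ⟶ E} (h : inl X Y ≫ f = inl X Y ≫ f')
    (h' : inr X Y ≫ f = inr X Y ≫ f') : f = f' :=
  sigma_hom_ext fun b => match b with
    | true => h
    | false => h'

theorem exists_sumDesc {X Y E : SC C} (f : X ⟶ E) (f' : Y ⟶ E) :
    ∃ g : sum X Y ⟶ E, inl X Y ≫ g = f ∧ inr X Y ≫ g = f' := by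
  let F : ∀ b, pairFam X Y b ⟶ E := fun b => match b with
    | true => f
    | false => f'
  exact ⟨sigmaDesc F, inj_sigmaDesc F true, inj_sigmaDesc F false⟩

theorem cof_of_inl_inr {X Y E : SC C} {f : sum X Y ⟶ E} (hl : cof (inl X Y ≫ f))
    (hr : cof (inr X Y ≫ f))
    (h : ∀ a b c, Rel (inl X Y ≫ f) a c → Rel (inr X Y ≫ f) b c → False) : cof f := by
  refine cof_of_inj_comp f ?_ ?_
  · rintro (_ | _)
    · exact hr
    · exact hl
  · rintro (_ | _) (_ | _) a b c hac hbc
    · rfl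
    · exact (h _ _ _ hbc hac).elim
    · exact (h _ _ _ hac hbc).elim
    · rfl

/-- An object is the coproduct of two complementary subobjects. -/
noncomputable def splitMap (B : SC C) (S : Set B.Idx) : sum (B.restr S) (B.restr Sᶜ) ⟶ B :=
  ofHor ⟨fun x => match x with | ⟨true, i⟩ => i.1 | ⟨false, i⟩ => i.1,
    fun x => match x with | ⟨true, i⟩ => hid (B.obj i.1) | ⟨false, i⟩ => hid (B.obj i.1)⟩

theorem inl_splitMap (B : SC C) (S : Set B.Idx) :
    inl (B.restr S) (B.restr Sᶜ) ≫ splitMap B S = B.incl S := by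
  rw [inl_eq_ofHor, incl_eq_ofHor]
  refine (ofHor_comp _ _).trans ?_
  congr 2
  funext i
  exact hcomp_hid _

theorem inr_splitMap (B : SC C) (S : Set B.Idx) :
    inr (B.restr S) (B.restr Sᶜ) ≫ splitMap B S = B.incl Sᶜ := by
  rw [inr_eq_ofHor, incl_eq_ofHor]
  refine (ofHor_comp _ _).trans ?_
  congr 2
  funext i
  exact hcomp_hid _

instance isIso_splitMap (B : SC C) (S : Set B.Idx) : IsIso (splitMap B S) := by
  apply isIso_ofHor
  constructor
  · rintro ⟨(_ | _), i⟩ ⟨(_ | _), j⟩ h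
    · obtain rfl : i = j := Subtype.ext h
      rfl
    · exact absurd (show (i : Subtype _).1 ∈ S by rw [show i.1 = j.1 from h]; exact j.2) i.2
    · exact absurd (show (j : Subtype _).1 ∈ S by rw [← show i.1 = j.1 from h]; exact i.2) j.2
    · obtain rfl : i = j := Subtype.ext h
      rfl
  · intro b
    by_cases hb : b ∈ S
    · exact ⟨⟨true, ⟨b, hb⟩⟩, rfl⟩
    · exact ⟨⟨false, ⟨b, hb⟩⟩, rfl⟩

theorem isPushout_inl {S D : SC C} (g : S ⟶ D) (T : SC C) :
    IsPushout (inl S T) g (sumMap g T) (inl D T) := by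
  have desc : ∀ {E : SC C} (h : sum S T ⟶ E) (k : D ⟶ E), inl S T ≫ h = g ≫ k →
      ∃ d : sum D T ⟶ E, sumMap g T ≫ d = h ∧ inl D T ≫ d = k := by
    intro E h k e
    obtain ⟨d, hd, hd'⟩ := exists_sumDesc k (inr S T ≫ h)
    refine ⟨d, sum_hom_ext ?_ ?_, hd⟩
    · rw [← Category.assoc, inl_sumMap, Category.assoc, hd, e]
    · rw [← Category.assoc, inr_sumMap, hd']
  refine ⟨⟨inl_sumMap g T⟩, ⟨PushoutCocone.IsColimit.mk _
    (fun c => (desc c.inl c.inr c.condition).choose)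
    (fun c => (desc c.inl c.inr c.condition).choose_spec.1)
    (fun c => (desc c.inl c.inr c.condition).choose_spec.2) fun c m hm hm' => ?_⟩⟩
  obtain ⟨h₁, h₂⟩ := (desc c.inl c.inr c.condition).choose_spec
  refine sum_hom_ext (hm'.trans h₂.symm) ?_
  rw [← inr_sumMap g T, Category.assoc, Category.assoc, hm, h₁]

/-- `B` is the coproduct of the two complementary subobjects, so cobase change replaces the summand
`B.restr S` by `D` and keeps the other one. -/
theorem isPushout_incl (B : SC C) (S : Set B.Idx) {D : SC C} (g : B.restr S ⟶ D) :
    IsPushout (B.incl S) g (inv (splitMap B S) ≫ sumMap g (B.restr Sᶜ))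
      (inl D (B.restr Sᶜ)) := by
  rw [← inl_splitMap]
  refine IsPushout.of_iso (isPushout_inl g (B.restr Sᶜ)) (Iso.refl _) (asIso (splitMap B S))
    (Iso.refl _) (Iso.refl _) ?_ ?_ ?_ ?_ <;> simp

/-- The cobase change of the weak equivalence onto the image is pasted with that of the inclusion of
the image. -/
theorem exists_isPushout_of_cof {A B D : SC C} {f : A ⟶ B} (hf : cof f) (g : A ⟶ D) :
    ∃ (P : SC C) (inl : B ⟶ P) (inr : D ⟶ P), IsPushout f g inl inr ∧ cof inr := by
  obtain ⟨P, inl, inr, h, hr⟩ := exists_isPushout_of_weq (weq_proj_of_cof hf) g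
  have h' := isPushout_incl B (im f) inl
  have h2 := h.paste_horiz h'
  rw [comp_proj_im_incl] at h2
  exact ⟨_, _, _, h2, cof_comp (cof_of_weq hr) (cof_inj _ _)⟩

theorem cof_cobaseChange {A B D P : SC C} {f : A ⟶ B} {g : A ⟶ D} {inl : B ⟶ P} {inr : D ⟶ P}
    (h : IsPushout f g inl inr) (hf : cof f) : cof inr := by
  obtain ⟨P', inl', inr', h', hr⟩ := exists_isPushout_of_cof hf g
  rw [← h'.inr_isoIsPushout_hom _ _ h]
  exact cof_comp hr (cof_of_weq (weq_of_isIso _ inferInstance))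

/-! ### Zero objects -/

/-- The empty family. -/
def empty (C : PolytopeComplex.{v, u}) : SC C := ⟨Empty, fun i => i.elim, fun i => i.elim⟩

theorem isZero_empty : IsZero (empty C) := by
  have h : ∀ i : (empty C).Idx, False := fun i => Empty.elim i
  refine ⟨fun B => ⟨⟨⟨ofHor ⟨fun i => (h i).elim, fun i => (h i).elim⟩⟩,
      fun f => hom_ext fun i => (h i).elim⟩⟩,
    fun B => ⟨⟨⟨ofSub ⟨fun i => (h i).elim, fun i => (h i).elim⟩ fun i => (h i).elim⟩,
      fun f => hom_ext fun _ i => (h i).elim⟩⟩⟩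

/-- The identity of a zero object factors through the empty family, so it relates no index to
itself. -/
theorem isEmpty_idx_of_isZero {Z : SC C} (hZ : IsZero Z) : IsEmpty Z.Idx := by
  refine ⟨fun i => ?_⟩
  have h1 := (rel_id (A := Z) i i).2 rfl
  have h2 : 𝟙 Z = hZ.to_ (empty C) ≫ hZ.from_ (empty C) := hZ.eq_of_src _ _
  rw [h2] at h1
  obtain ⟨j, -, -⟩ := (rel_comp _ _ _ _).1 h1
  exact Empty.elim j

theorem cof_of_isEmpty {A B : SC C} (f : A ⟶ B) (hA : IsEmpty A.Idx) : cof f := by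
  obtain ⟨s, rfl⟩ := exists_rep f
  exact ⟨s, rfl, fun i => hA.elim i, fun k => hA.elim (s.p.toFun k)⟩

end SC

/-! ### Formal arguments valid for general categories with cofibrations and weak equivalences -/

section General

universe v₁ u₁ v₂ u₂

variable {E : Type u₁} [Category.{v₁} E] [WaldhausenData E]

/-- The gluing axiom holds if weak equivalences are epimorphisms and stable under cobase change. -/
theorem weq_gluing (hcomp : ∀ {A B D : E} (f : A ⟶ B) (g : B ⟶ D), weq f → weq g → weq (f ≫ g))
    (hiso : ∀ {A B : E} (f : A ⟶ B), IsIso f → weq f)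
    (hepi : ∀ {A B : E} (f : A ⟶ B), weq f → Epi f)
    (hpush : ∀ {A B D : E} (f : A ⟶ B) (g : A ⟶ D), weq f →
      ∃ (P : E) (inl : B ⟶ P) (inr : D ⟶ P), IsPushout f g inl inr ∧ weq inr)
    {A B D P A' B' D' P' : E} {f : A ⟶ B} {g : A ⟶ D} {inl : B ⟶ P} {inr : D ⟶ P}
    {f' : A' ⟶ B'} {g' : A' ⟶ D'} {inl' : B' ⟶ P'} {inr' : D' ⟶ P'}
    (α : A ⟶ A') (β : B ⟶ B') (δ : D ⟶ D') (φ : P ⟶ P')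
    (h : IsPushout f g inl inr) (h' : IsPushout f' g' inl' inr')
    (hf : f ≫ β = α ≫ f') (hg : g ≫ δ = α ≫ g') (hl : inl ≫ φ = β ≫ inl')
    (hr : inr ≫ φ = δ ≫ inr') (hα : weq α) (hβ : weq β) (hδ : weq δ) : weq φ := by
  -- Replacing `B` by `B'` and then `D` by `D'` changes `P` to `Q` by two cobase changes of weak
  -- equivalences, so `P ⟶ Q` is a weak equivalence.
  obtain ⟨P₁, i₁, j₁, h₁, hj₁⟩ := hpush β inl hβ
  obtain ⟨Q, i₂, j₂, h₂, hj₂⟩ := hpush δ (inr ≫ j₁) hδ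
  have hQ := (h.paste_horiz h₁).paste_vert h₂.flip
  rw [hf, hg] at hQ
  have := hepi α hα
  -- As `α` is an epimorphism, gluing over `A` and over `A'` gives the same pushout; hence `Q` is
  -- isomorphic to `P'`.
  have hP' : IsPushout (α ≫ f') (α ≫ g') inl' inr' :=
    ⟨⟨by rw [Category.assoc, h'.w, Category.assoc]⟩, ⟨PushoutCocone.IsColimit.mk _
      (fun c => h'.desc c.inl c.inr (by
        rw [← cancel_epi α, ← Category.assoc, c.condition, Category.assoc]))
      (fun c => h'.inl_desc _ _ _) (fun c => h'.inr_desc _ _ _)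
      fun c m hm hm' => h'.hom_ext (by rw [hm, h'.inl_desc]) (by rw [hm', h'.inr_desc])⟩⟩
  have e : φ = j₁ ≫ j₂ ≫ (hQ.isoIsPushout _ _ hP').hom := by
    refine h.hom_ext ?_ ?_
    · rw [hl, ← Category.assoc, ← h₁.w, Category.assoc, ← Category.assoc i₁,
        hQ.inl_isoIsPushout_hom _ _ hP']
    · rw [hr, ← Category.assoc, ← Category.assoc, ← h₂.w, Category.assoc,
        hQ.inr_isoIsPushout_hom _ _ hP']
  rw [e]
  exact hcomp _ _ hj₁ (hcomp _ _ hj₂ (hiso _ inferInstance))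

/-! ### Transport along an equivalence -/

theorem isZero_map_of_isEquivalence {E : Type u₁} [Category.{v₁} E] {E' : Type u₂}
    [Category.{v₂} E'] (F : E ⥤ E') [F.IsEquivalence] {Z : E} (hZ : IsZero Z) :
    IsZero (F.obj Z) := by
  have h1 := hZ.isInitial.isInitialObj F
  have h2 := hZ.isTerminal.isTerminalObj F
  exact ⟨fun Y => ⟨⟨⟨h1.to Y⟩, fun f => h1.hom_ext _ _⟩⟩,
    fun Y => ⟨⟨⟨h2.from Y⟩, fun f => h2.hom_ext _ _⟩⟩⟩

theorem IsWaldhausen.of_isEquivalence {E' : Type u₂} [Category.{v₂} E'] [WaldhausenData E']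
    (h : IsWaldhausen E') (F : E ⥤ E') [F.IsEquivalence]
    (hcof : ∀ {A B : E} (f : A ⟶ B), cof f ↔ cof (F.map f))
    (hweq : ∀ {A B : E} (f : A ⟶ B), weq f ↔ weq (F.map f)) : IsWaldhausen E where
  hasZeroObject := by
    obtain ⟨Z, hZ⟩ := h.hasZeroObject
    exact ⟨F.inv.obj Z, isZero_map_of_isEquivalence F.inv hZ⟩
  cof_of_isIso f _ := (hcof f).2 (h.cof_of_isIso _ inferInstance)
  cof_comp f g hf hg := (hcof _).2 (by
    rw [F.map_comp]; exact h.cof_comp _ _ ((hcof f).1 hf) ((hcof g).1 hg))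
  cof_of_isZero f hZ := (hcof f).2 (h.cof_of_isZero _ (isZero_map_of_isEquivalence F hZ))
  hasPushout f g hf := by
    have := h.hasPushout (F.map f) (F.map g) ((hcof f).1 hf)
    have : HasColimit (span f g ⋙ F) := hasColimit_of_iso (spanCompIso F f g)
    exact Adjunction.hasColimit_of_comp_equivalence (span f g) F
  cof_cobaseChange hp hf := (hcof _).2 (h.cof_cobaseChange (hp.map F) ((hcof _).1 hf))
  weq_of_isIso f _ := (hweq f).2 (h.weq_of_isIso _ inferInstance)
  weq_comp f g hf hg := (hweq _).2 (by
    rw [F.map_comp]; exact h.weq_comp _ _ ((hweq f).1 hf) ((hweq g).1 hg))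
  gluing α β δ φ hp hp' hf hf' e1 e2 e3 e4 hα hβ hδ := (hweq φ).2 (
    h.gluing (F.map α) (F.map β) (F.map δ) (F.map φ) (hp.map F) (hp'.map F) ((hcof _).1 hf)
      ((hcof _).1 hf') (by rw [← F.map_comp, e1, F.map_comp])
      (by rw [← F.map_comp, e2, F.map_comp]) (by rw [← F.map_comp, e3, F.map_comp])
      (by rw [← F.map_comp, e4, F.map_comp]) ((hweq _).1 hα) ((hweq _).1 hβ) ((hweq _).1 hδ))

/-- Zero objects and pushouts are preserved by every equivalence, so only the two classes of
morphisms need checking. -/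
theorem IsExactFunctor.of_isEquivalence {E' : Type u₂} [Category.{v₂} E'] [WaldhausenData E']
    (F : E ⥤ E') [F.IsEquivalence] (hcof : ∀ {A B : E} (f : A ⟶ B), cof f → cof (F.map f))
    (hweq : ∀ {A B : E} (f : A ⟶ B), weq f → weq (F.map f)) : IsExactFunctor F where
  map_isZero hZ := isZero_map_of_isEquivalence F hZ
  map_cof hf := hcof _ hf
  map_weq hf := hweq _ hf
  map_isPushout _ hp := hp.map F

/-! ### Products -/

section Pi

variable {ι : Type u₂} {X : ι → Type u₁} [∀ i, Category.{v₁} (X i)]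

theorem isPushout_pi {A B D P : ∀ i, X i} {f : A ⟶ B} {g : A ⟶ D} {inl : B ⟶ P} {inr : D ⟶ P}
    (h : ∀ i, IsPushout (f i) (g i) (inl i) (inr i)) : IsPushout f g inl inr :=
  ⟨⟨funext fun i => (h i).w⟩, ⟨PushoutCocone.IsColimit.mk _
    (fun c i => (h i).desc (c.inl i) (c.inr i) (congrFun c.condition i))
    (fun _ => funext fun i => (h i).inl_desc _ _ _)
    (fun _ => funext fun i => (h i).inr_desc _ _ _)
    fun _ _ hm hm' => funext fun i => (h i).hom_ext
      ((congrFun hm i).trans ((h i).inl_desc _ _ _).symm)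
      ((congrFun hm' i).trans ((h i).inr_desc _ _ _).symm)⟩⟩

theorem isIso_pi_apply {A B : ∀ i, X i} (f : A ⟶ B) [IsIso f] (i : ι) : IsIso (f i) :=
  inferInstanceAs (IsIso ((Pi.eval X i).map f))

variable [∀ i, WaldhausenData (X i)]

/-- Along a cofibration the componentwise pushout exists, and the given pushout is isomorphic to it;
this is what `hf` is for. -/
theorem isPushout_pi_apply (hX : ∀ i, IsWaldhausen (X i)) {A B D P : ∀ i, X i} {f : A ⟶ B}
    {g : A ⟶ D} {inl : B ⟶ P} {inr : D ⟶ P} (hf : cof f) (h : IsPushout f g inl inr) (i : ι) :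
    IsPushout (f i) (g i) (inl i) (inr i) := by
  have hp : ∀ i, HasPushout (f i) (g i) := fun i => (hX i).hasPushout _ _ (hf i)
  have h' : IsPushout f g (P := fun i => pushout (f i) (g i)) (fun i => pushout.inl _ _)
    (fun i => pushout.inr _ _) := isPushout_pi fun i => IsPushout.of_hasPushout _ _
  have hi := isIso_pi_apply (h'.isoIsPushout _ _ h).hom i
  refine IsPushout.of_iso (IsPushout.of_hasPushout (f i) (g i)) (Iso.refl _) (Iso.refl _)
    (Iso.refl _) (asIso ((h'.isoIsPushout _ _ h).hom i)) (by simp) (by simp) ?_ ?_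
  · exact (congrFun (h'.inl_isoIsPushout_hom _ _ h) i).trans (Category.id_comp _).symm
  · exact (congrFun (h'.inr_isoIsPushout_hom _ _ h) i).trans (Category.id_comp _).symm

theorem isZero_pi_apply (hX : ∀ i, IsWaldhausen (X i)) {Z : ∀ i, X i} (hZ : IsZero Z) (i : ι) :
    IsZero (Z i) := by
  have h0 := fun i => (hX i).hasZeroObject
  choose Y hY using fun i => (h0 i).zero
  have h : IsZero Y := ⟨fun W => ⟨⟨⟨fun i => (hY i).to_ _⟩,
      fun f => funext fun i => (hY i).eq_of_src _ _⟩⟩,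
    fun W => ⟨⟨⟨fun i => (hY i).from_ _⟩, fun f => funext fun i => (hY i).eq_of_tgt _ _⟩⟩⟩
  exact (hY i).of_iso ((Pi.eval X i).mapIso (hZ.iso h))

theorem IsWaldhausen.pi (hX : ∀ i, IsWaldhausen (X i)) : IsWaldhausen (∀ i, X i) where
  hasZeroObject := by
    choose Y hY using fun i => (hX i).hasZeroObject.zero
    exact ⟨Y, ⟨fun W => ⟨⟨⟨fun i => (hY i).to_ _⟩,
        fun f => funext fun i => (hY i).eq_of_src _ _⟩⟩,
      fun W => ⟨⟨⟨fun i => (hY i).from_ _⟩, fun f => funext fun i => (hY i).eq_of_tgt _ _⟩⟩⟩⟩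
  cof_of_isIso f _ i := (hX i).cof_of_isIso _ (isIso_pi_apply f i)
  cof_comp f g hf hg i := (hX i).cof_comp _ _ (hf i) (hg i)
  cof_of_isZero f hZ i := (hX i).cof_of_isZero _ (isZero_pi_apply hX hZ i)
  hasPushout f g hf := by
    have hp : ∀ i, HasPushout (f i) (g i) := fun i => (hX i).hasPushout _ _ (hf i)
    have h' : IsPushout f g (P := fun i => pushout (f i) (g i)) (fun i => pushout.inl _ _)
      (fun i => pushout.inr _ _) := isPushout_pi fun i => IsPushout.of_hasPushout _ _
    exact h'.hasPushout
  cof_cobaseChange hp hf i := (hX i).cof_cobaseChange (isPushout_pi_apply hX hf hp i) (hf i)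
  weq_of_isIso f _ i := (hX i).weq_of_isIso _ (isIso_pi_apply f i)
  weq_comp f g hf hg i := (hX i).weq_comp _ _ (hf i) (hg i)
  gluing α β δ φ hp hp' hf hf' e1 e2 e3 e4 hα hβ hδ i :=
    (hX i).gluing (α i) (β i) (δ i) (φ i) (isPushout_pi_apply hX hf hp i)
      (isPushout_pi_apply hX hf' hp' i) (hf i) (hf' i) (congrFun e1 i) (congrFun e2 i)
      (congrFun e3 i) (congrFun e4 i) (hα i) (hβ i) (hδ i)

end Pi

/-! ### Sequences of acyclic cofibrations -/

section Acyclic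

variable {n : ℕ}

theorem acyclic_hom_ext {A B : AcyclicFilteredObj E n} {f g : A ⟶ B}
    (h : ∀ i, f.hom.hom.app i = g.hom.hom.app i) : f = g := by
  apply ObjectProperty.hom_ext
  apply ObjectProperty.hom_ext
  ext i
  exact h i

/-- The evaluation at a level. -/
def acyclicEval (E : Type u₁) [Category.{v₁} E] [WaldhausenData E] {n : ℕ} (i : Fin n) :
    AcyclicFilteredObj E n ⥤ E :=
  ObjectProperty.ι _ ⋙ ObjectProperty.ι _ ⋙ (evaluation _ _).obj i

theorem isIso_acyclic_app {A B : AcyclicFilteredObj E n} (f : A ⟶ B) [IsIso f] (i : Fin n) :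
    IsIso (f.hom.hom.app i) := inferInstanceAs (IsIso ((acyclicEval E i).map f))

/-- The corner map is even a weak equivalence: preceded by the leg from `B_i`, itself a weak
equivalence, it gives the acyclic map `B_i ⟶ B_j`, so `hc` cancels the leg. -/
theorem acyclic_cof_iff (hE : IsWaldhausen E) (hw : ∀ {A B : E} (f : A ⟶ B), weq f → cof f)
    (hc : ∀ {A B D : E} (f : A ⟶ B) (g : B ⟶ D), weq f → weq (f ≫ g) → weq g)
    {A B : AcyclicFilteredObj E n} (f : A ⟶ B) : cof f ↔ ∀ i, cof (f.hom.hom.app i) := by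
  refine ⟨fun h => h.1, fun h => ⟨h, fun i j hij => ?_⟩⟩
  have := hE.hasPushout (f.hom.hom.app i) (A.obj.obj.map (homOfLE hij.le)) (h i)
  have hp := IsPushout.of_hasPushout (f.hom.hom.app i) (A.obj.obj.map (homOfLE hij.le))
  refine ⟨_, _, _, hp.desc (B.obj.obj.map (homOfLE hij.le)) (f.hom.hom.app j)
    (f.hom.hom.naturality _).symm, hp, hp.inl_desc _ _ _, hp.inr_desc _ _ _, hw _ ?_⟩
  refine hc (pushout.inl _ _) _ ?_ (by rw [hp.inl_desc]; exact B.property _ _ _)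
  -- The leg from `B_i` is the map of pushouts induced by `A_i ⟶ A_j`, starting from the trivial
  -- pushout; gluing makes it a weak equivalence.
  have h0 : IsPushout (f.hom.hom.app i) (𝟙 _) (𝟙 _) (f.hom.hom.app i) :=
    IsPushout.of_vert_isIso ⟨by simp⟩
  exact hE.gluing (𝟙 _) (𝟙 _) (A.obj.obj.map (homOfLE hij.le)) _ h0 hp (h i) (h i) (by simp)
    (by simp) rfl hp.w (hE.weq_of_isIso _ inferInstance) (hE.weq_of_isIso _ inferInstance)
    (A.property _ _ _)

theorem isPushout_acyclic {A B D P : AcyclicFilteredObj E n} {f : A ⟶ B} {g : A ⟶ D}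
    {inl : B ⟶ P} {inr : D ⟶ P}
    (h : ∀ i, IsPushout (f.hom.hom.app i) (g.hom.hom.app i) (inl.hom.hom.app i)
      (inr.hom.hom.app i)) : IsPushout f g inl inr := by
  have h1 : IsPushout f.hom.hom g.hom.hom inl.hom.hom inr.hom.hom :=
    IsPushout.of_forall_isPushout_app h
  have h2 : IsPushout f.hom g.hom inl.hom inr.hom :=
    IsPushout.of_map (ObjectProperty.ι _) (ObjectProperty.hom_ext _ h1.w) h1
  exact IsPushout.of_map (ObjectProperty.ι _) (ObjectProperty.hom_ext _ h2.w) h2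

/-- The pushout is formed levelwise; its structure maps are weak equivalences by the gluing axiom,
and therefore cofibrations by `hw`. -/
theorem exists_isPushout_acyclic (hE : IsWaldhausen E)
    (hw : ∀ {A B : E} (f : A ⟶ B), weq f → cof f) {A B D : AcyclicFilteredObj E n} (f : A ⟶ B)
    (g : A ⟶ D) (hf : ∀ i, cof (f.hom.hom.app i)) :
    ∃ (P : AcyclicFilteredObj E n) (inl : B ⟶ P) (inr : D ⟶ P), ∀ i,
      IsPushout (f.hom.hom.app i) (g.hom.hom.app i) (inl.hom.hom.app i) (inr.hom.hom.app i) := by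
  have hp : ∀ i, HasPushout (f.hom.hom.app i) (g.hom.hom.app i) := fun i => hE.hasPushout _ _ (hf i)
  have H : ∀ i, IsPushout (f.hom.hom.app i) (g.hom.hom.app i) _ _ :=
    fun i => IsPushout.of_hasPushout _ _
  have hw' : ∀ {i j : Fin n} (h : i ⟶ j),
      f.hom.hom.app i ≫ B.obj.obj.map h ≫ pushout.inl (f.hom.hom.app j) (g.hom.hom.app j) =
        g.hom.hom.app i ≫ D.obj.obj.map h ≫ pushout.inr _ _ := by
    intro i j h
    rw [← Category.assoc, ← f.hom.hom.naturality, Category.assoc, (H j).w, ← Category.assoc,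
      g.hom.hom.naturality, Category.assoc]
  let P : Fin n ⥤ E :=
    { obj := fun i => pushout (f.hom.hom.app i) (g.hom.hom.app i)
      map := fun h => (H _).desc _ _ (hw' h)
      map_id := fun i => (H i).hom_ext (by simp) (by simp)
      map_comp := fun h h' => (H _).hom_ext (by simp) (by simp) }
  have hP : ∀ (i j : Fin n) (h : i ⟶ j), weq (P.map h) := fun i j h =>
    hE.gluing (A.obj.obj.map h) (B.obj.obj.map h) (D.obj.obj.map h) (P.map h) (H i) (H j) (hf i)
      (hf j) (f.hom.hom.naturality h).symm (g.hom.hom.naturality h).symm ((H i).inl_desc _ _ _)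
      ((H i).inr_desc _ _ _) (A.property _ _ h) (B.property _ _ h) (D.property _ _ h)
  exact ⟨⟨⟨P, fun i j h => hw _ (hP i j h)⟩, hP⟩,
    ObjectProperty.homMk (ObjectProperty.homMk
      { app := fun i => pushout.inl _ _
        naturality := fun i j h => ((H i).inl_desc _ _ _).symm }),
    ObjectProperty.homMk (ObjectProperty.homMk
      { app := fun i => pushout.inr _ _
        naturality := fun i j h => ((H i).inr_desc _ _ _).symm }), H⟩

theorem isPushout_acyclic_app (hE : IsWaldhausen E)
    (hw : ∀ {A B : E} (f : A ⟶ B), weq f → cof f) {A B D P : AcyclicFilteredObj E n} {f : A ⟶ B}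
    {g : A ⟶ D} {inl : B ⟶ P} {inr : D ⟶ P} (hf : ∀ i, cof (f.hom.hom.app i))
    (h : IsPushout f g inl inr) (i : Fin n) :
    IsPushout (f.hom.hom.app i) (g.hom.hom.app i) (inl.hom.hom.app i) (inr.hom.hom.app i) := by
  obtain ⟨P', inl', inr', H⟩ := exists_isPushout_acyclic hE hw f g hf
  have h' := isPushout_acyclic H
  have e1 := congrArg (acyclicEval E i).map (h'.inl_isoIsPushout_hom _ _ h)
  have e2 := congrArg (acyclicEval E i).map (h'.inr_isoIsPushout_hom _ _ h)
  rw [Functor.map_comp] at e1 e2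
  exact IsPushout.of_iso (H i) (Iso.refl _) (Iso.refl _) (Iso.refl _)
    ((acyclicEval E i).mapIso (h'.isoIsPushout _ _ h)) (by simp) (by simp)
    (e1.trans (Category.id_comp _).symm) (e2.trans (Category.id_comp _).symm)

theorem exists_isZero_acyclic (hE : IsWaldhausen E) (n : ℕ) :
    ∃ Z : AcyclicFilteredObj E n, IsZero Z ∧ ∀ i, IsZero (Z.obj.obj.obj i) := by
  obtain ⟨Y, hY⟩ := hE.hasZeroObject
  let Z : AcyclicFilteredObj E n := ⟨⟨(Functor.const _).obj Y,
    fun _ _ _ => hE.cof_of_isIso (𝟙 Y) inferInstance⟩,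
    fun _ _ _ => hE.weq_of_isIso (𝟙 Y) inferInstance⟩
  refine ⟨Z, ⟨fun W => ⟨⟨⟨ObjectProperty.homMk (ObjectProperty.homMk
      { app := fun i => hY.to_ _, naturality := fun _ _ _ => hY.eq_of_src _ _ })⟩,
      fun f => acyclic_hom_ext fun i => hY.eq_of_src _ _⟩⟩,
    fun W => ⟨⟨⟨ObjectProperty.homMk (ObjectProperty.homMk
      { app := fun i => hY.from_ _, naturality := fun _ _ _ => hY.eq_of_tgt _ _ })⟩,
      fun f => acyclic_hom_ext fun i => hY.eq_of_tgt _ _⟩⟩⟩, fun _ => hY⟩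

theorem isZero_acyclic_app (hE : IsWaldhausen E) {Z : AcyclicFilteredObj E n} (hZ : IsZero Z)
    (i : Fin n) : IsZero (Z.obj.obj.obj i) := by
  obtain ⟨Z', h, h'⟩ := exists_isZero_acyclic hE n
  exact (h' i).of_iso ((acyclicEval E i).mapIso (hZ.iso h))

theorem IsWaldhausen.acyclic (hE : IsWaldhausen E)
    (hw : ∀ {A B : E} (f : A ⟶ B), weq f → cof f)
    (hc : ∀ {A B D : E} (f : A ⟶ B) (g : B ⟶ D), weq f → weq (f ≫ g) → weq g) (n : ℕ) :
    IsWaldhausen (AcyclicFilteredObj E n) where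
  hasZeroObject := ⟨(exists_isZero_acyclic hE n).imp fun _ h => h.1⟩
  cof_of_isIso f _ := (acyclic_cof_iff hE hw hc f).2 fun i =>
    hE.cof_of_isIso _ (isIso_acyclic_app f i)
  cof_comp f g hf hg := (acyclic_cof_iff hE hw hc _).2 fun i =>
    hE.cof_comp _ _ ((acyclic_cof_iff hE hw hc f).1 hf i) ((acyclic_cof_iff hE hw hc g).1 hg i)
  cof_of_isZero f hZ := (acyclic_cof_iff hE hw hc f).2 fun i =>
    hE.cof_of_isZero _ (isZero_acyclic_app hE hZ i)
  hasPushout f g hf := by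
    obtain ⟨P, inl, inr, h⟩ :=
      exists_isPushout_acyclic hE hw f g ((acyclic_cof_iff hE hw hc f).1 hf)
    exact (isPushout_acyclic h).hasPushout
  cof_cobaseChange hp hf := (acyclic_cof_iff hE hw hc _).2 fun i =>
    hE.cof_cobaseChange (isPushout_acyclic_app hE hw ((acyclic_cof_iff hE hw hc _).1 hf) hp i)
      ((acyclic_cof_iff hE hw hc _).1 hf i)
  weq_of_isIso f _ i := hE.weq_of_isIso _ (isIso_acyclic_app f i)
  weq_comp f g hf hg i := hE.weq_comp _ _ (hf i) (hg i)
  gluing α β δ φ hp hp' hf hf' e1 e2 e3 e4 hα hβ hδ i := by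
    rw [acyclic_cof_iff hE hw hc] at hf hf'
    exact hE.gluing _ _ _ (φ.hom.hom.app i) (isPushout_acyclic_app hE hw hf hp i)
      (isPushout_acyclic_app hE hw hf' hp' i) (hf i) (hf' i)
      (congrArg (acyclicEval E i).map e1) (congrArg (acyclicEval E i).map e2)
      (congrArg (acyclicEval E i).map e3) (congrArg (acyclicEval E i).map e4) (hα i) (hβ i) (hδ i)

end Acyclic

end General

/-! ### `SC(C)` and `W_n SC(C)` are Waldhausen categories -/

theorem isWaldhausen_SC : IsWaldhausen (SC C) where
  hasZeroObject := ⟨empty C, isZero_empty⟩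
  cof_of_isIso f hf := cof_of_weq (weq_of_isIso f hf)
  cof_comp _ _ := cof_comp
  cof_of_isZero f hZ := cof_of_isEmpty f (isEmpty_idx_of_isZero hZ)
  hasPushout f g hf := by
    obtain ⟨P, inl, inr, h, -⟩ := exists_isPushout_of_cof hf g
    exact h.hasPushout
  cof_cobaseChange := cof_cobaseChange
  weq_of_isIso := weq_of_isIso
  weq_comp _ _ := weq_comp
  gluing α β δ φ hp hp' _ _ e1 e2 e3 e4 hα hβ hδ :=
    weq_gluing (fun _ _ => weq_comp) weq_of_isIso (fun _ => epi_of_weq)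
      (fun _ g hf => exists_isPushout_of_weq hf g) α β δ φ hp hp' e1 e2 e3 e4 hα hβ hδ

theorem isWaldhausen_acyclic (n : ℕ) : IsWaldhausen (AcyclicFilteredObj (SC C) n) :=
  isWaldhausen_SC.acyclic (fun _ => cof_of_weq) (fun _ _ => weq_of_weq_comp) n

theorem acyclic_cof_SC_iff {n : ℕ} {A B : AcyclicFilteredObj (SC C) n} (f : A ⟶ B) :
    cof f ↔ ∀ i, cof (f.hom.hom.app i) :=
  acyclic_cof_iff isWaldhausen_SC (fun _ => cof_of_weq) (fun _ _ => weq_of_weq_comp) f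

/-! ### Corner maps in `SC C` -/

namespace SC

/-- In a square of cofibrations whose images intersect in the image of the source, the map from
the pushout is a cofibration. -/
theorem exists_isPushout_cof_desc {A A' B B' : SC C} {a : A ⟶ A'} {b : B ⟶ B'} {f : A ⟶ B}
    {f' : A' ⟶ B'} (ha : cof a) (hb : cof b) (hf' : cof f') (w : a ≫ f' = f ≫ b)
    (h : ∀ x, x ∈ im b → x ∈ im f' → x ∈ im (f ≫ b)) :
    ∃ (P : SC C) (inl : B ⟶ P) (inr : A' ⟶ P) (d : P ⟶ B'),
      IsPushout f a inl inr ∧ inl ≫ d = b ∧ inr ≫ d = f' ∧ cof d := by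
  -- The pushout is written as a coproduct of `P₁`, which receives a weak equivalence `r` from `B`,
  -- and of the members of `A'` outside the image of `a`. The map `d` is then tested on the two
  -- summands.
  obtain ⟨P₁, i, r, h₁, hr⟩ := exists_isPushout_of_weq (weq_proj_of_cof ha) f
  have h₂ := isPushout_incl A' (im a) i
  have hp := h₁.paste_horiz h₂
  rw [comp_proj_im_incl] at hp
  refine ⟨_, _, _, hp.desc f' b w, hp.flip, hp.inr_desc _ _ _, hp.inl_desc _ _ _, ?_⟩
  have ht : r ≫ inl P₁ (A'.restr (im a)ᶜ) ≫ hp.desc f' b w = b := by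
    rw [← Category.assoc]
    exact hp.inr_desc _ _ _
  have hfalse : inr P₁ (A'.restr (im a)ᶜ) ≫ hp.desc f' b w = A'.incl (im a)ᶜ ≫ f' := by
    have e : inr P₁ (A'.restr (im a)ᶜ) =
        A'.incl (im a)ᶜ ≫ inv (splitMap A' (im a)) ≫ sumMap i (A'.restr (im a)ᶜ) := by
      rw [← inr_splitMap, Category.assoc, IsIso.hom_inv_id_assoc, inr_sumMap]
    rw [e, Category.assoc, hp.inl_desc]
  refine cof_of_inl_inr (cof_of_weq_comp hr (by rw [ht]; exact hb))
    (by rw [hfalse]; exact cof_comp (cof_incl _ _) hf') fun p a' x hx hx' => ?_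
  obtain ⟨y, hy⟩ := exists_rel_of_weq hr p
  have hyx : Rel b y x := by
    rw [← ht, rel_comp]
    exact ⟨p, hy, hx⟩
  rw [hfalse, rel_comp] at hx'
  obtain ⟨a₁, ha₁, hx'⟩ := hx'
  obtain rfl := (rel_incl _ _).1 ha₁
  -- A common image `x` of the two summands comes from `A` by hypothesis; injectivity of `f'` then
  -- places the member of `A'` in the image of `a`, from which it was excluded.
  obtain ⟨z, hz⟩ := (mem_im _ _).1 (h x ((mem_im _ _).2 ⟨_, hyx⟩) ((mem_im _ _).2 ⟨_, hx'⟩))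
  rw [← w, rel_comp] at hz
  obtain ⟨a₂, hz, ha₂⟩ := hz
  obtain rfl := rel_injective_of_cof hf' ha₂ hx'
  exact a'.2 ((mem_im _ _).2 ⟨z, hz⟩)

/-! ### Shuffles -/

/-- Morphisms which are pure shuffles. -/
def IsShuffle {A B : SC C} (f : A ⟶ B) : Prop := ∃ σ : TwHor A B, f = ofHor σ

theorem IsShuffle.comp {A B D : SC C} {f : A ⟶ B} {g : B ⟶ D} (hf : IsShuffle f)
    (hg : IsShuffle g) : IsShuffle (f ≫ g) := by
  obtain ⟨σ, rfl⟩ := hf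
  obtain ⟨τ, rfl⟩ := hg
  exact ⟨_, ofHor_comp σ τ⟩

theorem isShuffle_incl (A : SC C) (S : Set A.Idx) : IsShuffle (A.incl S) := ⟨_, rfl⟩

theorem isShuffle_inj {ι : Type} [Finite ι] (A : ι → SC C) (i : ι) : IsShuffle (inj A i) :=
  ⟨_, rfl⟩

theorem isShuffle_sigmaDesc {ι : Type} [Finite ι] {A : ι → SC C} {B : SC C} {f : ∀ i, A i ⟶ B}
    (hf : ∀ i, IsShuffle (f i)) : IsShuffle (sigmaDesc f) := by
  choose σ hσ using hf
  refine ⟨⟨fun x => (σ x.1).toFun x.2, fun x => (σ x.1).hom x.2⟩, sigma_hom_ext fun i => ?_⟩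
  rw [inj_sigmaDesc, hσ, inj_eq_ofHor, ofHor_comp]
  change _ = ofHor ⟨(σ i).toFun, fun a => hcomp (hid _) ((σ i).hom a)⟩
  simp only [hid_hcomp]

theorem IsShuffle.comp_proj {A B : SC C} {f : A ⟶ B} (hf : IsShuffle f) (T : Set B.Idx)
    (h : ∀ i j, Rel f i j → j ∈ T) : IsShuffle (f ≫ B.proj T) := by
  obtain ⟨σ, rfl⟩ := hf
  have hT : ∀ i, σ.toFun i ∈ T := fun i => h i _ ((rel_ofHor _ _ _).2 rfl)
  refine ⟨⟨fun i => ⟨σ.toFun i, hT i⟩, σ.hom⟩, hom_ext fun i j x y g => ?_⟩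
  rw [graph_comp_proj, graph_ofHor, graph_ofHor, Subtype.ext_iff]

/-- For a pure shuffle invertibility is a question about indices only; the comparisons with strands
are shown to be isomorphisms in this way. -/
theorem IsShuffle.isIso {A B : SC C} {f : A ⟶ B} (hf : IsShuffle f)
    (h : ∀ j, ∃! i, Rel f i j) : IsIso f := by
  obtain ⟨σ, rfl⟩ := hf
  simp only [rel_ofHor] at h
  exact isIso_ofHor σ ((Function.bijective_iff_existsUnique _).2 h)

/-- Levels of strands and paddings often agree only up to a provable equality. Transport is then
done by a structure map of the sequence, which is an identity in disguise. -/
theorem isShuffle_map_of_eq {n : ℕ} (A : Fin n ⥤ SC C) {l k : Fin n} (h : l = k) :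
    IsShuffle (A.map (homOfLE h.le)) := by
  subst h
  exact ⟨_, (A.map_id l).trans (ofHor_hid _).symm⟩

/-! ### Index relations and commutative squares for restrictions and coproducts -/

theorem rel_incl_comp {A B : SC C} {S : Set A.Idx} (f : A ⟶ B) (i : S) (j : B.Idx) :
    Rel (A.incl S ≫ f) i j ↔ Rel f i.1 j := by
  simp only [rel_comp, rel_incl, exists_eq_left']

theorem rel_comp_proj {A B : SC C} {T : Set B.Idx} (f : A ⟶ B) (i : A.Idx) (j : T) :
    Rel (f ≫ B.proj T) i j ↔ Rel f i j.1 := by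
  simp only [rel_comp, rel_proj, exists_eq_right]

theorem rel_inj_comp_inj {ι : Type} [Finite ι] {κ : ι → Type} [∀ i, Finite (κ i)]
    (A : ∀ i, κ i → SC C) (i : ι) (k : κ i) (a : (A i k).Idx)
    (b : (sigma fun i => sigma (A i)).Idx) :
    Rel (inj (A i) k ≫ inj (fun i => sigma (A i)) i) a b ↔ b = ⟨i, k, a⟩ := by
  rw [rel_comp]
  constructor
  · rintro ⟨x, hx, hb⟩
    obtain rfl := (rel_inj _ _ _ _).1 hx
    obtain rfl := (rel_inj _ _ _ _).1 hb
    rfl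
  · rintro rfl
    exact ⟨_, (rel_inj _ _ _ _).2 rfl, (rel_inj _ _ _ _).2 rfl⟩

theorem sigmaMap_sigmaDesc_eq {ι ι' : Type} [Finite ι] [Finite ι'] {A : ι → SC C}
    {B : ι' → SC C} {D D' : SC C} {e : ι → ι'} {f : ∀ i, A i ⟶ B (e i)} {g : ∀ i, B i ⟶ D'}
    {g' : ∀ i, A i ⟶ D} {k : D ⟶ D'} (h : ∀ i, f i ≫ g (e i) = g' i ≫ k) :
    sigmaMap e f ≫ sigmaDesc g = sigmaDesc g' ≫ k := by
  refine sigma_hom_ext fun i => ?_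
  rw [← Category.assoc, inj_sigmaMap, Category.assoc, inj_sigmaDesc, ← Category.assoc,
    inj_sigmaDesc, h]

theorem restrMap_incl_comp {A A' B B' : SC C} {f : A ⟶ B} {g : B ⟶ B'} {g' : A ⟶ A'}
    {k : A' ⟶ B'} {S : Set A.Idx} {T : Set B.Idx} (h : ∀ i j, i ∈ S → Rel f i j → j ∈ T)
    (e : f ≫ g = g' ≫ k) : restrMap f S T ≫ B.incl T ≫ g = (A.incl S ≫ g') ≫ k := by
  have := comp_proj_incl (A.incl S ≫ f) T fun i j hr => h _ _ i.2 ((rel_incl_comp _ _ _).1 hr)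
  calc restrMap f S T ≫ B.incl T ≫ g
      = ((A.incl S ≫ f) ≫ B.proj T ≫ B.incl T) ≫ g := by simp only [restrMap, Category.assoc]
    _ = (A.incl S ≫ g') ≫ k := by rw [this, Category.assoc, e, Category.assoc]

theorem comp_proj_restrMap {X Y A B : SC C} {x : X ⟶ Y} {t : X ⟶ A} {t' : Y ⟶ B} {f : A ⟶ B}
    {S : Set A.Idx} (T : Set B.Idx) (h : ∀ i j, Rel t i j → j ∈ S) (e : x ≫ t' = t ≫ f) :
    x ≫ t' ≫ B.proj T = (t ≫ A.proj S) ≫ restrMap f S T := by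
  have := comp_proj_incl t S h
  calc x ≫ t' ≫ B.proj T = (t ≫ A.proj S ≫ A.incl S) ≫ f ≫ B.proj T := by
        rw [this, ← Category.assoc, e, Category.assoc]
    _ = (t ≫ A.proj S) ≫ restrMap f S T := by simp only [restrMap, Category.assoc]

theorem comp_inj_inj {ι : Type} [Finite ι] {κ κ' : ι → Type} [∀ i, Finite (κ i)]
    [∀ i, Finite (κ' i)] {A : ∀ i, κ i → SC C} {B : ∀ i, κ' i → SC C} {e : ∀ i, κ i → κ' i}
    {f : ∀ i k, A i k ⟶ B i (e i k)} {i : ι} {k : κ i} {X Y : SC C} {x : X ⟶ Y}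
    {a : X ⟶ A i k} {a' : Y ⟶ B i (e i k)} (h : x ≫ a' = a ≫ f i k) :
    x ≫ a' ≫ inj (B i) (e i k) ≫ inj (fun i => sigma (B i)) i =
      (a ≫ inj (A i) k ≫ inj (fun i => sigma (A i)) i) ≫
        sigmaMap (fun i => i) fun i => sigmaMap (e i) (f i) := by
  rw [Category.assoc, Category.assoc, inj_sigmaMap, ← Category.assoc (inj _ _), inj_sigmaMap,
    ← Category.assoc x, h]
  simp only [Category.assoc]

end SC

/-! ### Layered morphisms -/

section Layered

variable {n : ℕ}

/-- By layeredness a member of `A_k` outside the image of `A_i` does not reach the image of `B_i`.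
So the images of `B_i` and `A_k` in `B_k` meet only in the image of `A_i`, and
`exists_isPushout_cof_desc` applies. -/
theorem layered_cof_iff {A B : LayeredObj C n} (f : A ⟶ B) :
    cof f ↔ ∀ k, cof (f.hom.hom.app k) := by
  refine ⟨fun h => h.1, fun h => ⟨h, fun i k hik => ?_⟩⟩
  refine exists_isPushout_cof_desc (A.obj.property _ _ _) (B.obj.property _ _ _) (h k)
    (f.hom.hom.naturality _) fun x hx hx' => ?_
  obtain ⟨a, ha⟩ := (mem_im _ _).1 hx'
  have ha' : a ∈ im (A.obj.obj.map (homOfLE hik.le)) := by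
    by_contra hne
    exact IsLayered.not_mem_im f.property hik ha hne hx
  obtain ⟨z, hz⟩ := (mem_im _ _).1 ha'
  rw [← f.hom.hom.naturality]
  exact (mem_im _ _).2 ⟨z, (rel_comp _ _ _ _).2 ⟨a, hz, ha⟩⟩

/-- The strand is found at the least level from which the member `b` comes. -/
theorem exists_mem_strandIdx (A : Fin n ⥤ SC C) {k : Fin n} (b : (A.obj k).Idx) :
    ∃ (i : Fin n) (h : i ≤ k), b ∈ strandIdx A h := by
  have hne : {i : Fin n | ∃ h : i ≤ k, b ∈ im (A.map (homOfLE h))}.Nonempty := by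
    refine ⟨k, le_rfl, (mem_im _ _).2 ⟨b, ?_⟩⟩
    have : A.map (homOfLE (le_refl k)) = 𝟙 _ := A.map_id k
    rw [this, rel_id]
  obtain ⟨i, ⟨h, hb⟩, hmin⟩ := wellFounded_lt.has_min _ hne
  obtain ⟨a, ha⟩ := (mem_im _ _).1 hb
  refine ⟨i, h, (mem_strandIdx _ _ _).2 ⟨a, fun i' hi' hai => ?_, ha⟩⟩
  have hlt : i' < i := Fin.lt_def.2 (by omega)
  obtain ⟨z, hz⟩ := (mem_im _ _).1 hai
  refine hmin i' ⟨hlt.le.trans h, (mem_im _ _).2 ⟨z, ?_⟩⟩ hlt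
  have : A.map (homOfLE (hlt.le.trans h)) = A.map (homOfLE hlt.le) ≫ A.map (homOfLE h) := by
    rw [← A.map_comp]; rfl
  rw [this, rel_comp]
  exact ⟨a, hz, ha⟩

/-- If `b` already comes from an earlier level, then its preimage at level `i'`, unique because
cofibrations are injective on indices, lies in the image of level `i' - 1` and so is not new. -/
theorem eq_of_mem_strandIdx (A : FilteredObj (SC C) n) {i i' k : Fin n} (h : i ≤ k) (h' : i' ≤ k)
    {b : (A.obj.obj k).Idx} (hb : b ∈ strandIdx A.obj h) (hb' : b ∈ strandIdx A.obj h') :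
    i = i' := by
  wlog hlt : i < i' generalizing i i'
  · rcases lt_trichotomy i i' with h1 | h1 | h1
    · exact this h h' hb hb' h1
    · exact h1
    · exact (this h' h hb' hb h1).symm
  exfalso
  obtain ⟨a, -, ha⟩ := (mem_strandIdx _ _ _).1 hb
  obtain ⟨a', hnew, ha'⟩ := (mem_strandIdx _ _ _).1 hb'
  let j : Fin n := ⟨i'.1 - 1, by omega⟩
  have hlt' := Fin.lt_def.1 hlt
  have hij : i ≤ j := Fin.le_def.2 (by change i.1 ≤ i'.1 - 1; omega)
  have hji : j ≤ i' := Fin.le_def.2 (by change i'.1 - 1 ≤ i'.1; omega)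
  have e : A.obj.map (homOfLE h) =
      (A.obj.map (homOfLE hij) ≫ A.obj.map (homOfLE hji)) ≫ A.obj.map (homOfLE h') := by
    rw [← A.obj.map_comp, ← A.obj.map_comp]; rfl
  rw [e, rel_comp] at ha
  obtain ⟨d, hd, hdb⟩ := ha
  obtain rfl := rel_injective_of_cof (A.property _ _ _) hdb ha'
  obtain ⟨c, -, hc⟩ := (rel_comp _ _ _ _).1 hd
  exact hnew j (by change i'.1 - 1 + 1 = i'.1; omega) ((mem_im _ _).2 ⟨c, hc⟩)

theorem cof_strands_map {A B : LayeredObj C n} (f : A ⟶ B) (hf : cof f) :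
    cof ((strands C n).map f) := fun _ => (acyclic_cof_SC_iff _).2 fun _ =>
  cof_restrMap ((layered_cof_iff f).1 hf _) _ _ fun a b ha hab =>
    IsLayered.mem_strandIdx f.property _ a b ha hab

/-- For surjectivity on a strand, a preimage of `b` lies in some strand of `A`; its image lies in
the strand of `B` with the same number, and strands are disjoint. -/
theorem weq_strands_map {A B : LayeredObj C n} (f : A ⟶ B) (hf : weq f) :
    weq ((strands C n).map f) := fun _ _ => by
  refine weq_restrMap (cof_of_weq (hf _)) _ _ fun b => ⟨fun hb => ?_, ?_⟩
  · obtain ⟨a, ha⟩ := exists_rel_of_weq (hf _) b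
    obtain ⟨i, hi, hai⟩ := exists_mem_strandIdx A.obj.obj a
    obtain rfl := eq_of_mem_strandIdx B.obj _ _ hb
      (IsLayered.mem_strandIdx f.property hi a b hai ha)
    exact ⟨a, hai, ha⟩
  · rintro ⟨a, ha, hab⟩
    exact IsLayered.mem_strandIdx f.property _ a b ha hab

theorem cof_coprodPaddings_map {X Y : ∀ m : Fin n, AcyclicFilteredObj (SC C) (m.1 + 1)}
    (f : X ⟶ Y) (hf : cof f) : cof ((coprodPaddings C n).map f) :=
  (layered_cof_iff _).2 fun _ => cof_sigmaMap _ Function.injective_id _ fun _ =>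
    cof_sigmaMap _ Function.injective_id _ fun _ => (hf _).1 _

theorem weq_coprodPaddings_map {X Y : ∀ m : Fin n, AcyclicFilteredObj (SC C) (m.1 + 1)}
    (f : X ⟶ Y) (hf : weq f) : weq ((coprodPaddings C n).map f) := fun _ =>
  weq_sigmaMap _ fun _ => weq_sigmaMap _ fun _ => hf _ _

/-- Levelwise isomorphisms are layered. -/
theorem isLayered_of_isIso {A B : FilteredObj (SC C) n} (f : A ⟶ B)
    (hf : ∀ k, IsIso (f.hom.app k)) : IsLayered C n f := by
  have hw : ∀ k, weq (f.hom.app k) := fun k => weq_of_isIso _ (hf k)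
  refine isLayered_of_rel f fun i k h a b hab => ⟨fun ha => ?_, fun hb => ?_⟩
  · obtain ⟨a₀, ha₀⟩ := (mem_im _ _).1 ha
    have h1 : Rel (A.obj.map (homOfLE h.le) ≫ f.hom.app k) a₀ b :=
      (rel_comp _ _ _ _).2 ⟨a, ha₀, hab⟩
    rw [f.hom.naturality, rel_comp] at h1
    obtain ⟨b₀, -, hb₀⟩ := h1
    exact (mem_im _ _).2 ⟨b₀, hb₀⟩
  · obtain ⟨b₀, hb₀⟩ := (mem_im _ _).1 hb
    obtain ⟨a₀, ha₀⟩ := exists_rel_of_weq (hw i) b₀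
    have h1 : Rel (f.hom.app i ≫ B.obj.map (homOfLE h.le)) a₀ b :=
      (rel_comp _ _ _ _).2 ⟨b₀, ha₀, hb₀⟩
    rw [← f.hom.naturality, rel_comp] at h1
    obtain ⟨a₁, ha₁, hab₁⟩ := h1
    obtain rfl := rel_injective_of_cof (cof_of_weq (hw k)) hab₁ hab
    exact (mem_im _ _).2 ⟨a₀, ha₁⟩

/-- Levelwise isomorphisms are isomorphisms of `L_n SC(C)`. -/
theorem isIso_layered {A B : LayeredObj C n} (f : A ⟶ B) (hf : ∀ k, IsIso (f.hom.hom.app k)) :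
    IsIso f := by
  let g : B.obj ⟶ A.obj := ObjectProperty.homMk
    { app := fun k => inv (f.hom.hom.app k)
      naturality := fun i j h => by
        rw [IsIso.eq_inv_comp, ← Category.assoc, IsIso.comp_inv_eq, f.hom.hom.naturality] }
  have hg : IsLayered C n g := isLayered_of_isIso g fun k =>
    inferInstanceAs (IsIso (inv (f.hom.hom.app k)))
  refine ⟨⟨g, hg⟩, ?_, ?_⟩
  · apply WideSubcategory.hom_ext
    apply ObjectProperty.hom_ext
    ext k : 2
    exact IsIso.hom_inv_id (f.hom.hom.app k)
  · apply WideSubcategory.hom_ext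
    apply ObjectProperty.hom_ext
    ext k : 2
    exact IsIso.inv_hom_id (f.hom.hom.app k)

theorem isIso_acyclic {X Y : AcyclicFilteredObj (SC C) n} (f : X ⟶ Y)
    (hf : ∀ k, IsIso (f.hom.hom.app k)) : IsIso f := by
  refine ⟨ObjectProperty.homMk (ObjectProperty.homMk
    { app := fun k => inv (f.hom.hom.app k)
      naturality := fun i j h => by
        rw [IsIso.eq_inv_comp, ← Category.assoc, IsIso.comp_inv_eq, f.hom.hom.naturality] }),
    acyclic_hom_ext fun k => ?_, acyclic_hom_ext fun k => ?_⟩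
  · exact IsIso.hom_inv_id (f.hom.hom.app k)
  · exact IsIso.inv_hom_id (f.hom.hom.app k)

end Layered

/-! ### The coproduct of the strands of an object -/

section Unit

variable {n : ℕ}

theorem strandLevel_sub (m k : Fin n) (h : n - 1 - m.1 ≤ k.1) :
    strandLevel m ⟨k.1 - (n - 1 - m.1), by omega⟩ = k :=
  Fin.ext (by simp only [strandLevel]; omega)

/-- The inclusion of a strand at the level `k`. -/
noncomputable def strandInclusion (A : FilteredObj (SC C) n) (m k : Fin n)
    (h : n - 1 - m.1 ≤ k.1) :
    (strandFunctor A.obj m).obj ⟨k.1 - (n - 1 - m.1), by omega⟩ ⟶ A.obj.obj k :=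
  -- The second factor only corrects the level, which equals `k` up to a provable equality.
  (A.obj.obj _).incl _ ≫ A.obj.map (homOfLE (strandLevel_sub m k h).le)

theorem isShuffle_strandInclusion (A : FilteredObj (SC C) n) (m k : Fin n)
    (h : n - 1 - m.1 ≤ k.1) : IsShuffle (strandInclusion A m k h) :=
  (isShuffle_incl _ _).comp (isShuffle_map_of_eq A.obj (strandLevel_sub m k h))

theorem rel_map_of_eq (A : Fin n ⥤ SC C) {l k : Fin n} (h : l = k) (b : (A.obj k).Idx) :
    ∃ a, Rel (A.map (homOfLE h.le)) a b := by
  subst h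
  refine ⟨b, ?_⟩
  have : A.map (homOfLE (le_refl l)) = 𝟙 _ := A.map_id l
  rw [this, rel_id]

theorem rel_strandInclusion (A : FilteredObj (SC C) n) (m k : Fin n) (h : n - 1 - m.1 ≤ k.1)
    (a : ((strandFunctor A.obj m).obj ⟨k.1 - (n - 1 - m.1), by omega⟩).Idx)
    (b : (A.obj.obj k).Idx) :
    Rel (strandInclusion A m k h) a b ↔
      Rel (A.obj.map (homOfLE (strandLevel_sub m k h).le)) a.1 b :=
  rel_incl_comp _ _ _

theorem mem_strandIdx_of_rel (A : FilteredObj (SC C) n) (m k : Fin n) (h : n - 1 - m.1 ≤ k.1)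
    (a : ((strandFunctor A.obj m).obj ⟨k.1 - (n - 1 - m.1), by omega⟩).Idx)
    (b : (A.obj.obj k).Idx) (hab : Rel (strandInclusion A m k h) a b) :
    b ∈ strandIdx A.obj (strandLevel_mono m (Fin.zero_le _) |>.trans
      (strandLevel_sub m k h).le) :=
  (strandIdx_succ _ _ _ _).2 ⟨a.1, a.2, (rel_strandInclusion _ _ _ _ _ _).1 hab⟩

/-- The canonical map from the coproduct of the strands of `A` to `A`, at the level `k`. -/
noncomputable def strandsDesc (A : FilteredObj (SC C) n) (k : Fin n) :
    (paddingsObj (strandObj A)).obj.obj k ⟶ A.obj.obj k :=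
  sigmaDesc fun m => sigmaDesc fun h : PLift (n - 1 - m.1 ≤ k.1) => strandInclusion A m k h.down

/-- The map is a pure shuffle, and it is bijective on indices because each member of `A_k` lies in
exactly one strand. -/
theorem isIso_strandsDesc (A : FilteredObj (SC C) n) (k : Fin n) : IsIso (strandsDesc A k) := by
  refine IsShuffle.isIso (isShuffle_sigmaDesc fun m => isShuffle_sigmaDesc fun h =>
    isShuffle_strandInclusion A m k h.down) fun b => ?_
  obtain ⟨i, hi, hb⟩ := exists_mem_strandIdx A.obj b
  -- Strands are indexed by their length minus one, so the strand that starts at level `i` has index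
  -- `n - 1 - i`.
  let m : Fin n := ⟨n - 1 - i.1, by omega⟩
  have him : n - 1 - m.1 = i.1 := by change n - 1 - (n - 1 - i.1) = i.1; omega
  have h : n - 1 - m.1 ≤ k.1 := him.trans_le (Fin.le_def.1 hi)
  obtain ⟨a, ha⟩ := rel_map_of_eq A.obj (strandLevel_sub m k h) b
  have him' : i = strandLevel m 0 := Fin.ext (by simp only [strandLevel]; exact him.symm)
  have key : ∀ {i i' : Fin n} (hi : i ≤ k) (e : i = i'), b ∈ strandIdx A.obj hi →
      b ∈ strandIdx A.obj (e.symm.trans_le hi) := by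
    rintro i _ hi rfl hb
    exact hb
  have hb' := key hi him' hb
  obtain ⟨a', ha', hr⟩ := (strandIdx_succ A.obj (strandLevel_mono m (Fin.zero_le
    (⟨k.1 - (n - 1 - m.1), by omega⟩ : Fin (m.1 + 1)))) (strandLevel_sub m k h).le b).1 hb'
  refine ⟨⟨m, ⟨h⟩, a', ha'⟩, ?_, ?_⟩
  · exact (rel_sigmaDesc _ _ _ _).2 ((rel_sigmaDesc _ _ _ _).2
      ((rel_strandInclusion A m k h ⟨a', ha'⟩ b).2 hr))
  · rintro ⟨m₂, ⟨h₂⟩, a₂⟩ hr₂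
    have hr₃ := (rel_sigmaDesc _ _ _ _).1 ((rel_sigmaDesc _ _ _ _).1 hr₂)
    have hb₂ := mem_strandIdx_of_rel A m₂ k h₂ a₂ b hr₃
    have e := congrArg Fin.val (eq_of_mem_strandIdx A _ _ hb' hb₂)
    simp only [strandLevel, Fin.val_zero, add_zero] at e
    obtain rfl : m₂ = m := Fin.ext (by omega)
    have := rel_injective_of_cof (A.property _ _ _)
      ((rel_strandInclusion A m k h₂ a₂ b).1 hr₃) hr
    obtain rfl : a₂ = ⟨a', ha'⟩ := Subtype.ext this
    rfl

theorem strandsDesc_naturality (A : FilteredObj (SC C) n) {k k' : Fin n} (g : k ⟶ k') :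
    (paddingsObj (strandObj A)).obj.map g ≫ strandsDesc A k' =
      strandsDesc A k ≫ A.obj.map g := by
  refine sigmaMap_sigmaDesc_eq fun m => sigmaMap_sigmaDesc_eq fun h => ?_
  refine restrMap_incl_comp
    (fun a b ha hab => (strandIdx_succ A.obj _ _ b).2 ⟨a, ha, hab⟩) ?_
  rw [← A.obj.map_comp, ← A.obj.map_comp]
  rfl

/-- The canonical map from the coproduct of the strands of `A` to `A`. -/
noncomputable def strandsDescHom (A : LayeredObj C n) :
    (strands C n ⋙ coprodPaddings C n).obj A ⟶ A :=
  ⟨ObjectProperty.homMk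
    { app := fun k => strandsDesc A.obj k
      naturality := fun _ _ g => strandsDesc_naturality A.obj g },
    isLayered_of_isIso _ fun k => isIso_strandsDesc A.obj k⟩

/-- Every object of `L_n SC(C)` is the coproduct of its strands. -/
noncomputable def strandsIso (C : PolytopeComplex.{v, u}) (n : ℕ) :
    strands C n ⋙ coprodPaddings C n ≅ 𝟭 (LayeredObj C n) :=
  NatIso.ofComponents
    (fun A => @asIso _ _ _ _ (strandsDescHom A)
      (isIso_layered _ fun k => isIso_strandsDesc A.obj k))
    (by
      intro A B f
      apply WideSubcategory.hom_ext
      apply ObjectProperty.hom_ext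
      ext k : 2
      exact sigmaMap_sigmaDesc_eq fun m => sigmaMap_sigmaDesc_eq fun h => restrMap_incl_comp
        (fun a b ha hab => IsLayered.mem_strandIdx f.property _ a b ha hab)
        (f.hom.hom.naturality _).symm)

end Unit

/-! ### The strands of a coproduct of paddings -/

section Counit

variable {n : ℕ}

theorem rel_paddingsObj_map_fst (X : ∀ m : Fin n, AcyclicFilteredObj (SC C) (m.1 + 1))
    {i k : Fin n} (g : i ⟶ k) {a b} (h : Rel ((paddingsObj X).obj.map g) a b) : a.1 = b.1 := by
  obtain ⟨m, a⟩ := a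
  obtain ⟨b', rfl, -⟩ := (rel_sigmaMap _ _ _ _ _).1 h
  rfl

/-- The summand `X_m` first appears at level `n - 1 - m`; all its later members come from the level
before. -/
theorem mem_newIdx_paddingsObj (X : ∀ m : Fin n, AcyclicFilteredObj (SC C) (m.1 + 1))
    {i : Fin n} (a : ((paddingsObj X).obj.obj i).Idx) :
    a ∈ newIdx (paddingsObj X).obj i ↔ n - 1 - a.1.1 = i.1 := by
  have ha : n - 1 - a.1.1 ≤ i.1 := by
    obtain ⟨m, h, a⟩ := a
    exact h.down
  simp only [newIdx, Set.mem_ofPred_eq, mem_im_paddingsObj]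
  constructor
  · intro h
    by_contra hne
    -- If `i` is not the first level of the summand, it is positive and the summand is already
    -- present at `i - 1`.
    exact h ⟨i.1 - 1, by omega⟩ (by change i.1 - 1 + 1 = i.1; omega)
      (by change _ ≤ i.1 - 1; omega)
  · intro h i' hi'
    omega

/-- The structure maps preserve summands, so the members born at level `i` keep filling the summand
that starts there. -/
theorem mem_strandIdx_paddingsObj (X : ∀ m : Fin n, AcyclicFilteredObj (SC C) (m.1 + 1))
    {i k : Fin n} (h : i ≤ k) (b : ((paddingsObj X).obj.obj k).Idx) :
    b ∈ strandIdx (paddingsObj X).obj h ↔ n - 1 - b.1.1 = i.1 := by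
  rw [mem_strandIdx]
  constructor
  · rintro ⟨a, ha, hr⟩
    rw [← rel_paddingsObj_map_fst X _ hr]
    exact (mem_newIdx_paddingsObj X a).1 ha
  · intro hb
    obtain ⟨a, ha⟩ := (mem_im _ _).1 ((mem_im_paddingsObj X (homOfLE h) b).2 hb.le)
    refine ⟨a, (mem_newIdx_paddingsObj X a).2 ?_, ha⟩
    rw [rel_paddingsObj_map_fst X _ ha, hb]

theorem sub_strandLevel (m : Fin n) (l : Fin (m.1 + 1)) (h : (strandLevel m l).1 -
    (n - 1 - m.1) < m.1 + 1) : l = ⟨(strandLevel m l).1 - (n - 1 - m.1), h⟩ :=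
  Fin.ext (by simp only [strandLevel]; omega)

theorem le_strandLevel (m : Fin n) (l : Fin (m.1 + 1)) : n - 1 - m.1 ≤ (strandLevel m l).1 := by
  simp only [strandLevel]; omega

/-- The summands of the coproduct of the paddings at the level `k`. -/
@[reducible] def padFam (X : ∀ m : Fin n, AcyclicFilteredObj (SC C) (m.1 + 1)) (k m : Fin n)
    (h : PLift (n - 1 - m.1 ≤ k.1)) : SC C :=
  (X m).obj.obj.obj ⟨k.1 - (n - 1 - m.1), by have := h.down; omega⟩

/-- The inclusion of a member of a family of sequences into the coproduct of the paddings. -/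
noncomputable def toPaddings (X : ∀ m : Fin n, AcyclicFilteredObj (SC C) (m.1 + 1)) (m : Fin n)
    (l : Fin (m.1 + 1)) : (X m).obj.obj.obj l ⟶ (paddingsObj X).obj.obj (strandLevel m l) :=
  (X m).obj.obj.map (homOfLE (sub_strandLevel m l (by have := (strandLevel m l).2; omega)).le) ≫
    inj (padFam X (strandLevel m l) m) ⟨le_strandLevel m l⟩ ≫
    inj (fun m' : Fin n => sigma (padFam X (strandLevel m l) m')) m

theorem isShuffle_toPaddings (X : ∀ m : Fin n, AcyclicFilteredObj (SC C) (m.1 + 1)) (m : Fin n)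
    (l : Fin (m.1 + 1)) : IsShuffle (toPaddings X m l) :=
  (isShuffle_map_of_eq _ (sub_strandLevel m l _)).comp
    ((isShuffle_inj _ _).comp (isShuffle_inj _ _))

theorem rel_toPaddings (X : ∀ m : Fin n, AcyclicFilteredObj (SC C) (m.1 + 1)) (m : Fin n)
    (l : Fin (m.1 + 1)) (a : ((X m).obj.obj.obj l).Idx)
    (b : ((paddingsObj X).obj.obj (strandLevel m l)).Idx) :
    Rel (toPaddings X m l) a b ↔ ∃ a', Rel ((X m).obj.obj.map (homOfLE
      (sub_strandLevel m l (by have := (strandLevel m l).2; omega)).le)) a a' ∧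
        b = ⟨m, ⟨le_strandLevel m l⟩, a'⟩ := by
  rw [toPaddings, rel_comp]
  exact exists_congr fun a' => and_congr Iff.rfl
    (rel_inj_comp_inj (padFam X (strandLevel m l)) m ⟨le_strandLevel m l⟩ a' b)

theorem toPaddings_mem (X : ∀ m : Fin n, AcyclicFilteredObj (SC C) (m.1 + 1)) (m : Fin n)
    (l : Fin (m.1 + 1)) (a : ((X m).obj.obj.obj l).Idx)
    (b : ((paddingsObj X).obj.obj (strandLevel m l)).Idx) (h : Rel (toPaddings X m l) a b) :
    b ∈ strandIdx (paddingsObj X).obj (strandLevel_mono m (Fin.zero_le l)) := by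
  obtain ⟨a', -, rfl⟩ := (rel_toPaddings X m l a b).1 h
  exact (mem_strandIdx_paddingsObj X _ _).2 (by simp [strandLevel])

/-- The canonical map from `X_m` to the strand of length `m + 1` of the coproduct of the
paddings, at the level `l`. -/
noncomputable def toStrand (X : ∀ m : Fin n, AcyclicFilteredObj (SC C) (m.1 + 1)) (m : Fin n)
    (l : Fin (m.1 + 1)) :
    (X m).obj.obj.obj l ⟶ (strandFunctor (paddingsObj X).obj m).obj l :=
  toPaddings X m l ≫ SC.proj _ _

theorem isIso_toStrand (X : ∀ m : Fin n, AcyclicFilteredObj (SC C) (m.1 + 1)) (m : Fin n)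
    (l : Fin (m.1 + 1)) : IsIso (toStrand X m l) := by
  refine ((isShuffle_toPaddings X m l).comp_proj _ (toPaddings_mem X m l)).isIso ?_
  rintro ⟨b, hb⟩
  have hr : ∀ a, Rel (toStrand X m l) a ⟨b, hb⟩ ↔ Rel (toPaddings X m l) a b :=
    fun a => rel_comp_proj _ _ _
  have hb' := (mem_strandIdx_paddingsObj X _ _).1 hb
  obtain ⟨m', ⟨h'⟩, b⟩ := b
  have e : n - 1 - m'.1 = (strandLevel m 0).1 := hb'
  simp only [strandLevel, Fin.val_zero, add_zero] at e
  obtain rfl : m = m' := Fin.ext (by omega)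
  obtain ⟨a, ha⟩ := rel_map_of_eq (X m).obj.obj (sub_strandLevel m l
    (by have := (strandLevel m l).2; omega)) b
  refine ⟨a, (hr _).2 ((rel_toPaddings X m l _ _).2 ⟨b, ha, rfl⟩), fun a₂ h₂ => ?_⟩
  obtain ⟨b₂, hb₂, e₂⟩ := (rel_toPaddings X m l _ _).1 ((hr _).1 h₂)
  obtain rfl : b = b₂ := by
    have := eq_of_heq (Sigma.mk.inj_iff.1 e₂).2
    exact eq_of_heq (Sigma.mk.inj_iff.1 this).2
  exact rel_injective_of_cof ((X m).obj.property _ _ _) hb₂ ha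

theorem toPaddings_naturality (X : ∀ m : Fin n, AcyclicFilteredObj (SC C) (m.1 + 1)) (m : Fin n)
    {l l' : Fin (m.1 + 1)} (g : l ⟶ l') :
    (X m).obj.obj.map g ≫ toPaddings X m l' =
      toPaddings X m l ≫ (paddingsObj X).obj.map
        (homOfLE (strandLevel_mono m (leOfHom g))) := by
  have hl : strandLevel m l ≤ strandLevel m l' := strandLevel_mono m (leOfHom g)
  have h : (X m).obj.obj.map g ≫ (X m).obj.obj.map (homOfLE (sub_strandLevel m l'
      (by have := (strandLevel m l').2; omega)).le) =
      (X m).obj.obj.map (homOfLE (sub_strandLevel m l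
        (by have := (strandLevel m l).2; omega)).le) ≫
        (X m).obj.obj.map (homOfLE (Fin.le_def.2
          (Nat.sub_le_sub_right (Fin.le_def.1 hl) (n - 1 - m.1)))) := by
    rw [← Functor.map_comp, ← Functor.map_comp]
    rfl
  exact comp_inj_inj (A := padFam X (strandLevel m l)) (B := padFam X (strandLevel m l'))
    (e := fun _ h => ⟨h.down.trans (Fin.le_def.1 hl)⟩)
    (f := fun m' _ => (X m').obj.obj.map (homOfLE (Fin.le_def.2
      (Nat.sub_le_sub_right (Fin.le_def.1 hl) (n - 1 - m'.1)))))
    (i := m) (k := ⟨le_strandLevel m l⟩) h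

theorem toStrand_naturality (X : ∀ m : Fin n, AcyclicFilteredObj (SC C) (m.1 + 1)) (m : Fin n)
    {l l' : Fin (m.1 + 1)} (g : l ⟶ l') :
    (X m).obj.obj.map g ≫ toStrand X m l' =
      toStrand X m l ≫ (strandFunctor (paddingsObj X).obj m).map g :=
  comp_proj_restrMap _ (toPaddings_mem X m l) (toPaddings_naturality X m g)

/-- The canonical map from `X_m` to the strand of length `m + 1` of the coproduct of the
paddings. -/
noncomputable def toStrandHom (X : ∀ m : Fin n, AcyclicFilteredObj (SC C) (m.1 + 1)) (m : Fin n) :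
    X m ⟶ (coprodPaddings C n ⋙ strands C n).obj X m :=
  ObjectProperty.homMk (ObjectProperty.homMk
    { app := fun l => toStrand X m l
      naturality := fun _ _ g => toStrand_naturality X m g })

theorem toStrandHom_naturality {X Y : ∀ m : Fin n, AcyclicFilteredObj (SC C) (m.1 + 1)}
    (f : X ⟶ Y) (m : Fin n) :
    f m ≫ toStrandHom Y m = toStrandHom X m ≫ (coprodPaddings C n ⋙ strands C n).map f m :=
  acyclic_hom_ext fun l => comp_proj_restrMap _ (toPaddings_mem X m l)
    (comp_inj_inj (A := padFam X (strandLevel m l)) (B := padFam Y (strandLevel m l))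
      (e := fun _ h => h) (f := fun m' _ => (f m').hom.hom.app _) (i := m)
      (k := ⟨le_strandLevel m l⟩) ((f m).hom.hom.naturality _).symm)

/-- The strands of a coproduct of paddings are the original sequences. -/
noncomputable def paddingsIso (C : PolytopeComplex.{v, u}) (n : ℕ) :
    𝟭 (∀ m : Fin n, AcyclicFilteredObj (SC C) (m.1 + 1)) ≅ coprodPaddings C n ⋙ strands C n :=
  have : ∀ X (m : Fin n), IsIso (toStrandHom (C := C) X m) := fun X m =>
    isIso_acyclic _ fun l => isIso_toStrand X m l
  NatIso.ofComponents
    (fun X => ⟨fun m => toStrandHom X m, fun m => inv (toStrandHom X m),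
      funext fun m => IsIso.hom_inv_id (toStrandHom X m),
      funext fun m => IsIso.inv_hom_id (toStrandHom X m)⟩)
    (fun f => funext fun m => toStrandHom_naturality f m)

end Counit

/-! ### The equivalence -/

/-- The strand functor and the coproduct-of-paddings functor are inverse equivalences. -/
noncomputable def strandsEquivalence (C : PolytopeComplex.{v, u}) (n : ℕ) :
    LayeredObj C n ≌ (∀ m : Fin n, AcyclicFilteredObj (SC C) (m.1 + 1)) :=
  CategoryTheory.Equivalence.mk (strands C n) (coprodPaddings C n) (strandsIso C n).symm
    (paddingsIso C n).symm

instance (n : ℕ) : (strands C n).IsEquivalence := (strandsEquivalence C n).isEquivalence_functor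

instance (n : ℕ) : (coprodPaddings C n).IsEquivalence :=
  (strandsEquivalence C n).isEquivalence_inverse

/-! ### Detection of cofibrations and weak equivalences by strands -/

section Layered

variable {n : ℕ}

theorem isIso_layered_app {A B : LayeredObj C n} (f : A ⟶ B) [IsIso f] (k : Fin n) :
    IsIso (f.hom.hom.app k) :=
  inferInstanceAs (IsIso ((wideSubcategoryInclusion _ ⋙ ObjectProperty.ι _ ⋙
    (evaluation _ _).obj k).map f))

theorem weq_layered_of_isIso {A B : LayeredObj C n} (f : A ⟶ B) [IsIso f] : weq f :=
  fun k => weq_of_isIso _ (isIso_layered_app f k)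

theorem conj_strandsIso {A B : LayeredObj C n} (f : A ⟶ B) :
    f = (strandsIso C n).inv.app A ≫ (coprodPaddings C n).map ((strands C n).map f) ≫
      (strandsIso C n).hom.app B := by
  have := (strandsIso C n).hom.naturality f
  change (coprodPaddings C n).map ((strands C n).map f) ≫ _ = _ at this
  rw [this, Iso.inv_hom_id_app_assoc]
  rfl

/-- To reflect cofibrations, `f` is written as its image under both functors, conjugated by
isomorphisms. Composing is done levelwise in `SC C`, through `layered_cof_iff`, since the axioms for
`L_n` are not yet available. -/
theorem cof_iff_strands {A B : LayeredObj C n} (f : A ⟶ B) : cof f ↔ cof ((strands C n).map f) := by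
  refine ⟨cof_strands_map f, fun h => ?_⟩
  have h1 := (layered_cof_iff _).1 (cof_coprodPaddings_map _ h)
  rw [conj_strandsIso f, layered_cof_iff]
  exact fun k => cof_comp (cof_of_weq (weq_layered_of_isIso _ k))
    (cof_comp (h1 k) (cof_of_weq (weq_layered_of_isIso _ k)))

theorem weq_iff_strands {A B : LayeredObj C n} (f : A ⟶ B) : weq f ↔ weq ((strands C n).map f) := by
  refine ⟨weq_strands_map f, fun h => ?_⟩
  rw [conj_strandsIso f]
  exact fun k => weq_comp (weq_layered_of_isIso _ k)
    (weq_comp (weq_coprodPaddings_map _ h k) (weq_layered_of_isIso _ k))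

end Layered

theorem isWaldhausen_pi (C : PolytopeComplex.{v, u}) (n : ℕ) :
    IsWaldhausen (∀ m : Fin n, AcyclicFilteredObj (SC C) (m.1 + 1)) :=
  IsWaldhausen.pi fun _ => isWaldhausen_acyclic _

theorem isExactEquivalence_strands (C : PolytopeComplex.{v, u}) (n : ℕ) :
    IsExactEquivalence (strands C n) (coprodPaddings C n) where
  exact_functor := IsExactFunctor.of_isEquivalence _ cof_strands_map weq_strands_map
  exact_inverse := IsExactFunctor.of_isEquivalence _ cof_coprodPaddings_map weq_coprodPaddings_map
  equivalence := ⟨strandsEquivalence C n, rfl, rfl, fun _ => weq_layered_of_isIso _,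
    fun _ => (isWaldhausen_pi C n).weq_of_isIso _ inferInstance⟩

end ScissorsCongruence

open CategoryTheory ScissorsCongruence
theorem mainTheorem7 (C : PolytopeComplex.{v, u}) (n : ℕ) :
    IsWaldhausen (LayeredObj C n) ∧
    (∀ m : Fin n, IsWaldhausen (AcyclicFilteredObj (SC C) (m.1 + 1))) ∧
    IsWaldhausen (∀ m : Fin n, AcyclicFilteredObj (SC C) (m.1 + 1)) ∧
    IsExactEquivalence (strands C n) (coprodPaddings C n) :=
  ⟨(isWaldhausen_pi C n).of_isEquivalence (strands C n) cof_iff_strands weq_iff_strands,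
    fun _ => isWaldhausen_acyclic _, isWaldhausen_pi C n, isExactEquivalence_strands C n⟩
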